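/- Theorem 2.3 (Genus zero). Let $S^2\subset\mathbb{R}^3$ be the unit sphere with its outward orientation, let $x_0\in S^2$, and let $\omega$ be a smooth positive area form on $S^2$ with $\int_{S^2}\omega=1$ (for instance the normalized area form of a Riemannian metric). Let $\Phi(S^2)$ be the path group of $S^2$ at $x_0$: its elements are the piecewise smooth closed paths $[0,1]\to S^2$ based at $x_0$, modulo the equivalence relation generated by orientation-preserving reparametrization (continuous nondecreasing changes of parameter of $[0,1]$ onto itself) and by clipping retraced pieces (if $\sigma|_{[t_2,t_3]}$ retraces $\sigma|_{[t_1,t_2]}$ backwards, $\sigma$ is identified with the path that rests at $\sigma(t_1)$ on $[t_1,t_3]$ and equals $\sigma$ elsewhere); the product is concatenation and the inverse is reversal of orientation. For a closed path $\sigma$, a disc bounded by $\sigma$ is a continuous map $D$ from the closed unit disc to $S^2$ whose boundary, traversed counterclockwise from angle $0$, is $\sigma$, and which in polar coordinates $(r,\theta)$ is smooth on each closed cell of some finite grid, and its signed area is $\int_D\omega$. Let $\Phi_\omega(S^2)\subset\Phi(S^2)$ be the set of classes of closed paths that bound a disc of signed area $0$. Then $\Phi_\omega(S^2)$ is a normal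 subgroup of $\Phi(S^2)$ and, as groups, $$\Phi(S^2)/\Phi_\omega(S^2)\;\cong\;U(1)\;\cong\;\mathbb{R}/\mathbb{Z}.$$ More precisely, there is a group isomorphism $\Phi(S^2)/\Phi_\omega(S^2)\to\mathbb{R}/\mathbb{Z}$ that sends the class of $\sigma$ to $\int_D\omega$ modulo $\mathbb{Z}$, for every closed path $\sigma$ at $x_0$ and every disc $D$ bounded by $\sigma$. The enclosed area is defined exactly modulo the total area $1$: for every closed path $\sigma$ at $x_0$ there is $a\in\mathbb{R}$ such that the set of signed areas of discs bounded by $\sigma$ is $a+\mathbb{Z}$. -/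

import Mathlib

open Set MeasureTheory
open scoped Manifold ContDiff

noncomputable section

namespace SpherePaths

abbrev E3 := EuclideanSpace ℝ (Fin 3)

/-- The sphere `S²`, as the unit sphere of Euclidean space. -/
abbrev S2 := Metric.sphere (0 : E3) 1

/-! ### Piecewise smooth loops -/

/-- A path on the sphere is piecewise smooth if there are finitely many break points such that the
path is smooth on every closed subinterval of `[0,1]` with no break point in its interior. -/
def PiecewiseSmooth {x y : S2} (γ : Path x y) : Prop :=
  ∃ F : Finset ℝ, ∀ a b : ℝ, 0 ≤ a → a < b → b ≤ 1 → (∀ t ∈ F, t ∉ Ioo a b) →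
    ContDiffOn ℝ ∞ (fun t => (γ.extend t : E3)) (Icc a b)

/-- Parametrized piecewise smooth loops on the sphere based at `x₀`. -/
structure Loop (x₀ : S2) where
  path : Path x₀ x₀
  smooth : PiecewiseSmooth path

variable {x₀ : S2}

/-- The loop as a function of a real parameter; only the values on `[0,1]` matter. -/
def Loop.fn (σ : Loop x₀) (t : ℝ) : S2 := σ.path.extend t

theorem Loop.ext_fn {σ τ : Loop x₀} (h : ∀ t ∈ Icc (0 : ℝ) 1, σ.fn t = τ.fn t) : σ = τ := by
  obtain ⟨p, hp⟩ := σ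
  obtain ⟨q, hq⟩ := τ
  have : p = q := by
    refine Path.ext (funext fun t => ?_)
    simpa [Loop.fn] using h t t.2
  subst this
  rfl

/-- `τ` is an orientation preserving reparametrization of `σ` (pauses are allowed). -/
def IsReparam (σ τ : Loop x₀) : Prop :=
  ∃ φ : ℝ → ℝ, Continuous φ ∧ Monotone φ ∧ φ 0 = 0 ∧ φ 1 = 1 ∧
    ∀ t ∈ Icc (0 : ℝ) 1, τ.fn t = σ.fn (φ t)

/-- `τ` arises from `σ` by clipping a retraced piece: `σ` restricted to `[t₁,t₂]` and `σ`
restricted to `[t₂,t₃]` run through the same points with opposite orientations, and `τ` rests at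
`σ(t₁)` during `[t₁,t₃]` and agrees with `σ` otherwise. The two pieces are compared by means of
an increasing parametrization `α` of `[t₁,t₂]` and a decreasing parametrization `β` of
`[t₂,t₃]`. -/
def IsClipping (σ τ : Loop x₀) : Prop :=
  ∃ t₁ t₂ t₃ : ℝ, 0 ≤ t₁ ∧ t₁ ≤ t₂ ∧ t₂ ≤ t₃ ∧ t₃ ≤ 1 ∧
    (∃ α β : ℝ → ℝ, Continuous α ∧ Monotone α ∧ α 0 = t₁ ∧ α 1 = t₂ ∧
      Continuous β ∧ Antitone β ∧ β 0 = t₃ ∧ β 1 = t₂ ∧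
      ∀ u ∈ Icc (0 : ℝ) 1, σ.fn (α u) = σ.fn (β u)) ∧
    (∀ t ∈ Icc t₁ t₃, τ.fn t = σ.fn t₁) ∧
    (∀ t ∈ Icc (0 : ℝ) 1, t ∉ Icc t₁ t₃ → τ.fn t = σ.fn t)

/-- The elementary moves whose generated equivalence relation identifies loops. -/
def Move (σ τ : Loop x₀) : Prop := IsReparam σ τ ∨ IsClipping σ τ

/-! ### Constant loop, concatenation, reversal -/

def Loop.const (x₀ : S2) : Loop x₀ where
  path := Path.refl x₀
  smooth := ⟨∅, fun a b _ _ _ _ => by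
    have : (fun t => (((Path.refl x₀).extend t : S2) : E3)) = fun _ => (x₀ : E3) := by
      funext t; simp
    rw [this]; exact contDiffOn_const⟩

theorem trans_extend_left {σ τ : Path x₀ x₀} {t : ℝ} (h0 : 0 ≤ t) (h : t ≤ 1 / 2) :
    (σ.trans τ).extend t = σ.extend (2 * t) := by
  rw [Path.extend_apply _ ⟨h0, by linarith⟩]
  simp only [Path.trans, Path.coe_mk_mk, Function.comp_apply]
  rw [if_pos h]

theorem trans_extend_right {σ τ : Path x₀ x₀} {t : ℝ} (h : 1 / 2 ≤ t) (h1 : t ≤ 1) :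
    (σ.trans τ).extend t = τ.extend (2 * t - 1) := by
  rw [Path.extend_apply _ ⟨by linarith, h1⟩]
  simp only [Path.trans, Path.coe_mk_mk, Function.comp_apply]
  split_ifs with h2
  · have : t = 1 / 2 := le_antisymm h2 h
    subst this
    norm_num
  · rfl

/-- First `σ`, then `τ`. -/
def Loop.trans (σ τ : Loop x₀) : Loop x₀ where
  path := σ.path.trans τ.path
  smooth := by
    classical
    obtain ⟨F, hF⟩ := σ.smooth
    obtain ⟨G, hG⟩ := τ.smooth
    refine ⟨insert (1 / 2) (F.image (fun t => t / 2) ∪ G.image (fun t => (t + 1) / 2)), ?_⟩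
    intro a b ha hab hb hbr
    have hhalf := hbr (1 / 2) (by simp)
    rcases le_or_gt b (1 / 2) with hb2 | hb2
    · have key := hF (2 * a) (2 * b) (by linarith) (by linarith) (by linarith) (by
        intro t ht hm
        refine hbr (t / 2) (by simp only [Finset.mem_insert, Finset.mem_union, Finset.mem_image]
                               exact Or.inr (Or.inl ⟨t, ht, rfl⟩)) ⟨?_, ?_⟩
        · linarith [hm.1]
        · linarith [hm.2])
      have := key.comp (f := fun t : ℝ => 2 * t) (s := Icc a b)
        (by fun_prop) (fun t ht => ⟨by linarith [ht.1], by linarith [ht.2]⟩)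
      refine this.congr fun t ht => ?_
      simp only [Function.comp_apply]
      rw [trans_extend_left (by linarith [ht.1]) (by linarith [ht.2])]
    · have ha2 : 1 / 2 ≤ a := by
        by_contra hlt
        exact hhalf ⟨by linarith, hb2⟩
      have key := hG (2 * a - 1) (2 * b - 1) (by linarith) (by linarith) (by linarith) (by
        intro t ht hm
        refine hbr ((t + 1) / 2)
          (by simp only [Finset.mem_insert, Finset.mem_union, Finset.mem_image]
              exact Or.inr (Or.inr ⟨t, ht, rfl⟩)) ⟨?_, ?_⟩
        · linarith [hm.1]
        · linarith [hm.2])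
      have := key.comp (f := fun t : ℝ => 2 * t - 1) (s := Icc a b)
        (by fun_prop) (fun t ht => ⟨by linarith [ht.1], by linarith [ht.2]⟩)
      refine this.congr fun t ht => ?_
      simp only [Function.comp_apply]
      rw [trans_extend_right (by linarith [ht.1]) (by linarith [ht.2])]

theorem symm_extend (σ : Path x₀ x₀) {t : ℝ} (h0 : 0 ≤ t) (h1 : t ≤ 1) :
    σ.symm.extend t = σ.extend (1 - t) := by
  rw [Path.extend_apply _ ⟨h0, h1⟩, Path.extend_apply _ ⟨by linarith, by linarith⟩]
  rfl

def Loop.symm (σ : Loop x₀) : Loop x₀ where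
  path := σ.path.symm
  smooth := by
    classical
    obtain ⟨F, hF⟩ := σ.smooth
    refine ⟨F.image (fun t => 1 - t), ?_⟩
    intro a b ha hab hb hbr
    have key := hF (1 - b) (1 - a) (by linarith) (by linarith) (by linarith) (by
      intro t ht hm
      refine hbr (1 - t) (Finset.mem_image_of_mem _ ht) ⟨?_, ?_⟩
      · linarith [hm.2]
      · linarith [hm.1])
    have := key.comp (f := fun t : ℝ => 1 - t) (s := Icc a b)
      (by fun_prop) (fun t ht => ⟨by linarith [ht.2], by linarith [ht.1]⟩)
    refine this.congr fun t ht => ?_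
    simp only [Function.comp_apply]
    rw [symm_extend _ (by linarith [ht.1]) (by linarith [ht.2])]

theorem fn_const (t : ℝ) : (Loop.const x₀).fn t = x₀ := by simp [Loop.fn, Loop.const]

theorem fn_nonpos (σ : Loop x₀) {t : ℝ} (h : t ≤ 0) : σ.fn t = x₀ := by
  simp [Loop.fn, Path.extend_of_le_zero _ h]

theorem fn_one_le (σ : Loop x₀) {t : ℝ} (h : 1 ≤ t) : σ.fn t = x₀ := by
  simp [Loop.fn, Path.extend_of_one_le _ h]

theorem fn_trans_left (σ τ : Loop x₀) {t : ℝ} (h : t ≤ 1 / 2) :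
    (σ.trans τ).fn t = σ.fn (2 * t) := by
  rcases le_or_gt 0 t with h0 | h0
  · exact trans_extend_left h0 h
  · rw [fn_nonpos _ h0.le, fn_nonpos _ (by linarith)]

theorem fn_trans_right (σ τ : Loop x₀) {t : ℝ} (h : 1 / 2 ≤ t) :
    (σ.trans τ).fn t = τ.fn (2 * t - 1) := by
  rcases le_or_gt t 1 with h0 | h0
  · exact trans_extend_right h h0
  · rw [fn_one_le _ h0.le, fn_one_le _ (by linarith)]

theorem fn_symm (σ : Loop x₀) (t : ℝ) : σ.symm.fn t = σ.fn (1 - t) := by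
  rcases le_or_gt 0 t with h0 | h0
  · rcases le_or_gt t 1 with h1 | h1
    · exact symm_extend _ h0 h1
    · rw [fn_one_le _ h1.le, fn_nonpos _ (by linarith)]
  · rw [fn_nonpos _ h0.le, fn_one_le _ (by linarith)]

/-! ### The moves are compatible with the operations -/

theorem Move.trans_right {σ σ' : Loop x₀} (τ : Loop x₀) (h : Move σ σ') :
    Move (σ.trans τ) (σ'.trans τ) := by
  rcases h with ⟨φ, hc, hm, h0, h1, hφ⟩ | ⟨t₁, t₂, t₃, h01, h12, h23, h31,
      ⟨α, β, hα, hαm, hα0, hα1, hβ, hβm, hβ0, hβ1, hαβ⟩, hin, hout⟩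
  · left
    refine ⟨fun t => φ (min (2 * t) 1) / 2 + max (t - 1 / 2) 0, by fun_prop, ?_, ?_, ?_, ?_⟩
    · intro s t hst
      have : φ (min (2 * s) 1) ≤ φ (min (2 * t) 1) := hm (by gcongr)
      have : max (s - 1 / 2) 0 ≤ max (t - 1 / 2) 0 := by gcongr
      simp only
      linarith
    · norm_num [h0]
    · norm_num [h1]
    · intro t ht
      simp only
      rcases le_or_gt t (1 / 2) with h | h
      · have hle : φ (2 * t) ≤ 1 := h1 ▸ hm (by linarith)
        rw [fn_trans_left _ _ h, min_eq_left (by linarith), max_eq_right (by linarith),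
          fn_trans_left _ _ (by linarith), hφ _ ⟨by linarith [ht.1], by linarith⟩]
        congr 1; ring
      · rw [fn_trans_right _ _ h.le, min_eq_right (by linarith), max_eq_left (by linarith), h1,
          fn_trans_right _ _ (by linarith)]
        congr 1; ring
  · right
    refine ⟨t₁ / 2, t₂ / 2, t₃ / 2, by linarith, by linarith, by linarith, by linarith,
      ⟨fun u => α u / 2, fun u => β u / 2, by fun_prop, ?_, by simp [hα0], by simp [hα1],
        by fun_prop, ?_, by simp [hβ0], by simp [hβ1], ?_⟩, ?_, ?_⟩
    · intro s t hst; have := hαm hst; simp only; linarith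
    · intro s t hst; have := hβm hst; simp only; linarith
    · intro u hu
      have ha : α u ≤ t₂ := hα1 ▸ hαm hu.2
      have hb : β u ≤ t₃ := hβ0 ▸ hβm hu.1
      simp only
      rw [fn_trans_left _ _ (by linarith), fn_trans_left _ _ (by linarith)]
      have := hαβ u hu
      rwa [show 2 * (α u / 2) = α u by ring, show 2 * (β u / 2) = β u by ring]
    · intro t ht
      rw [fn_trans_left _ _ (by linarith [ht.2]), fn_trans_left _ _ (by linarith),
        hin _ ⟨by linarith [ht.1], by linarith [ht.2]⟩]
      congr 1; ring
    · intro t ht hnt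
      rcases le_or_gt t (1 / 2) with h | h
      · rw [fn_trans_left _ _ h, fn_trans_left _ _ h]
        refine hout _ ⟨by linarith [ht.1], by linarith⟩ fun hm => hnt ⟨?_, ?_⟩
        · linarith [hm.1]
        · linarith [hm.2]
      · rw [fn_trans_right _ _ h.le, fn_trans_right _ _ h.le]

theorem Move.trans_left {σ σ' : Loop x₀} (τ : Loop x₀) (h : Move σ σ') :
    Move (τ.trans σ) (τ.trans σ') := by
  rcases h with ⟨φ, hc, hm, h0, h1, hφ⟩ | ⟨t₁, t₂, t₃, h01, h12, h23, h31,
      ⟨α, β, hα, hαm, hα0, hα1, hβ, hβm, hβ0, hβ1, hαβ⟩, hin, hout⟩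
  · left
    refine ⟨fun t => φ (max (2 * t - 1) 0) / 2 + min t (1 / 2), by fun_prop, ?_, ?_, ?_, ?_⟩
    · intro s t hst
      have : φ (max (2 * s - 1) 0) ≤ φ (max (2 * t - 1) 0) := hm (by gcongr)
      have : min s (1 / 2) ≤ min t (1 / 2) := by gcongr
      simp only
      linarith
    · norm_num [h0]
    · norm_num [h1]
    · intro t ht
      simp only
      rcases le_or_gt t (1 / 2) with h | h
      · rw [fn_trans_left _ _ h, max_eq_right (by linarith), min_eq_left (by linarith), h0,
          fn_trans_left _ _ (by linarith)]
        congr 1; ring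
      · have hle : 0 ≤ φ (2 * t - 1) := h0 ▸ hm (by linarith)
        rw [fn_trans_right _ _ h.le, max_eq_left (by linarith), min_eq_right (by linarith),
          fn_trans_right _ _ (by linarith), hφ _ ⟨by linarith, by linarith [ht.2]⟩]
        congr 1; ring
  · right
    refine ⟨(t₁ + 1) / 2, (t₂ + 1) / 2, (t₃ + 1) / 2, by linarith, by linarith, by linarith,
      by linarith,
      ⟨fun u => (α u + 1) / 2, fun u => (β u + 1) / 2, by fun_prop, ?_, by simp [hα0],
        by simp [hα1], by fun_prop, ?_, by simp [hβ0], by simp [hβ1], ?_⟩, ?_, ?_⟩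
    · intro s t hst; have := hαm hst; simp only; linarith
    · intro s t hst; have := hβm hst; simp only; linarith
    · intro u hu
      have ha : t₁ ≤ α u := hα0 ▸ hαm hu.1
      have hb : t₂ ≤ β u := hβ1 ▸ hβm hu.2
      simp only
      rw [fn_trans_right _ _ (by linarith), fn_trans_right _ _ (by linarith)]
      have := hαβ u hu
      rwa [show 2 * ((α u + 1) / 2) - 1 = α u by ring, show 2 * ((β u + 1) / 2) - 1 = β u by ring]
    · intro t ht
      rw [fn_trans_right _ _ (by linarith [ht.1]), fn_trans_right _ _ (by linarith),
        hin _ ⟨by linarith [ht.1], by linarith [ht.2]⟩]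
      congr 1; ring
    · intro t ht hnt
      rcases le_or_gt t (1 / 2) with h | h
      · rw [fn_trans_left _ _ h, fn_trans_left _ _ h]
      · rw [fn_trans_right _ _ h.le, fn_trans_right _ _ h.le]
        refine hout _ ⟨by linarith, by linarith [ht.2]⟩ fun hm => hnt ⟨?_, ?_⟩
        · linarith [hm.1]
        · linarith [hm.2]

theorem Move.symm_congr {σ σ' : Loop x₀} (h : Move σ σ') : Move σ.symm σ'.symm := by
  rcases h with ⟨φ, hc, hm, h0, h1, hφ⟩ | ⟨t₁, t₂, t₃, h01, h12, h23, h31,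
      ⟨α, β, hα, hαm, hα0, hα1, hβ, hβm, hβ0, hβ1, hαβ⟩, hin, hout⟩
  · left
    refine ⟨fun t => 1 - φ (1 - t), by fun_prop, ?_, by simp [h1], by simp [h0], ?_⟩
    · intro s t hst
      have : φ (1 - t) ≤ φ (1 - s) := hm (by linarith)
      simp only
      linarith
    · intro t ht
      rw [fn_symm, fn_symm, hφ _ ⟨by linarith [ht.2], by linarith [ht.1]⟩]
      congr 1; ring
  · right
    have hends : σ.fn t₁ = σ.fn t₃ := by
      have := hαβ 0 (by simp)
      rwa [hα0, hβ0] at this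
    refine ⟨1 - t₃, 1 - t₂, 1 - t₁, by linarith, by linarith, by linarith, by linarith,
      ⟨fun u => 1 - β u, fun u => 1 - α u, by fun_prop, ?_, by simp [hβ0], by simp [hβ1],
        by fun_prop, ?_, by simp [hα0], by simp [hα1], ?_⟩, ?_, ?_⟩
    · intro s t hst; have := hβm hst; simp only; linarith
    · intro s t hst; have := hαm hst; simp only; linarith
    · intro u hu
      rw [fn_symm, fn_symm, sub_sub_cancel, sub_sub_cancel]
      exact (hαβ u hu).symm
    · intro t ht
      rw [fn_symm, fn_symm, sub_sub_cancel, ← hends]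
      exact hin _ ⟨by linarith [ht.2], by linarith [ht.1]⟩
    · intro t ht hnt
      rw [fn_symm, fn_symm]
      refine hout _ ⟨by linarith [ht.2], by linarith [ht.1]⟩ fun hm => hnt ⟨?_, ?_⟩
      · linarith [hm.2]
      · linarith [hm.1]

theorem move_assoc (σ τ ρ : Loop x₀) :
    Move (σ.trans (τ.trans ρ)) ((σ.trans τ).trans ρ) := by
  left
  refine ⟨fun t => min (2 * t) (min (t + 1 / 4) ((t + 1) / 2)), by fun_prop, ?_, by norm_num,
    by norm_num, ?_⟩
  · intro s t hst
    simp only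
    gcongr
  · intro t ht
    simp only
    rcases le_or_gt t (1 / 2) with h | h
    · rcases le_or_gt t (1 / 4) with h' | h'
      · rw [min_eq_left (by rw [le_min_iff]; constructor <;> linarith),
          fn_trans_left _ _ h, fn_trans_left _ _ (by linarith), fn_trans_left _ _ (by linarith)]
      · rw [min_eq_left (b := (t + 1) / 2) (by linarith), min_eq_right (by linarith),
          fn_trans_left _ _ h, fn_trans_right _ _ (by linarith), fn_trans_right _ _ (by linarith),
          fn_trans_left _ _ (by linarith)]
        congr 1; ring
    · rw [min_eq_right (b := (t + 1) / 2) (by linarith), min_eq_right (by linarith),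
        fn_trans_right _ _ h.le, fn_trans_right _ _ (by linarith), fn_trans_right _ _ (by linarith)]
      congr 1; ring

theorem move_const_trans (σ : Loop x₀) : Move σ ((Loop.const x₀).trans σ) := by
  left
  refine ⟨fun t => max 0 (2 * t - 1), by fun_prop, ?_, by norm_num, by norm_num, ?_⟩
  · intro s t hst
    simp only
    gcongr
  · intro t ht
    simp only
    rcases le_or_gt t (1 / 2) with h | h
    · rw [max_eq_left (by linarith), fn_trans_left _ _ h, fn_const, fn_nonpos _ le_rfl]
    · rw [max_eq_right (by linarith), fn_trans_right _ _ h.le]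

theorem move_trans_const (σ : Loop x₀) : Move σ (σ.trans (Loop.const x₀)) := by
  left
  refine ⟨fun t => min 1 (2 * t), by fun_prop, ?_, by norm_num, by norm_num, ?_⟩
  · intro s t hst
    simp only
    gcongr
  · intro t ht
    simp only
    rcases le_or_gt t (1 / 2) with h | h
    · rw [min_eq_right (by linarith), fn_trans_left _ _ h]
    · rw [min_eq_left (by linarith), fn_trans_right _ _ h.le, fn_const, fn_one_le _ le_rfl]

theorem move_trans_symm (σ : Loop x₀) : Move (σ.trans σ.symm) (Loop.const x₀) := by
  right
  refine ⟨0, 1 / 2, 1, le_rfl, by norm_num, by norm_num, le_rfl,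
    ⟨fun u => u / 2, fun u => 1 - u / 2, by fun_prop, ?_, by norm_num, by norm_num, by fun_prop,
      ?_, by norm_num, by norm_num, ?_⟩, ?_, ?_⟩
  · intro s t hst; simp only; linarith
  · intro s t hst; simp only; linarith
  · intro u hu
    simp only
    rw [fn_trans_left _ _ (by linarith [hu.2]), fn_trans_right _ _ (by linarith [hu.2]), fn_symm]
    congr 1; ring
  · intro t _
    rw [fn_const, fn_nonpos _ le_rfl]
  · intro t ht hnt
    exact absurd ht hnt

/-! ### The path group -/

/-- The path group of the sphere: piecewise smooth loops at `x₀` modulo the equivalence relation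
generated by reparametrization and clipping of retraced pieces. -/
def PathGroup (x₀ : S2) : Type := Quot (Move (x₀ := x₀))

def PathGroup.mk (σ : Loop x₀) : PathGroup x₀ := Quot.mk _ σ

theorem Loop.symm_symm (σ : Loop x₀) : σ.symm.symm = σ :=
  Loop.ext_fn fun t _ => by rw [fn_symm, fn_symm, sub_sub_cancel]

/-- In a product `a * b` the loop `b` is traversed first. -/
instance : Group (PathGroup x₀) where
  mul := Quot.map₂ (fun σ τ => τ.trans σ) (fun σ _ _ h => h.trans_right σ)
    (fun _ _ τ h => h.trans_left τ)
  one := PathGroup.mk (Loop.const x₀)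
  inv := Quot.map Loop.symm fun _ _ h => h.symm_congr
  mul_assoc := by
    rintro ⟨σ⟩ ⟨τ⟩ ⟨ρ⟩
    exact Quot.sound (move_assoc ρ τ σ)
  one_mul := by
    rintro ⟨σ⟩
    exact (Quot.sound (move_trans_const σ)).symm
  mul_one := by
    rintro ⟨σ⟩
    exact (Quot.sound (move_const_trans σ)).symm
  inv_mul_cancel := by
    rintro ⟨σ⟩
    exact Quot.sound (move_trans_symm σ)

/-! ### Enclosed area -/

/-- The standard area form of the unit sphere (outward orientation) multiplied by the density `f`:
`ω_x(u,v) = f(x) det(x,u,v)`. -/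
def areaForm (f : S2 → ℝ) (x : S2) (u v : E3) : ℝ :=
  f x * Matrix.det (Matrix.of ![(x : E3).ofLp, u.ofLp, v.ofLp])

/-- `D` is a piecewise smooth (singular) disc in the sphere with oriented boundary `σ`, written in
polar coordinates `(r,θ)` with `r, θ ∈ [0,1]`, `θ` measured in full turns. Only the values on the
unit square matter; the disc is smooth on every closed rectangle that is not crossed by the
finitely many grid lines `r ∈ F`, `θ ∈ G`. -/
structure IsSpanningDisc (σ : Loop x₀) (D : ℝ × ℝ → S2) : Prop where
  continuousOn : ContinuousOn D (Icc 0 1 ×ˢ Icc 0 1)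
  piecewise_smooth : ∃ F G : Finset ℝ, ∀ a b c d : ℝ,
    0 ≤ a → a < b → b ≤ 1 → 0 ≤ c → c < d → d ≤ 1 →
    (∀ r ∈ F, r ∉ Ioo a b) → (∀ θ ∈ G, θ ∉ Ioo c d) →
    ContDiffOn ℝ ∞ (fun p => (D p : E3)) (Icc a b ×ˢ Icc c d)
  center : ∀ θ ∈ Icc (0 : ℝ) 1, D (0, θ) = D (0, 0)
  periodic : ∀ r ∈ Icc (0 : ℝ) 1, D (r, 0) = D (r, 1)
  boundary : ∀ θ ∈ Icc (0 : ℝ) 1, D (1, θ) = σ.fn θ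

/-- The signed area `∫_D ω` of a disc, the integral of the pulled back area form. -/
def discArea (f : S2 → ℝ) (D : ℝ × ℝ → S2) : ℝ :=
  ∫ p in (Icc (0 : ℝ) 1 ×ˢ Icc (0 : ℝ) 1 : Set (ℝ × ℝ)),
    areaForm f (D p) (deriv (fun r => (D (r, p.2) : E3)) p.1)
      (deriv (fun θ => (D (p.1, θ) : E3)) p.2)

/-- The elements of the path group represented by a (contractible) loop that bounds a disc of
signed area zero. -/
def zeroAreaClasses (f : S2 → ℝ) (x₀ : S2) : Set (PathGroup x₀) :=
  {a | ∃ σ : Loop x₀, PathGroup.mk σ = a ∧ ∃ D, IsSpanningDisc σ D ∧ discArea f D = 0}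

end SpherePaths

end

open Set MeasureTheory
open scoped Manifold ContDiff

noncomputable section

namespace SpherePaths

open Filter Topology
open scoped NNReal

/-! ### Determinants and signed cones -/

/-! The heart of the matter is that the area of a disc modulo 1 depends only on its boundary, and
can be computed from the boundary by a formula that is additive under concatenation and unchanged by
the moves. No form of Stokes' theorem is used. Instead, for a generic vector `p`, the area modulo 1
is compared with `hol f p σ`, the area swept by the spherical segments from `p` to the points of
`σ`.

Areas on the sphere are turned into integrals over cones in space. Spreading the density over rays
with a radial weight of mass one (`dens`) makes the signed area of a spherical triangle equal to the
integral of `dens` against the signed indicator `chi` of the cone over it. For a tetrahedron in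
general position, the signed cones over its four faces combine, off finitely many planes, to a
constant: 0, or ±1 if the origin lies inside. As `dens` has total mass 1, triangle areas satisfy a
cocycle relation modulo ℤ (`triArea_cocycle`).

A disc is cut into a grid of small triangles. Their areas sum in the limit to the area of the disc
(`tendsto_sum_cellArea`). By the cocycle relation each small triangle may be replaced by three
triangles with apex `p`; interior edges cancel, the sides θ = 0 and θ = 1 cancel, the side r = 0 is
a point, and the side r = 1 leaves a sum along the loop that tends to `hol` (`tendsto_sum_triArea`).
This is `ae_discArea_eq_hol`. The limit along the loop is the same for every continuous monotone
parametrization, so `hol` is invariant under reparametrization, changes sign under reversal and is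
additive; hence retraced pieces contribute nothing. Almost every `p` is admissible, so one `p`
serves several loops and discs at once.

It follows that area modulo 1 is a homomorphism from the path group. Every loop bounds a disc,
namely the cone over it from a generic point. Round caps through the base point have areas filling
[0,1], which gives surjectivity. Inserting copies of the whole sphere, with either orientation, at
the centre of a disc changes its area by any integer. So the areas of the discs of one loop form a
full coset of ℤ, and the kernel consists exactly of the classes with a disc of area 0. The first
isomorphism theorem concludes. -/

/-- The determinant of three vectors. -/
def det3 (a b c : E3) : ℝ := Matrix.det (Matrix.of ![a.ofLp, b.ofLp, c.ofLp])

theorem det3_eq (a b c : E3) : det3 a b c =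
    a 0 * (b 1 * c 2 - b 2 * c 1) - a 1 * (b 0 * c 2 - b 2 * c 0)
      + a 2 * (b 0 * c 1 - b 1 * c 0) := by
  simp [det3, Matrix.det_fin_three]
  ring

theorem areaForm_eq (f : S2 → ℝ) (x : S2) (u v : E3) : areaForm f x u v = f x * det3 x u v := rfl

attribute [irreducible] det3

theorem continuous_det3 : Continuous fun q : E3 × E3 × E3 => det3 q.1 q.2.1 q.2.2 := by
  have h : ∀ i, Continuous fun x : E3 => x i := fun i => PiLp.continuous_apply 2 _ i
  have h1 : ∀ i, Continuous fun q : E3 × E3 × E3 => q.1 i := fun i => (h i).comp continuous_fst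
  have h2 : ∀ i, Continuous fun q : E3 × E3 × E3 => q.2.1 i :=
    fun i => (h i).comp (continuous_fst.comp continuous_snd)
  have h3 : ∀ i, Continuous fun q : E3 × E3 × E3 => q.2.2 i :=
    fun i => (h i).comp (continuous_snd.comp continuous_snd)
  simp only [det3_eq]
  exact ((((h1 0).mul (((h2 1).mul (h3 2)).sub ((h2 2).mul (h3 1)))).sub
    ((h1 1).mul (((h2 0).mul (h3 2)).sub ((h2 2).mul (h3 0))))).add
    ((h1 2).mul (((h2 0).mul (h3 1)).sub ((h2 1).mul (h3 0)))))

theorem tendsto_det3 {ι : Type*} {l : Filter ι} {a b c : ι → E3} {a' b' c' : E3}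
    (ha : Tendsto a l (𝓝 a')) (hb : Tendsto b l (𝓝 b')) (hc : Tendsto c l (𝓝 c')) :
    Tendsto (fun i => det3 (a i) (b i) (c i)) l (𝓝 (det3 a' b' c')) :=
  (continuous_det3.tendsto (a', b', c')).comp (ha.prodMk_nhds (hb.prodMk_nhds hc))

theorem det3_smul (r s : ℝ) (a b c : E3) : det3 a (r • b) (s • c) = r * s * det3 a b c := by
  simp only [det3_eq, PiLp.smul_apply, smul_eq_mul]; ring

theorem det3_sub_sub (a b c : E3) : det3 a (b - a) (c - a) = det3 a b c := by
  simp only [det3_eq, PiLp.sub_apply]; ring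

theorem det3_sub_right (a b c : E3) : det3 a b (c - b) = det3 a b c := by
  simp only [det3_eq, PiLp.sub_apply]; ring

theorem abs_det3_le (a b c : E3) : |det3 a b c| ≤ 6 * (‖a‖ * ‖b‖ * ‖c‖) := by
  have h : ∀ i j k, |a i * b j * c k| ≤ ‖a‖ * ‖b‖ * ‖c‖ := by
    intro i j k
    rw [abs_mul, abs_mul]
    have := PiLp.norm_apply_le a i
    have := PiLp.norm_apply_le b j
    have := PiLp.norm_apply_le c k
    simp only [Real.norm_eq_abs] at *
    gcongr
  have e : det3 a b c = a 0 * b 1 * c 2 - a 0 * b 2 * c 1 - a 1 * b 0 * c 2 + a 1 * b 2 * c 0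
      + a 2 * b 0 * c 1 - a 2 * b 1 * c 0 := by
    rw [det3_eq]; ring
  rw [e, abs_le]
  have h1 := abs_le.1 (h 0 1 2)
  have h2 := abs_le.1 (h 0 2 1)
  have h3 := abs_le.1 (h 1 0 2)
  have h4 := abs_le.1 (h 1 2 0)
  have h5 := abs_le.1 (h 2 0 1)
  have h6 := abs_le.1 (h 2 1 0)
  constructor <;> linarith [h1.1, h1.2, h2.1, h2.2, h3.1, h3.2, h4.1, h4.2, h5.1, h5.2, h6.1, h6.2]

/-- `1` if all arguments are positive, `-1` if all are negative, and `0` otherwise. -/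
def commonSign (a b c d : ℝ) : ℝ :=
  if 0 < a ∧ 0 < b ∧ 0 < c ∧ 0 < d then 1
  else if a < 0 ∧ b < 0 ∧ c < 0 ∧ d < 0 then -1 else 0

theorem commonSign_mul_pos {D : ℝ} (hD : 0 < D) (a b c d : ℝ) :
    commonSign (D * a) (D * b) (D * c) (D * d) = commonSign a b c d := by
  simp only [commonSign, mul_pos_iff_of_pos_left hD, ← neg_pos, ← mul_neg]

theorem commonSign_neg (a b c d : ℝ) :
    commonSign (-a) (-b) (-c) (-d) = -commonSign a b c d := by
  simp only [commonSign, neg_pos, neg_lt_zero]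
  split_ifs with h1 h2 <;> first | (exfalso; linarith [h1.1, h2.1]) | simp

theorem commonSign_mul (D a b c d : ℝ) :
    commonSign (D * a) (D * b) (D * c) (D * d) = SignType.sign D * commonSign a b c d := by
  rcases lt_trichotomy D 0 with hD | hD | hD
  · have := commonSign_mul_pos (neg_pos.2 hD) a b c d
    rw [← neg_mul_neg D a, ← neg_mul_neg D b, ← neg_mul_neg D c, ← neg_mul_neg D d]
    rw [commonSign_mul_pos (neg_pos.2 hD), commonSign_neg]
    simp [hD]
  · simp [hD, commonSign]
  · rw [commonSign_mul_pos hD]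
    simp [hD]

theorem commonSign_rotate (a b c d : ℝ) : commonSign a b d c = commonSign a b c d := by
  simp only [commonSign]
  congr 1
  · simp only [eq_iff_iff]; tauto
  · congr 1; simp only [eq_iff_iff]; tauto

set_option maxHeartbeats 1600000 in
/-- In the basis of the first three vectors the ray from `v` in the direction opposite to `d`
eventually is in the open octant if and only if `d` is in the opposite one; the left hand side
counts its entries and exits. -/
theorem commonSign_cocycle {v₁ v₂ v₃ d₁ d₂ d₃ : ℝ} (h1 : v₁ ≠ 0) (h2 : v₂ ≠ 0) (h3 : v₃ ≠ 0)
    (hd2 : d₂ ≠ 0) (hd3 : d₃ ≠ 0) (hd1 : d₁ = 0 → 0 < d₂ ∨ 0 < d₃)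
    (h12 : v₂ * d₁ - v₁ * d₂ ≠ 0) (h13 : v₃ * d₁ - v₁ * d₃ ≠ 0) (h23 : v₂ * d₃ - v₃ * d₂ ≠ 0) :
    commonSign 1 v₁ v₂ v₃ + commonSign (-d₂) (v₂ * d₁ - v₁ * d₂) (v₂ * d₃ - v₃ * d₂) (-v₂)
      + commonSign (-d₃) (v₃ * d₁ - v₁ * d₃) (-v₃) (d₂ * v₃ - d₃ * v₂)
      - commonSign d₁ (v₂ * d₁ - v₁ * d₂) (v₃ * d₁ - v₁ * d₃) v₁
      = if d₁ < 0 ∧ d₂ < 0 ∧ d₃ < 0 then 1 else 0 := by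
  -- The number `uᵢ` is the time at which the ray `v - t d` crosses the i-th coordinate plane. After
  -- this substitution every sign depends only on the signs of the `dᵢ` and `uᵢ` and on the order of
  -- the `uᵢ`.
  obtain ⟨u₂, rfl⟩ : ∃ u, v₂ = u * d₂ := ⟨v₂ / d₂, by field_simp⟩
  obtain ⟨u₃, rfl⟩ : ∃ u, v₃ = u * d₃ := ⟨v₃ / d₃, by field_simp⟩
  have hu2 := left_ne_zero_of_mul h2
  have hu3 := left_ne_zero_of_mul h3
  have e23 : u₂ * d₂ * d₃ - u₃ * d₃ * d₂ = d₂ * d₃ * (u₂ - u₃) := by ring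
  have e23' : d₂ * (u₃ * d₃) - d₃ * (u₂ * d₂) = -(d₂ * d₃ * (u₂ - u₃)) := by ring
  rw [e23] at h23
  rw [e23, e23']
  have hu23 := right_ne_zero_of_mul h23
  -- A ray parallel to the first coordinate plane never crosses it. With `d₂` and `d₃` both negative
  -- the left side would be the indicator of `0 < v₁` and the identity would fail; `hd1` excludes
  -- this.
  by_cases hd : d₁ = 0
  · subst hd
    have hs := hd1 rfl
    simp only [mul_zero, zero_sub, neg_ne_zero] at *
    simp only [commonSign, mul_pos_iff, mul_neg_iff, neg_pos, neg_lt_zero]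
    rcases lt_or_gt_of_ne hd2 with a2 | a2 <;> rcases lt_or_gt_of_ne hd3 with a3 | a3 <;>
    simp only [a2, a3, not_lt_of_gt] <;> grind
  · obtain ⟨u₁, rfl⟩ : ∃ u, v₁ = u * d₁ := ⟨v₁ / d₁, by field_simp⟩
    have hu1 := left_ne_zero_of_mul h1
    have e12 : u₂ * d₂ * d₁ - u₁ * d₁ * d₂ = d₁ * d₂ * (u₂ - u₁) := by ring
    have e13 : u₃ * d₃ * d₁ - u₁ * d₁ * d₃ = d₁ * d₃ * (u₃ - u₁) := by ring
    rw [e12] at h12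
    rw [e13] at h13
    rw [e12, e13]
    have hu12 := right_ne_zero_of_mul h12
    have hu13 := right_ne_zero_of_mul h13
    clear h12 h13 h23 e12 e13 e23 e23' h1 h2 h3 hd1
    simp only [commonSign, mul_pos_iff, mul_neg_iff, neg_pos, neg_lt_zero]
    rcases lt_or_gt_of_ne hd with a1 | a1 <;> rcases lt_or_gt_of_ne hd2 with a2 | a2 <;>
    rcases lt_or_gt_of_ne hd3 with a3 | a3 <;>
    simp only [a1, a2, a3, not_lt_of_gt, true_and, and_true, false_and, and_false, or_false,
      false_or, sub_pos, sub_neg] <;>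
    rcases lt_or_gt_of_ne hu12 with c12 | c12 <;> rcases lt_or_gt_of_ne hu13 with c13 | c13 <;>
    rcases lt_or_gt_of_ne hu23 with c23 | c23 <;> simp only [sub_pos, sub_neg] at c12 c13 c23 <;>
    first
    | (exfalso; linarith only [c12, c13, c23])
    | (rcases lt_or_gt_of_ne hu1 with b1 | b1 <;> rcases lt_or_gt_of_ne hu2 with b2 | b2 <;>
        rcases lt_or_gt_of_ne hu3 with b3 | b3 <;>
        first
        | (exfalso; linarith only [c12, c13, c23, b1, b2, b3])
        | norm_num [c12, c13, c23, b1, b2, b3, not_lt_of_gt])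

/-- The signed indicator function of the open cone spanned by three vectors. -/
def chi (a b c v : E3) : ℝ := commonSign (det3 a b c) (det3 v b c) (det3 a v c) (det3 a b v)

theorem chi_swap (a b c v : E3) : chi a c b v = -chi a b c v := by
  have e1 : det3 a c b = -det3 a b c := by simp only [det3_eq]; ring
  have e2 : det3 v c b = -det3 v b c := by simp only [det3_eq]; ring
  have e3 : det3 a v b = -det3 a b v := by simp only [det3_eq]; ring
  have e4 : det3 a c v = -det3 a v c := by simp only [det3_eq]; ring
  rw [chi, e1, e2, e3, e4, commonSign_neg, commonSign_rotate, chi]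

theorem exists_coords {p x y : E3} (hD : det3 p x y ≠ 0) (v : E3) :
    ∃ a b c : ℝ, v = a • p + b • x + c • y := by
  refine ⟨det3 v x y / det3 p x y, det3 p v y / det3 p x y, det3 p x v / det3 p x y, ?_⟩
  ext i
  simp only [PiLp.add_apply, PiLp.smul_apply, smul_eq_mul]
  field_simp
  simp only [det3_eq]
  fin_cases i <;> simp <;> ring

/-- In the basis `p, x, y` every determinant is `det3 p x y` times a polynomial in the coordinates
of `z` and `v`, which reduces the claim to `commonSign_cocycle`. The point is that the right side
does not involve `v`: it is the degree of the boundary of the tetrahedron around the origin, nonzero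
only if the origin is inside. The hypothesis `hs` excludes the degenerate case in which `z` lies in
the plane of `x` and `y`, in the cone opposite to theirs. -/
theorem chi_cocycle {p x y z v : E3} (hxy : det3 p x y ≠ 0) (hyz : det3 p y z ≠ 0)
    (hzx : det3 p z x ≠ 0) (h1 : det3 v x y ≠ 0) (h2 : det3 p v y ≠ 0) (h3 : det3 p x v ≠ 0)
    (h4 : det3 v y z ≠ 0) (h5 : det3 v z x ≠ 0) (h6 : det3 p v z ≠ 0)
    (hs : ∀ b c : ℝ, z = b • x + c • y → 0 < b ∨ 0 < c) :
    chi p x y v + chi p y z v + chi p z x v - chi x y z v =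
      if det3 z x y / det3 p x y < 0 ∧ det3 p z y / det3 p x y < 0 ∧ det3 p x z / det3 p x y < 0
        then (SignType.sign (det3 p x y) : ℝ) else 0 := by
  obtain ⟨d₁, d₂, d₃, hz⟩ := exists_coords hxy z
  obtain ⟨v₁, v₂, v₃, hv⟩ := exists_coords hxy v
  have hs' : d₁ = 0 → 0 < d₂ ∨ 0 < d₃ := by
    intro h; apply hs; rw [hz, h]; simp
  set D := det3 p x y with hDdef
  have key : ∀ (w : E3) (a b c : ℝ), w = a • p + b • x + c • y →
      (w 0 = a * p 0 + b * x 0 + c * y 0) ∧ (w 1 = a * p 1 + b * x 1 + c * y 1) ∧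
      (w 2 = a * p 2 + b * x 2 + c * y 2) := by
    rintro w a b c rfl; simp
  obtain ⟨z0, z1, z2⟩ := key z _ _ _ hz
  obtain ⟨w0, w1, w2⟩ := key v _ _ _ hv
  have evxy : det3 v x y = D * v₁ := by simp only [hDdef, det3_eq, w0, w1, w2]; ring
  have epvy : det3 p v y = D * v₂ := by simp only [hDdef, det3_eq, w0, w1, w2]; ring
  have epxv : det3 p x v = D * v₃ := by simp only [hDdef, det3_eq, w0, w1, w2]; ring
  have ezxy : det3 z x y = D * d₁ := by simp only [hDdef, det3_eq, z0, z1, z2]; ring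
  have epzy : det3 p z y = D * d₂ := by simp only [hDdef, det3_eq, z0, z1, z2]; ring
  have epxz : det3 p x z = D * d₃ := by simp only [hDdef, det3_eq, z0, z1, z2]; ring
  have epyz : det3 p y z = D * (-d₂) := by simp only [hDdef, det3_eq, z0, z1, z2]; ring
  have epzx : det3 p z x = D * (-d₃) := by simp only [hDdef, det3_eq, z0, z1, z2]; ring
  have exyz : det3 x y z = D * d₁ := by simp only [hDdef, det3_eq, z0, z1, z2]; ring
  have evyz : det3 v y z = D * (v₂ * d₁ - v₁ * d₂) := by
    simp only [hDdef, det3_eq, z0, z1, z2, w0, w1, w2]; ring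
  have epvz : det3 p v z = D * (v₂ * d₃ - v₃ * d₂) := by
    simp only [hDdef, det3_eq, z0, z1, z2, w0, w1, w2]; ring
  have epyv : det3 p y v = D * (-v₂) := by
    simp only [hDdef, det3_eq, w0, w1, w2]; ring
  have evzx : det3 v z x = D * (v₃ * d₁ - v₁ * d₃) := by
    simp only [hDdef, det3_eq, z0, z1, z2, w0, w1, w2]; ring
  have epvx : det3 p v x = D * (-v₃) := by
    simp only [hDdef, det3_eq, w0, w1, w2]; ring
  have epzv : det3 p z v = D * (d₂ * v₃ - d₃ * v₂) := by
    simp only [hDdef, det3_eq, z0, z1, z2, w0, w1, w2]; ring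
  have exvz : det3 x v z = D * (v₃ * d₁ - v₁ * d₃) := by
    simp only [hDdef, det3_eq, z0, z1, z2, w0, w1, w2]; ring
  have exyv : det3 x y v = D * v₁ := by
    simp only [hDdef, det3_eq, w0, w1, w2]; ring
  have c0 : chi p x y v = SignType.sign D * commonSign 1 v₁ v₂ v₃ := by
    rw [chi, ← commonSign_mul, evxy, epvy, epxv, mul_one]
  rw [c0, chi, chi, chi, epyz, evyz, epvz, epyv, epzx, evzx, epvx, epzv, exyz, exvz, exyv,
    commonSign_mul, commonSign_mul, commonSign_mul, ← mul_add, ← mul_add, ← mul_sub,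
    commonSign_cocycle, ezxy, epzy, epxz, mul_div_cancel_left₀ _ hxy, mul_div_cancel_left₀ _ hxy,
    mul_div_cancel_left₀ _ hxy]
  · split_ifs <;> simp
  · exact right_ne_zero_of_mul (evxy ▸ h1)
  · exact right_ne_zero_of_mul (epvy ▸ h2)
  · exact right_ne_zero_of_mul (epxv ▸ h3)
  · exact neg_ne_zero.1 (right_ne_zero_of_mul (epyz ▸ hyz))
  · exact neg_ne_zero.1 (right_ne_zero_of_mul (epzx ▸ hzx))
  · exact hs'
  · exact right_ne_zero_of_mul (evyz ▸ h4)
  · exact right_ne_zero_of_mul (evzx ▸ h5)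
  · exact right_ne_zero_of_mul (epvz ▸ h6)

/-! ### The area form as a radially decaying density on the ambient space -/

/-- The radial projection to the sphere, with a junk value at the origin. -/
def proj (v : E3) : S2 :=
  if h : v = 0 then ⟨EuclideanSpace.single 0 1, by simp⟩
  else ⟨‖v‖⁻¹ • v, by simp [norm_smul, h]⟩

theorem coe_proj {v : E3} (h : v ≠ 0) : (proj v : E3) = ‖v‖⁻¹ • v := by
  simp [proj, h]

theorem proj_smul {r : ℝ} (hr : 0 < r) (x : S2) : proj (r • (x : E3)) = x := by
  have hx : ‖(x : E3)‖ = 1 := by simp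
  have h : r • (x : E3) ≠ 0 := smul_ne_zero hr.ne' (by intro h; simp [h] at hx)
  apply Subtype.ext
  rw [coe_proj h, norm_smul, hx, Real.norm_eq_abs, abs_of_pos hr, smul_smul, mul_one,
    inv_mul_cancel₀ hr.ne', one_smul]

theorem continuousAt_proj {v : E3} (h : v ≠ 0) : ContinuousAt proj v := by
  rw [Topology.IsInducing.subtypeVal.continuousAt_iff]
  have : (fun w : E3 => ‖w‖⁻¹ • w) =ᶠ[𝓝 v] Subtype.val ∘ proj := by
    filter_upwards [isOpen_ne.mem_nhds h] with w hw
    exact (coe_proj hw).symm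
  refine ContinuousAt.congr ?_ this
  exact (continuousAt_id.norm.inv₀ (norm_ne_zero_iff.2 h)).smul continuousAt_id

/-- The density `f` spread over rays with an exponential weight of total mass one. -/
def dens (f : S2 → ℝ) (v : E3) : ℝ := f (proj v) * (Real.exp (-‖v‖) / 2)

theorem exists_bound {f : S2 → ℝ} (hf : Continuous f) : ∃ M, 0 ≤ M ∧ ∀ x, |f x| ≤ M := by
  obtain ⟨M, hM⟩ := isCompact_univ.exists_bound_of_continuousOn hf.continuousOn
  refine ⟨M, ?_, fun x => hM x trivial⟩
  exact (abs_nonneg _).trans (hM (proj 0) trivial)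

theorem continuousAt_dens {f : S2 → ℝ} (hf : Continuous f) {v : E3} (h : v ≠ 0) :
    ContinuousAt (dens f) v := by
  unfold dens
  exact (hf.continuousAt.comp (continuousAt_proj h)).mul (by fun_prop)

theorem measurable_dens {f : S2 → ℝ} (hf : Continuous f) : Measurable (dens f) :=
  measurable_of_continuousOn_compl_singleton 0 fun _ h =>
    (continuousAt_dens hf h).continuousWithinAt

theorem abs_dens_le {f : S2 → ℝ} {M : ℝ} (hM : ∀ x, |f x| ≤ M) (v : E3) :
    |dens f v| ≤ M * (Real.exp (-‖v‖) / 2) := by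
  rw [dens, abs_mul, abs_of_pos (a := Real.exp (-‖v‖) / 2) (by positivity)]
  gcongr
  exact hM _

theorem integrable_exp_neg_norm : Integrable fun v : E3 => Real.exp (-‖v‖) := by
  rw [integrable_fun_norm_addHaar volume (f := fun r => Real.exp (-r))]
  have := Real.GammaIntegral_convergent (s := 3) (by norm_num)
  refine this.congr_fun (fun r hr => ?_) measurableSet_Ioi
  simp only [finrank_euclideanSpace, Fintype.card_fin, smul_eq_mul]
  rw [mul_comm]
  norm_num

theorem integrable_dens {f : S2 → ℝ} (hf : Continuous f) : Integrable (dens f) := by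
  obtain ⟨M, hM0, hM⟩ := exists_bound hf
  refine ((integrable_exp_neg_norm.div_const 2).const_mul M).mono'
    (measurable_dens hf).aestronglyMeasurable (ae_of_all _ fun v => ?_)
  exact abs_dens_le hM v

theorem integral_radial : ∫ r in Ioi (0 : ℝ), r ^ 2 * (Real.exp (-r) / 2) = 1 := by
  have := Real.Gamma_eq_integral (s := 3) (by norm_num)
  rw [show (3 : ℝ) = (2 : ℕ) + 1 by norm_num, Real.Gamma_nat_eq_factorial] at this
  have h3 : (1 : ℝ) = ((2 : ℕ).factorial : ℝ) / 2 := by norm_num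
  rw [h3, this, ← integral_div]
  refine setIntegral_congr_fun measurableSet_Ioi fun r hr => ?_
  norm_num
  ring

/-- In polar coordinates the integral splits into the spherical integral of `f` and the radial
integral, which is 1. -/
theorem integral_dens (f : S2 → ℝ) :
    ∫ v, dens f v = ∫ x, f x ∂(volume : Measure E3).toSphere := by
  have h1 : ∫ v, dens f v = ∫ q, f q.1 * (Real.exp (-(q.2 : ℝ)) / 2)
      ∂(volume : Measure E3).toSphere.prod (Measure.volumeIoiPow (Module.finrank ℝ E3 - 1)) := by
    rw [← ((volume : Measure E3).measurePreserving_homeomorphUnitSphereProd).integral_comp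
      (Homeomorph.measurableEmbedding _),
      ← restrict_compl_singleton (μ := (volume : Measure E3)) 0,
      ← integral_subtype_comap (measurableSet_singleton _).compl]
    simp only [restrict_compl_singleton]
    congr 1
    funext v
    have hv : (v : E3) ≠ 0 := v.2
    simp only [dens, homeomorphUnitSphereProd_apply_snd_coe]
    congr 2
    apply Subtype.ext
    rw [coe_proj hv]
    simp
  have h2 : ∫ r : Ioi (0 : ℝ), Real.exp (-(r : ℝ)) / 2
      ∂(Measure.volumeIoiPow (Module.finrank ℝ E3 - 1)) = 1 := by
    simp only [Measure.volumeIoiPow, ENNReal.ofReal]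
    rw [integral_withDensity_eq_integral_smul (by fun_prop),
        integral_subtype_comap measurableSet_Ioi fun a : ℝ =>
          Real.toNNReal (a ^ (Module.finrank ℝ E3 - 1)) • (Real.exp (-a) / 2)]
    rw [← integral_radial]
    refine setIntegral_congr_fun measurableSet_Ioi fun r hr => ?_
    have hr' : (0 : ℝ) < r := hr
    simp only [finrank_euclideanSpace, Fintype.card_fin, NNReal.smul_def, smul_eq_mul]
    rw [Real.coe_toNNReal _ (by positivity)]
  rw [h1, integral_prod_mul (f := fun x : S2 => f x)
    (g := fun r : Ioi (0 : ℝ) => Real.exp (-(r : ℝ)) / 2), h2, mul_one]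

/-! ### Integrals over cones -/

/-- The open positive octant. -/
def octant : Set (Fin 3 → ℝ) := Set.pi univ fun _ => Ioi 0

theorem measurableSet_octant : MeasurableSet octant :=
  MeasurableSet.univ_pi fun _ => measurableSet_Ioi

theorem exp_eq_prod (δ : ℝ) (t : Fin 3 → ℝ) :
    Real.exp (-(δ * (t 0 + t 1 + t 2))) = ∏ i, Real.exp (-δ * t i) := by
  rw [← Real.exp_sum, Fin.sum_univ_three]
  ring_nf

theorem integrableOn_octant_exp {δ : ℝ} (hδ : 0 < δ) :
    IntegrableOn (fun t : Fin 3 → ℝ => Real.exp (-(δ * (t 0 + t 1 + t 2)))) octant := by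
  simp only [exp_eq_prod]
  rw [IntegrableOn, octant, volume_pi, Measure.restrict_pi_pi]
  exact Integrable.fintype_prod (f := fun (_ : Fin 3) (x : ℝ) => Real.exp (-δ * x))
    fun i => exp_neg_integrableOn_Ioi 0 hδ

theorem integral_octant_exp :
    ∫ t in octant, Real.exp (-(1 * (t 0 + t 1 + t 2))) = 1 := by
  simp only [exp_eq_prod]
  rw [octant, volume_pi, Measure.restrict_pi_pi]
  rw [integral_fintype_prod_eq_prod (fun (_ : Fin 3) (x : ℝ) => Real.exp (-1 * x))]
  simp [integral_exp_Iic_zero]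

/-- The integral of the density over the cone spanned by three vectors, in the coordinates with
respect to these vectors. -/
def coneInt (f : S2 → ℝ) (a b c : E3) : ℝ :=
  ∫ t in octant, dens f (t 0 • a + t 1 • b + t 2 • c)

/-- A functional `l` that is at least `δ` on all three generators forces linear growth on their
cone. This makes the exponential weight decay uniformly, and underlies every bound and limit for
`coneInt`. -/
theorem le_norm_comb {l a b c : E3} {δ : ℝ} (hl : ‖l‖ ≤ 1) (ha : δ ≤ inner ℝ l a)
    (hb : δ ≤ inner ℝ l b) (hc : δ ≤ inner ℝ l c) {t : Fin 3 → ℝ} (ht : t ∈ octant) :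
    δ * (t 0 + t 1 + t 2) ≤ ‖t 0 • a + t 1 • b + t 2 • c‖ := by
  have h0 : 0 < t 0 := ht 0 trivial
  have h1 : 0 < t 1 := ht 1 trivial
  have h2 : 0 < t 2 := ht 2 trivial
  calc δ * (t 0 + t 1 + t 2) ≤ t 0 * inner ℝ l a + t 1 * inner ℝ l b + t 2 * inner ℝ l c := by
        nlinarith
    _ = inner ℝ l (t 0 • a + t 1 • b + t 2 • c) := by
        simp only [inner_add_right, real_inner_smul_right]
    _ ≤ ‖l‖ * ‖t 0 • a + t 1 • b + t 2 • c‖ := real_inner_le_norm _ _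
    _ ≤ 1 * ‖t 0 • a + t 1 • b + t 2 • c‖ := by gcongr
    _ = _ := one_mul _

theorem abs_dens_comb_le {f : S2 → ℝ} {M : ℝ} (hM0 : 0 ≤ M) (hM : ∀ x, |f x| ≤ M)
    {l a b c : E3} {δ : ℝ} (hl : ‖l‖ ≤ 1) (ha : δ ≤ inner ℝ l a)
    (hb : δ ≤ inner ℝ l b) (hc : δ ≤ inner ℝ l c) {t : Fin 3 → ℝ} (ht : t ∈ octant) :
    |dens f (t 0 • a + t 1 • b + t 2 • c)| ≤ M * (Real.exp (-(δ * (t 0 + t 1 + t 2))) / 2) := by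
  refine (abs_dens_le hM _).trans ?_
  have := le_norm_comb hl ha hb hc ht
  gcongr

theorem exists_coneInt_bound {f : S2 → ℝ} (hf : Continuous f) {δ : ℝ} (hδ : 0 < δ) :
    ∃ C, 0 ≤ C ∧ ∀ l a b c : E3, ‖l‖ ≤ 1 → δ ≤ inner ℝ l a → δ ≤ inner ℝ l b → δ ≤ inner ℝ l c →
      |coneInt f a b c| ≤ C := by
  obtain ⟨M, hM0, hM⟩ := exists_bound hf
  refine ⟨∫ t in octant, M * (Real.exp (-(δ * (t 0 + t 1 + t 2))) / 2),
    integral_nonneg fun t => by positivity, fun l a b c hl ha hb hc => ?_⟩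
  rw [← Real.norm_eq_abs, coneInt]
  refine norm_integral_le_of_norm_le (((integrableOn_octant_exp hδ).div_const 2).const_mul M) ?_
  filter_upwards [ae_restrict_mem measurableSet_octant] with t ht
  exact abs_dens_comb_le hM0 hM hl ha hb hc ht

theorem continuousAt_coneInt {f : S2 → ℝ} (hf : Continuous f) {l a b c : E3} (hl : ‖l‖ ≤ 1)
    (ha : 0 < inner ℝ l a) (hb : 0 < inner ℝ l b) (hc : 0 < inner ℝ l c) :
    ContinuousAt (fun q : E3 × E3 × E3 => coneInt f q.1 q.2.1 q.2.2) (a, b, c) := by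
  obtain ⟨M, hM0, hM⟩ := exists_bound hf
  -- Halving the minimum leaves room for the generators to move in a neighbourhood while the
  -- dominating function stays fixed.
  set δ := min (inner ℝ l a) (min (inner ℝ l b) (inner ℝ l c)) / 2 with hδ
  have hδ0 : 0 < δ := by positivity
  have hm : 0 < min (inner ℝ l a) (min (inner ℝ l b) (inner ℝ l c)) := by positivity
  have ea : δ < inner ℝ l a := (half_lt_self hm).trans_le (min_le_left _ _)
  have eb : δ < inner ℝ l b :=
    (half_lt_self hm).trans_le ((min_le_right _ _).trans (min_le_left _ _))
  have ec : δ < inner ℝ l c :=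
    (half_lt_self hm).trans_le ((min_le_right _ _).trans (min_le_right _ _))
  have c1 : Continuous fun q : E3 × E3 × E3 => inner ℝ l q.1 := by fun_prop
  have c2 : Continuous fun q : E3 × E3 × E3 => inner ℝ l q.2.1 := by fun_prop
  have c3 : Continuous fun q : E3 × E3 × E3 => inner ℝ l q.2.2 := by fun_prop
  refine tendsto_integral_filter_of_dominated_convergence
    (fun t => M * (Real.exp (-(δ * (t 0 + t 1 + t 2))) / 2)) ?_ ?_
    (((integrableOn_octant_exp hδ0).div_const 2).const_mul M) ?_
  · refine .of_forall fun q => Measurable.aestronglyMeasurable ?_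
    exact (measurable_dens hf).comp (by fun_prop)
  · filter_upwards [(isOpen_lt continuous_const c1).mem_nhds ea,
      (isOpen_lt continuous_const c2).mem_nhds eb,
      (isOpen_lt continuous_const c3).mem_nhds ec] with q h1 h2 h3
    filter_upwards [ae_restrict_mem measurableSet_octant] with t ht
    exact abs_dens_comb_le hM0 hM hl (le_of_lt h1) (le_of_lt h2) (le_of_lt h3) ht
  · filter_upwards [ae_restrict_mem measurableSet_octant] with t ht
    have hne : t 0 • a + t 1 • b + t 2 • c ≠ 0 := by
      have := le_norm_comb hl ea.le eb.le ec.le ht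
      have h0 : 0 < t 0 := ht 0 trivial
      have h1 : 0 < t 1 := ht 1 trivial
      have h2 : 0 < t 2 := ht 2 trivial
      rw [← norm_pos_iff]
      exact lt_of_lt_of_le (by positivity) this
    have hc : Continuous fun q : E3 × E3 × E3 => t 0 • q.1 + t 1 • q.2.1 + t 2 • q.2.2 := by
      fun_prop
    exact (continuousAt_dens hf hne).tendsto.comp (hc.tendsto (a, b, c))

/-- The three generators coincide, so only the sum of the coordinates matters and the integral is
elementary. The factor 1/2 is that of the area of a triangle, half the area of a parallelogram. -/
theorem coneInt_self (f : S2 → ℝ) (x : S2) : coneInt f x x x = f x / 2 := by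
  have h : ∀ t ∈ octant, dens f (t 0 • (x : E3) + t 1 • (x : E3) + t 2 • (x : E3)) =
      f x / 2 * Real.exp (-(1 * (t 0 + t 1 + t 2))) := by
    intro t ht
    have h0 : 0 < t 0 := ht 0 trivial
    have h1 : 0 < t 1 := ht 1 trivial
    have h2 : 0 < t 2 := ht 2 trivial
    have hx : ‖(x : E3)‖ = 1 := by simp
    rw [← add_smul, ← add_smul, dens, proj_smul (by positivity), norm_smul, hx,
      Real.norm_eq_abs, abs_of_pos (by positivity)]
    ring_nf
  rw [coneInt, setIntegral_congr_fun measurableSet_octant h, integral_const_mul,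
    integral_octant_exp, mul_one]

/-! ### Signed areas of spherical triangles and the tetrahedron relation. -/

/-- The signed area of the spherical triangle with given vertices (projected to the sphere). -/
def triArea (f : S2 → ℝ) (a b c : E3) : ℝ := det3 a b c * coneInt f a b c

theorem chi_comb (a b c : E3) (t : Fin 3 → ℝ) :
    chi a b c (t 0 • a + t 1 • b + t 2 • c) =
      SignType.sign (det3 a b c) * octant.indicator (fun _ => 1) t := by
  have e1 : det3 (t 0 • a + t 1 • b + t 2 • c) b c = det3 a b c * t 0 := by
    simp only [det3_eq, PiLp.add_apply, PiLp.smul_apply, smul_eq_mul]; ring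
  have e2 : det3 a (t 0 • a + t 1 • b + t 2 • c) c = det3 a b c * t 1 := by
    simp only [det3_eq, PiLp.add_apply, PiLp.smul_apply, smul_eq_mul]; ring
  have e3 : det3 a b (t 0 • a + t 1 • b + t 2 • c) = det3 a b c * t 2 := by
    simp only [det3_eq, PiLp.add_apply, PiLp.smul_apply, smul_eq_mul]; ring
  rw [chi, e1, e2, e3]
  nth_rw 1 [← mul_one (det3 a b c)]
  rw [commonSign_mul]
  congr 1
  have : t ∈ octant ↔ 0 < t 0 ∧ 0 < t 1 ∧ 0 < t 2 := by
    simp [octant, Fin.forall_fin_succ]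
  by_cases ht : t ∈ octant
  · simp [commonSign, ht, this.1 ht]
  · rw [indicator_of_notMem ht, commonSign, if_neg, if_neg]
    · rintro ⟨h, -⟩; linarith
    · rintro ⟨-, h⟩; exact ht (this.2 h)

theorem measurable_chi (a b c : E3) : Measurable (chi a b c) := by
  have h1 : Measurable fun v => det3 v b c := (continuous_det3.comp
    (continuous_id.prodMk (continuous_const.prodMk continuous_const))).measurable
  have h2 : Measurable fun v => det3 a v c := (continuous_det3.comp
    (continuous_const.prodMk (continuous_id.prodMk continuous_const))).measurable
  have h3 : Measurable fun v => det3 a b v := (continuous_det3.comp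
    (continuous_const.prodMk (continuous_const.prodMk continuous_id))).measurable
  unfold chi commonSign
  refine Measurable.ite ?_ measurable_const (Measurable.ite ?_ measurable_const measurable_const)
  · exact (MeasurableSet.const _).inter ((measurableSet_lt measurable_const h1).inter
      ((measurableSet_lt measurable_const h2).inter (measurableSet_lt measurable_const h3)))
  · exact (MeasurableSet.const _).inter ((measurableSet_lt h1 measurable_const).inter
      ((measurableSet_lt h2 measurable_const).inter (measurableSet_lt h3 measurable_const)))

theorem abs_chi_le (a b c v : E3) : |chi a b c v| ≤ 1 := by
  unfold chi commonSign
  split_ifs <;> simp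

theorem integrable_dens_mul_chi {f : S2 → ℝ} (hf : Continuous f) (a b c : E3) :
    Integrable fun v => dens f v * chi a b c v :=
  (integrable_dens hf).mul_bdd (measurable_chi a b c).aestronglyMeasurable
    (ae_of_all _ fun v => abs_chi_le a b c v)

theorem integral_comp_comb {a b c : E3} (hD : det3 a b c ≠ 0) {g : E3 → ℝ} (hg : Measurable g) :
    |det3 a b c| * ∫ t : Fin 3 → ℝ, g (t 0 • a + t 1 • b + t 2 • c) = ∫ v, g v := by
  set M : Matrix (Fin 3) (Fin 3) ℝ := (Matrix.of ![a.ofLp, b.ofLp, c.ofLp]).transpose with hM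
  have hdet : M.det = det3 a b c := by rw [hM, Matrix.det_transpose, det3]
  have hM0 : M.det ≠ 0 := by rwa [hdet]
  have hL : ∀ t, WithLp.toLp 2 (Matrix.toLin' M t) = t 0 • a + t 1 • b + t 2 • c := by
    intro t
    ext i
    simp [M, Matrix.mulVec, dotProduct, Fin.sum_univ_three]
    ring
  have h1 : ∫ w : Fin 3 → ℝ, g (WithLp.toLp 2 w) = ∫ v, g v :=
    (EuclideanSpace.volume_preserving_symm_measurableEquiv_toLp (Fin 3)).symm.integral_comp' g
  have h2 := congrArg (fun μ => ∫ w, g (WithLp.toLp 2 w) ∂μ)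
    (Real.map_matrix_volume_pi_eq_smul_volume_pi hM0)
  simp only at h2
  have h3 : ∫ w, g (WithLp.toLp 2 w) ∂(Measure.map (Matrix.toLin' M) volume) =
      ∫ t, g (WithLp.toLp 2 (Matrix.toLin' M t)) :=
    integral_map (LinearMap.continuous_of_finiteDimensional _).aemeasurable
      (hg.comp (by fun_prop)).aestronglyMeasurable
  rw [integral_smul_measure, h1, h3] at h2
  simp only [hL] at h2
  rw [h2, ENNReal.toReal_ofReal (abs_nonneg _), hdet, smul_eq_mul, abs_inv, ← mul_assoc,
    mul_inv_cancel₀ (abs_ne_zero.2 hD), one_mul]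

/-- The linear change of variables to the generators produces the absolute value of the determinant,
and `chi` contributes its sign. While the definition by coordinates is suited to limits, this form
lets identities between signed cones be integrated. -/
theorem triArea_eq {f : S2 → ℝ} (hf : Continuous f) (a b c : E3) :
    triArea f a b c = ∫ v, dens f v * chi a b c v := by
  by_cases hD : det3 a b c = 0
  · simp [triArea, hD, chi, commonSign]
  rw [← integral_comp_comb hD (g := fun v => dens f v * chi a b c v)
    ((measurable_dens hf).mul (measurable_chi a b c))]
  have h3 : ∀ t : Fin 3 → ℝ, dens f (t 0 • a + t 1 • b + t 2 • c) *
      chi a b c (t 0 • a + t 1 • b + t 2 • c) = SignType.sign (det3 a b c) *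
        octant.indicator (fun t => dens f (t 0 • a + t 1 • b + t 2 • c)) t := by
    intro t
    rw [chi_comb]
    by_cases ht : t ∈ octant <;> simp [ht, mul_comm]
  simp only [h3]
  rw [integral_const_mul, integral_indicator measurableSet_octant, ← mul_assoc, abs_mul_sign]
  rfl

theorem triArea_swap {f : S2 → ℝ} (hf : Continuous f) (a b c : E3) :
    triArea f a c b = -triArea f a b c := by
  rw [triArea_eq hf, triArea_eq hf, ← integral_neg]
  simp [chi_swap a b c]

theorem triArea_self_right (f : S2 → ℝ) (a b : E3) : triArea f a b b = 0 := by
  have : det3 a b b = 0 := by rw [det3_eq]; ring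
  rw [triArea, this, zero_mul]

theorem ae_ne_zero_of_linear (φ : E3 →ₗ[ℝ] ℝ) (h : ∃ v, φ v ≠ 0) : ∀ᵐ v : E3, φ v ≠ 0 := by
  have hk : LinearMap.ker φ ≠ ⊤ := by
    obtain ⟨v, hv⟩ := h
    intro h
    exact hv (LinearMap.mem_ker.1 (h ▸ Submodule.mem_top))
  have := Measure.addHaar_submodule (volume : Measure E3) _ hk
  rw [ae_iff]
  convert this using 2
  ext v
  simp

/-- `det3` as a linear map in the first variable. -/
def det3L (b c : E3) : E3 →ₗ[ℝ] ℝ where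
  toFun v := det3 v b c
  map_add' v w := by simp only [det3_eq, PiLp.add_apply]; ring
  map_smul' r v := by simp only [det3_eq, PiLp.smul_apply, smul_eq_mul, RingHom.id_apply]; ring

theorem ae_det3_ne_zero {b c : E3} (h : ∃ v, det3 v b c ≠ 0) : ∀ᵐ v : E3, det3 v b c ≠ 0 :=
  ae_ne_zero_of_linear (det3L b c) h

/-- The signed areas of the faces of a tetrahedron add up to a multiple of the total area. -/
theorem triArea_cocycle {f : S2 → ℝ} (hf : Continuous f)
    (htotal : ∫ x, f x ∂(volume : Measure E3).toSphere = 1) {p x y z : E3}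
    (hxy : x = y ∨ det3 p x y ≠ 0) (hyz : y = z ∨ det3 p y z ≠ 0) (hzx : z = x ∨ det3 p z x ≠ 0)
    (hs : ∀ b c : ℝ, z = b • x + c • y → 0 < b ∨ 0 < c) :
    ∃ n : ℤ, triArea f p x y + triArea f p y z + triArea f p z x - triArea f x y z = n := by
  have swap := triArea_swap hf
  have hself : ∀ a b : E3, triArea f a a b = 0 := by
    intro a b
    have : det3 a a b = 0 := by rw [det3_eq]; ring
    rw [triArea, this, zero_mul]
  -- If two of `x`, `y`, `z` coincide, the areas vanish or cancel in pairs.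
  by_cases e1 : x = y
  · subst e1
    exact ⟨0, by rw [triArea_self_right, hself, swap p x z]; simp⟩
  by_cases e2 : y = z
  · subst e2
    exact ⟨0, by rw [triArea_self_right, triArea_self_right, swap p x y]; simp⟩
  by_cases e3 : z = x
  · subst e3
    exact ⟨0, by rw [triArea_self_right, swap z z y, hself, swap p z y]; simp⟩
  replace hxy := hxy.resolve_left e1
  replace hyz := hyz.resolve_left e2
  replace hzx := hzx.resolve_left e3
  have hc : ∀ a b c : E3, det3 c a b = det3 a b c := fun a b c => by simp only [det3_eq]; ring
  have hn : ∀ a b c : E3, det3 a b c = -det3 b a c := fun a b c => by simp only [det3_eq]; ring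
  set N : ℤ := if det3 z x y / det3 p x y < 0 ∧ det3 p z y / det3 p x y < 0 ∧
    det3 p x z / det3 p x y < 0 then (SignType.sign (det3 p x y) : ℤ) else 0 with hN
  refine ⟨N, ?_⟩
  have hi := integrable_dens_mul_chi hf
  have hi2 : Integrable fun v => dens f v * chi p x y v + dens f v * chi p y z v :=
    (hi _ _ _).add (hi _ _ _)
  have hi3 : Integrable fun v => dens f v * chi p x y v + dens f v * chi p y z v
      + dens f v * chi p z x v := hi2.add (hi _ _ _)
  rw [triArea_eq hf, triArea_eq hf, triArea_eq hf, triArea_eq hf, ← integral_add (hi _ _ _)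
    (hi _ _ _), ← integral_add hi2 (hi _ _ _), ← integral_sub hi3 (hi _ _ _)]
  -- Off finitely many planes the signed cones combine to the constant `N`; integrating against a
  -- density of total mass 1 returns `N`.
  have : ∀ᵐ v, dens f v * chi p x y v + dens f v * chi p y z v + dens f v * chi p z x v
      - dens f v * chi x y z v = dens f v * N := by
    filter_upwards [ae_det3_ne_zero ⟨p, hxy⟩, ae_det3_ne_zero ⟨p, hyz⟩, ae_det3_ne_zero ⟨p, hzx⟩,
      ae_det3_ne_zero (b := p) (c := y) ⟨x, by rw [hn]; simpa using hxy⟩,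
      ae_det3_ne_zero (b := p) (c := x) ⟨y, by rw [hc]; exact hxy⟩,
      ae_det3_ne_zero (b := p) (c := z) ⟨y, by rw [hn]; simpa using hyz⟩] with v h1 h4 h5 h2 h3 h6
    have := chi_cocycle hxy hyz hzx h1 (by rw [hn]; simpa using h2) (by rw [← hc]; exact h3) h4 h5
      (by rw [hn]; simpa using h6) hs
    rw [← mul_add, ← mul_add, ← mul_sub, this, hN]
    congr 1
    split_ifs <;> simp
  rw [integral_congr_ae this, integral_mul_const, integral_dens, htotal, one_mul]

/-! ### Spherical coordinates -/

/-- Spherical coordinates in which the last two variables run through the unit interval. -/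
def spherical (w : Fin 3 → ℝ) : Fin 3 → ℝ :=
  ![w 0 * -Real.cos (Real.pi * w 1), w 0 * (Real.sin (Real.pi * w 1) * Real.cos (2 * Real.pi * w 2)),
    w 0 * (Real.sin (Real.pi * w 1) * Real.sin (2 * Real.pi * w 2))]

def sphericalDeriv (w : Fin 3 → ℝ) : Matrix (Fin 3) (Fin 3) ℝ :=
  !![-Real.cos (Real.pi * w 1), w 0 * (Real.pi * Real.sin (Real.pi * w 1)), 0;
    Real.sin (Real.pi * w 1) * Real.cos (2 * Real.pi * w 2),
      w 0 * (Real.pi * Real.cos (Real.pi * w 1) * Real.cos (2 * Real.pi * w 2)),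
      -(w 0 * (Real.sin (Real.pi * w 1) * (2 * Real.pi * Real.sin (2 * Real.pi * w 2))));
    Real.sin (Real.pi * w 1) * Real.sin (2 * Real.pi * w 2),
      w 0 * (Real.pi * Real.cos (Real.pi * w 1) * Real.sin (2 * Real.pi * w 2)),
      w 0 * (Real.sin (Real.pi * w 1) * (2 * Real.pi * Real.cos (2 * Real.pi * w 2)))]

theorem det_sphericalDeriv (w : Fin 3 → ℝ) :
    (sphericalDeriv w).det = -(w 0 ^ 2 * (2 * Real.pi ^ 2 * Real.sin (Real.pi * w 1))) := by
  have h1 := Real.sin_sq_add_cos_sq (Real.pi * w 1)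
  have h2 := Real.sin_sq_add_cos_sq (2 * Real.pi * w 2)
  rw [sphericalDeriv]
  generalize Real.sin (Real.pi * w 1) = S at *
  generalize Real.cos (Real.pi * w 1) = C at *
  generalize Real.sin (2 * Real.pi * w 2) = l at *
  generalize Real.cos (2 * Real.pi * w 2) = k at *
  simp only [Matrix.det_fin_three, Matrix.of_apply, Matrix.cons_val', Matrix.cons_val_zero,
    Matrix.cons_val_one, Matrix.cons_val, Matrix.cons_val_fin_one]
  linear_combination (-2 * w 0 ^ 2 * Real.pi ^ 2 * S * (S ^ 2 + C ^ 2)) * h2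
    - 2 * w 0 ^ 2 * Real.pi ^ 2 * S * h1

theorem hasFDerivAt_spherical (w : Fin 3 → ℝ) :
    HasFDerivAt spherical (Matrix.toLin' (sphericalDeriv w)).toContinuousLinearMap w := by
  have hp : ∀ i, HasFDerivAt (fun w : Fin 3 → ℝ => w i)
      (ContinuousLinearMap.proj (R := ℝ) (φ := fun _ : Fin 3 => ℝ) i) w := fun i =>
    hasFDerivAt_apply i w
  have c1 := ((hp 1).const_mul Real.pi).cos
  have s1 := ((hp 1).const_mul Real.pi).sin
  have c2 := ((hp 2).const_mul (2 * Real.pi)).cos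
  have s2 := ((hp 2).const_mul (2 * Real.pi)).sin
  rw [hasFDerivAt_pi']
  intro i
  fin_cases i
  · refine ((hp 0).mul c1.neg).congr_fderiv ?_
    ext v
    simp [sphericalDeriv, dotProduct, Fin.sum_univ_three]
    ring
  · refine ((hp 0).mul (s1.mul c2)).congr_fderiv ?_
    ext v
    simp [sphericalDeriv, dotProduct, Fin.sum_univ_three]
    ring
  · refine ((hp 0).mul (s1.mul s2)).congr_fderiv ?_
    ext v
    simp [sphericalDeriv, dotProduct, Fin.sum_univ_three]
    ring

/-- The domain of spherical coordinates. -/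
def sphericalBox : Set (Fin 3 → ℝ) := {w | 0 < w 0 ∧ w 1 ∈ Ioo (0 : ℝ) 1 ∧ w 2 ∈ Ioo (0 : ℝ) 1}

theorem measurableSet_sphericalBox : MeasurableSet sphericalBox :=
  (measurableSet_lt measurable_const (measurable_pi_apply 0)).inter
    ((measurableSet_Ioo.preimage (measurable_pi_apply 1)).inter
      (measurableSet_Ioo.preimage (measurable_pi_apply 2)))

theorem sin_pi_mul_pos {x : ℝ} (h : x ∈ Ioo (0 : ℝ) 1) : 0 < Real.sin (Real.pi * x) :=
  Real.sin_pos_of_pos_of_lt_pi (mul_pos Real.pi_pos h.1)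
    (by nlinarith [Real.pi_pos, h.2])

/-- The two minus signs shift the angle by π, so that the open interval of azimuths is mapped onto
the range of the argument without its branch cut. -/
theorem arg_spherical {ρ x : ℝ} (hρ : 0 < ρ) (hx : x ∈ Ioo (0 : ℝ) 1) :
    Complex.arg (⟨-(ρ * Real.cos (2 * Real.pi * x)), -(ρ * Real.sin (2 * Real.pi * x))⟩ : ℂ) =
      2 * Real.pi * x - Real.pi := by
  have := Complex.arg_mul_cos_add_sin_mul_I hρ (θ := 2 * Real.pi * x - Real.pi)
    ⟨by nlinarith [Real.pi_pos, hx.1], by nlinarith [Real.pi_pos, hx.2]⟩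
  rw [← this]
  congr 1
  rw [← Complex.ofReal_cos, ← Complex.ofReal_sin, Real.cos_sub_pi, Real.sin_sub_pi]
  apply Complex.ext <;> simp [-Complex.ofReal_cos, -Complex.ofReal_sin]

theorem injOn_spherical : InjOn spherical sphericalBox := by
  rintro w ⟨w0, w1, w2⟩ w' ⟨w0', w1', w2'⟩ h
  have e0 := congrFun h 0
  have e1 := congrFun h 1
  have e2 := congrFun h 2
  simp only [spherical, Matrix.cons_val_zero, Matrix.cons_val_one, Matrix.cons_val] at e0 e1 e2
  have sq : ∀ w : Fin 3 → ℝ, w 0 ^ 2 = (w 0 * -Real.cos (Real.pi * w 1)) ^ 2 +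
      (w 0 * (Real.sin (Real.pi * w 1) * Real.cos (2 * Real.pi * w 2))) ^ 2 +
      (w 0 * (Real.sin (Real.pi * w 1) * Real.sin (2 * Real.pi * w 2))) ^ 2 := by
    intro w
    have h1 := Real.sin_sq_add_cos_sq (Real.pi * w 1)
    have h2 := Real.sin_sq_add_cos_sq (2 * Real.pi * w 2)
    linear_combination (-(w 0) ^ 2) * h1 - (w 0 ^ 2 * Real.sin (Real.pi * w 1) ^ 2) * h2
  have h0 : w 0 = w' 0 := by
    have : w 0 ^ 2 = w' 0 ^ 2 := by rw [sq w, sq w', e0, e1, e2]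
    exact (sq_eq_sq₀ w0.le w0'.le).1 this
  rw [← h0] at e0 e1 e2
  replace e0 := mul_left_cancel₀ w0.ne' e0
  have h1 : w 1 = w' 1 := by
    have hmem : ∀ {x : ℝ}, x ∈ Ioo (0 : ℝ) 1 → Real.pi * x ∈ Icc 0 Real.pi := fun hx =>
      ⟨by nlinarith [Real.pi_pos, hx.1], by nlinarith [Real.pi_pos, hx.2]⟩
    have := Real.injOn_cos (hmem w1) (hmem w1') (neg_injective e0)
    exact mul_left_cancel₀ Real.pi_ne_zero this
  rw [← h1] at e1 e2
  have hs := sin_pi_mul_pos w1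
  have h2 : w 2 = w' 2 := by
    have a := arg_spherical (mul_pos w0 hs) w2
    have a' := arg_spherical (mul_pos w0 hs) w2'
    rw [mul_assoc (w 0), mul_assoc (w 0), e1, e2, ← mul_assoc (w 0), ← mul_assoc (w 0), a'] at a
    have := Real.pi_pos
    have h3 : 2 * Real.pi * (w 2 - w' 2) = 0 := by linarith
    have := (mul_eq_zero.1 h3).resolve_left (by positivity)
    linarith
  ext i
  fin_cases i
  exacts [h0, h1, h2]

/-- The points missed by the coordinates lie on the half-plane of azimuth 0, including the axis.
Discarding the whole plane `v 2 = 0` is enough, as it is a null set. -/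
theorem subset_image_spherical : {v : Fin 3 → ℝ | v 2 ≠ 0} ⊆ spherical '' sphericalBox := by
  intro v hv
  have hv2 : 0 < v 2 ^ 2 := by have : v 2 ≠ 0 := hv; positivity
  have hpi := Real.pi_pos
  set ρ := Real.sqrt (v 0 ^ 2 + v 1 ^ 2 + v 2 ^ 2) with hρ
  have hρ2 : ρ ^ 2 = v 0 ^ 2 + v 1 ^ 2 + v 2 ^ 2 := Real.sq_sqrt (by positivity)
  have hρ0 : 0 < ρ := Real.sqrt_pos.2 (by positivity)
  set x := -(v 0 / ρ) with hx
  have hxρ : ρ * x = -v 0 := by rw [hx]; field_simp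
  have hx2 : x ^ 2 < 1 := by
    rw [hx, neg_sq, div_pow, div_lt_one (by positivity), hρ2]
    nlinarith [sq_nonneg (v 1)]
  have hx' := abs_lt.1 ((sq_lt_one_iff_abs_lt_one x).1 hx2)
  set z : ℂ := ⟨-v 1, -v 2⟩ with hz
  have hz0 : z ≠ 0 := fun h => hv (by simpa [hz] using congrArg Complex.im h)
  have harg : Complex.arg z < Real.pi := by
    refine (Complex.arg_le_pi z).lt_of_ne fun h => hv ?_
    have := (Complex.arg_eq_pi_iff.1 h).2
    simpa [hz] using this
  have harg' := Complex.neg_pi_lt_arg z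
  have hsin : Real.sin (Real.arccos x) * ρ = ‖z‖ := by
    rw [Real.sin_arccos, Complex.norm_eq_sqrt_sq_add_sq, ← Real.sqrt_sq hρ0.le,
      ← Real.sqrt_mul (by nlinarith)]
    congr 1
    simp only [hz]
    linear_combination hρ2 - (ρ * x - v 0) * hxρ
  have a1 : Real.pi * (Real.arccos x / Real.pi) = Real.arccos x := by field_simp
  have a2 : 2 * Real.pi * ((Complex.arg z + Real.pi) / (2 * Real.pi)) = Complex.arg z + Real.pi := by
    field_simp
  refine ⟨![ρ, Real.arccos x / Real.pi, (Complex.arg z + Real.pi) / (2 * Real.pi)], ?_, ?_⟩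
  · refine ⟨hρ0, ⟨div_pos (Real.arccos_pos.2 hx'.2) hpi, ?_⟩, ?_, ?_⟩
    · simp only [Matrix.cons_val_one, Matrix.cons_val_zero]
      rw [div_lt_one hpi]
      exact (Real.arccos_le_pi x).lt_of_ne fun h => by
        rw [Real.arccos_eq_pi] at h; linarith
    · simp only [Matrix.cons_val]
      exact div_pos (by linarith) (by positivity)
    · simp only [Matrix.cons_val]
      rw [div_lt_one (by positivity)]
      linarith
  · have r1 := Complex.norm_mul_cos_arg z
    have r2 := Complex.norm_mul_sin_arg z
    ext i
    fin_cases i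
    · simp only [spherical, Fin.zero_eta, Matrix.cons_val_zero, Matrix.cons_val_one]
      rw [a1, Real.cos_arccos hx'.1.le hx'.2.le]
      linarith
    · simp only [spherical, Fin.mk_one, Matrix.cons_val_zero, Matrix.cons_val_one, Matrix.cons_val]
      rw [a1, a2, Real.cos_add_pi, ← mul_assoc, mul_comm ρ, hsin, mul_neg, r1]
      simp [hz]
    · simp only [spherical, Fin.reduceFinMk, Matrix.cons_val_zero, Matrix.cons_val_one,
        Matrix.cons_val]
      rw [a1, a2, Real.sin_add_pi, ← mul_assoc, mul_comm ρ, hsin, mul_neg, r2]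
      simp [hz]

theorem integral_spherical (h : (Fin 3 → ℝ) → ℝ) :
    ∫ v, h v = ∫ w in sphericalBox,
      w 0 ^ 2 * (2 * Real.pi ^ 2 * Real.sin (Real.pi * w 1)) * h (spherical w) := by
  have hae : spherical '' sphericalBox =ᵐ[volume] univ := by
    rw [ae_eq_univ]
    refine measure_mono_null (compl_subset_comm.1 ?_)
      (Measure.pi_hyperplane (fun _ : Fin 3 => (volume : Measure ℝ)) 2 0)
    exact subset_image_spherical
  rw [← setIntegral_univ, ← setIntegral_congr_set hae,
    integral_image_eq_integral_abs_det_fderiv_smul volume measurableSet_sphericalBox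
      (fun w _ => (hasFDerivAt_spherical w).hasFDerivWithinAt) injOn_spherical]
  refine setIntegral_congr_fun measurableSet_sphericalBox fun w hw => ?_
  have := sin_pi_mul_pos hw.2.1
  have hdet : (Matrix.toLin' (sphericalDeriv w)).toContinuousLinearMap.det =
      -(w 0 ^ 2 * (2 * Real.pi ^ 2 * Real.sin (Real.pi * w 1))) := by
    rw [← det_sphericalDeriv, ← LinearMap.det_toLin']
    rfl
  simp only [smul_eq_mul]
  rw [hdet, abs_neg, abs_of_nonneg (by positivity)]

/-- Integration over the sphere in spherical coordinates with respect to an orthonormal frame. -/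
theorem integral_sphere_eq {f : S2 → ℝ} (hf : Continuous f) {a b c : E3} (habc : |det3 a b c| = 1)
    (hn : ∀ r s t : ℝ, ‖r • a + s • b + t • c‖ ^ 2 = r ^ 2 + s ^ 2 + t ^ 2) :
    ∫ x, f x ∂(volume : Measure E3).toSphere =
      ∫ q in Icc (0 : ℝ) 1 ×ˢ Icc (0 : ℝ) 1, 2 * Real.pi ^ 2 * Real.sin (Real.pi * q.1) *
        f (proj (-Real.cos (Real.pi * q.1) • a +
          (Real.sin (Real.pi * q.1) * Real.cos (2 * Real.pi * q.2)) • b +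
          (Real.sin (Real.pi * q.1) * Real.sin (2 * Real.pi * q.2)) • c)) := by
  have hD : det3 a b c ≠ 0 := fun h => by simp [h] at habc
  rw [← integral_dens, ← integral_comp_comb hD (measurable_dens hf), habc, one_mul,
    integral_spherical]
  set X : ℝ × ℝ → E3 := fun q => -Real.cos (Real.pi * q.1) • a +
          (Real.sin (Real.pi * q.1) * Real.cos (2 * Real.pi * q.2)) • b +
          (Real.sin (Real.pi * q.1) * Real.sin (2 * Real.pi * q.2)) • c with hX
  have hX1 : ∀ q, ‖X q‖ = 1 := by
    intro q
    have h1 := Real.sin_sq_add_cos_sq (Real.pi * q.1)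
    have h2 := Real.sin_sq_add_cos_sq (2 * Real.pi * q.2)
    have : ‖X q‖ ^ 2 = 1 := by
      rw [hX, hn]
      linear_combination h1 + Real.sin (Real.pi * q.1) ^ 2 * h2
    exact (sq_eq_sq₀ (norm_nonneg _) zero_le_one).1 (by rw [this]; norm_num)
  have e1 : MeasurePreserving (MeasurableEquiv.piFinSuccAbove (fun _ : Fin 3 => ℝ) 0)
      volume (volume : Measure (ℝ × (Fin 2 → ℝ))) :=
    volume_preserving_piFinSuccAbove (fun _ : Fin 3 => ℝ) 0
  have e2 : MeasurePreserving ((MeasurableEquiv.refl ℝ).prodCongr MeasurableEquiv.finTwoArrow)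
      (volume : Measure (ℝ × (Fin 2 → ℝ))) (volume : Measure (ℝ × (ℝ × ℝ))) :=
    (MeasurePreserving.id (volume : Measure ℝ)).prod (volume_preserving_finTwoArrow ℝ)
  -- The integrand is a product of a radial factor, whose integral is 1, and the angular factor that
  -- is wanted.
  set g : ℝ × (ℝ × ℝ) → ℝ := fun y => (y.1 ^ 2 * (Real.exp (-y.1) / 2)) *
    (2 * Real.pi ^ 2 * Real.sin (Real.pi * y.2.1) * f (proj (X y.2))) with hg
  set B : Set (ℝ × (ℝ × ℝ)) := Ioi 0 ×ˢ (Ioo 0 1 ×ˢ Ioo 0 1) with hB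
  have hBm : MeasurableSet B := measurableSet_Ioi.prod (measurableSet_Ioo.prod measurableSet_Ioo)
  have h1 : ∫ w in sphericalBox, w 0 ^ 2 * (2 * Real.pi ^ 2 * Real.sin (Real.pi * w 1)) *
      dens f (spherical w 0 • a + spherical w 1 • b + spherical w 2 • c) =
      ∫ w in sphericalBox, g (w 0, (w 1, w 2)) := by
    refine setIntegral_congr_fun measurableSet_sphericalBox fun w hw => ?_
    have hw0 : 0 < w 0 := hw.1
    have e1 : spherical w 0 • a + spherical w 1 • b + spherical w 2 • c = w 0 • X (w 1, w 2) := by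
      simp only [spherical, Matrix.cons_val_zero, Matrix.cons_val_one, Matrix.cons_val, hX,
        smul_add, smul_smul]
    have hne : X (w 1, w 2) ≠ 0 := fun h => by simpa [h] using hX1 (w 1, w 2)
    have e2 : (proj (X (w 1, w 2)) : E3) = X (w 1, w 2) := by
      rw [coe_proj hne, hX1, inv_one, one_smul]
    have e3 : proj (w 0 • X (w 1, w 2)) = proj (X (w 1, w 2)) := by
      conv_lhs => rw [← e2]
      exact proj_smul hw0 _
    simp only [hg]
    rw [e1, dens, norm_smul, hX1, Real.norm_eq_abs, abs_of_pos hw0, e3, mul_one (w 0)]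
    ring
  have h2 : ∫ w in sphericalBox, g (w 0, (w 1, w 2)) = ∫ y in B, g y := by
    rw [← integral_indicator measurableSet_sphericalBox, ← integral_indicator hBm]
    rw [← e2.integral_comp', ← e1.integral_comp']
    rfl
  rw [h1, h2, hB, hg, Measure.volume_eq_prod, setIntegral_prod_mul
    (fun r : ℝ => r ^ 2 * (Real.exp (-r) / 2))
    (fun y : ℝ × ℝ => 2 * Real.pi ^ 2 * Real.sin (Real.pi * y.1) * f (proj (X y))),
    integral_radial, one_mul, setIntegral_congr_set]
  exact Measure.set_prod_ae_eq Ioo_ae_eq_Icc Ioo_ae_eq_Icc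

/-! ### Sums over fine partitions -/

/-- A function of the cells of partitions that is approximately the integral of `h` over each cell
tends to the integral of `h` when summed over the partition. -/
theorem tendsto_sum_of_density {X ι : Type*} [MeasurableSpace X] {μ : Measure X}
    (s : ℕ → Finset ι) (A : ℕ → ι → Set X) (w : ℕ → ι → ℝ) (h : X → ℝ) (S : Set X) (C : ℝ)
    (hS : μ S ≠ ⊤) (meas : ∀ n k, MeasurableSet (A n k))
    (disj : ∀ n, (s n : Set ι).PairwiseDisjoint (A n))
    (cover : ∀ᶠ n in atTop, ⋃ k ∈ s n, A n k = S)
    (bound : ∀ᶠ n in atTop, ∀ k ∈ s n, |w n k| ≤ C * μ.real (A n k))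
    (lim : ∀ᵐ x ∂μ.restrict S, ∀ k : ℕ → ι, (∀ᶠ n in atTop, k n ∈ s n ∧ x ∈ A n (k n)) →
      Tendsto (fun n => w n (k n) / μ.real (A n (k n))) atTop (𝓝 (h x))) :
    IntegrableOn h S μ ∧
      Tendsto (fun n => ∑ k ∈ s n, w n k) atTop (𝓝 (∫ x in S, h x ∂μ)) := by
  have hSm : MeasurableSet S := by
    obtain ⟨m, hm⟩ := cover.exists
    rw [← hm]
    exact Finset.measurableSet_biUnion _ fun k _ => meas m k
  -- The step function with the average density of each cell. Its integral is the sum in question,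
  -- it is bounded by `|C|` and converges almost everywhere, so dominated convergence applies.
  set G : ℕ → X → ℝ := fun n x => ∑ k ∈ s n, (A n k).indicator (fun _ => w n k / μ.real (A n k)) x
    with hG
  have hfin : IsFiniteMeasure (μ.restrict S) := ⟨by simpa using hS.lt_top⟩
  have hGval : ∀ n k x, k ∈ s n → x ∈ A n k → G n x = w n k / μ.real (A n k) := by
    intro n k x hk hx
    simp only [hG]
    rw [Finset.sum_eq_single_of_mem k hk, indicator_of_mem hx]
    intro j hj hjk
    refine indicator_of_notMem (fun hxj => ?_) _
    exact Set.disjoint_left.1 (disj n hj hk hjk) hxj hx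
  have hGm : ∀ n, AEStronglyMeasurable (G n) (μ.restrict S) := fun n =>
    (Finset.measurable_fun_sum _ fun k _ =>
      measurable_const.indicator (meas n k)).aestronglyMeasurable
  have hGb : ∀ᶠ n in atTop, ∀ x, ‖G n x‖ ≤ |C| := by
    filter_upwards [bound] with n hb x
    by_cases hx : ∃ k ∈ s n, x ∈ A n k
    · obtain ⟨k, hk, hx⟩ := hx
      rw [hGval n k x hk hx, Real.norm_eq_abs, abs_div, abs_of_nonneg (a := μ.real _)
        measureReal_nonneg]
      refine div_le_of_le_mul₀ measureReal_nonneg (abs_nonneg _) ((hb k hk).trans ?_)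
      gcongr
      exact le_abs_self C
    · have : G n x = 0 := Finset.sum_eq_zero fun k hk =>
        indicator_of_notMem (fun h => hx ⟨k, hk, h⟩) _
      simp [this]
  have hGlim : ∀ᵐ x ∂μ.restrict S, Tendsto (fun n => G n x) atTop (𝓝 (h x)) := by
    filter_upwards [lim, ae_restrict_mem hSm] with x hx hxS
    have : ∀ n, ∃ k, (⋃ k ∈ s n, A n k = S) → k ∈ s n ∧ x ∈ A n k := by
      intro n
      by_cases hc : ⋃ k ∈ s n, A n k = S
      · rw [← hc] at hxS
        simp only [mem_iUnion, exists_prop] at hxS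
        exact ⟨hxS.choose, fun _ => hxS.choose_spec⟩
      · have hne : Nonempty ι := by
          obtain ⟨m, hm⟩ := cover.exists
          rw [← hm] at hxS
          simp only [mem_iUnion, exists_prop] at hxS
          exact ⟨hxS.choose⟩
        exact ⟨hne.some, fun h => absurd h hc⟩
    choose k hk using this
    have hev : ∀ᶠ n in atTop, k n ∈ s n ∧ x ∈ A n (k n) := cover.mono fun n hn => hk n hn
    refine (hx k hev).congr' ?_
    filter_upwards [hev] with n hn
    exact (hGval n _ x hn.1 hn.2).symm
  have hlim : Tendsto (fun n => ∫ x in S, G n x ∂μ) atTop (𝓝 (∫ x in S, h x ∂μ)) :=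
    tendsto_integral_filter_of_dominated_convergence (fun _ => |C|) (.of_forall hGm)
      (hGb.mono fun n hn => ae_of_all _ hn) (integrable_const _) hGlim
  refine ⟨(integrable_const |C|).mono' (aestronglyMeasurable_of_tendsto_ae atTop hGm hGlim) ?_, ?_⟩
  · filter_upwards [hGlim] with x hx
    exact le_of_tendsto hx.norm (hGb.mono fun n hn => hn x)
  refine hlim.congr' ?_
  filter_upwards [cover, bound] with n hc hb
  have hsub : ∀ k ∈ s n, A n k ⊆ S := fun k hk => hc ▸ subset_biUnion_of_mem (u := A n) hk
  simp only [hG]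
  rw [integral_finsetSum]
  · refine Finset.sum_congr rfl fun k hk => ?_
    rw [integral_indicator (meas n k), Measure.restrict_restrict (meas n k),
      inter_eq_left.2 (hsub k hk), integral_const, measureReal_restrict_apply_univ, smul_eq_mul]
    -- On a null cell the bound forces the weight to vanish. This also covers empty cells, which
    -- occur where a parametrization pauses.
    by_cases h0 : μ.real (A n k) = 0
    · have := hb k hk
      rw [h0, mul_zero] at this
      rw [h0, zero_mul, abs_eq_zero.1 (le_antisymm this (abs_nonneg _))]
    · field_simp
  · exact fun k _ => (integrable_const _).indicator (meas n k)

/-- Difference quotients over pairs of points near the base point converge to the derivative. -/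
theorem tendsto_scaled_sub {E F : Type*} [NormedAddCommGroup E] [NormedSpace ℝ E]
    [NormedAddCommGroup F] [NormedSpace ℝ F] {g : E → F} {L : E →L[ℝ] F} {q v : E}
    (hg : HasFDerivAt g L q) {x y : ℕ → E} {h : ℕ → ℝ} (hpos : ∀ᶠ n in atTop, 0 < h n)
    (h0 : Tendsto h atTop (𝓝 0)) (hx : ∀ᶠ n in atTop, ‖x n - q‖ ≤ h n)
    (hy : ∀ᶠ n in atTop, ‖y n - q‖ ≤ h n)
    (hv : ∀ᶠ n in atTop, (h n)⁻¹ • (y n - x n) = v) :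
    Tendsto (fun n => (h n)⁻¹ • (g (y n) - g (x n))) atTop (𝓝 (L v)) := by
  -- Neither end point need be the base point, so the linearization error at `q` is estimated for
  -- each of them separately; both errors are o(h).
  have key : ∀ z : ℕ → E, (∀ᶠ n in atTop, ‖z n - q‖ ≤ h n) →
      Tendsto (fun n => (h n)⁻¹ • (g (z n) - g q - L (z n - q))) atTop (𝓝 0) := by
    intro z hz
    have hz0 : Tendsto z atTop (𝓝 q) := by
      rw [tendsto_iff_norm_sub_tendsto_zero]
      exact squeeze_zero' (.of_forall fun _ => norm_nonneg _) hz h0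
    rw [Metric.tendsto_atTop]
    intro ε hε
    have := hg.isLittleO.def (half_pos hε)
    have h1 := (hz0.eventually this).and (hz.and hpos)
    obtain ⟨N, hN⟩ := eventually_atTop.1 h1
    refine ⟨N, fun n hn => ?_⟩
    obtain ⟨a, b, c⟩ := hN n hn
    rw [dist_zero_right, norm_smul, norm_inv, Real.norm_eq_abs, abs_of_pos c, inv_mul_lt_iff₀ c]
    calc _ ≤ ε / 2 * ‖z n - q‖ := a
      _ ≤ ε / 2 * h n := by gcongr
      _ < h n * ε := by nlinarith
  have := ((key y hy).sub (key x hx)).add (tendsto_const_nhds (x := L v))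
  rw [sub_zero, zero_add] at this
  refine this.congr' ?_
  filter_upwards [hv] with n hn
  rw [← hn, map_smul, ← smul_sub, ← smul_add]
  congr 1
  simp only [map_sub]
  abel

/-! ### Piecewise smooth functions are Lipschitz -/

/-- The break points together with the end points of the unit interval. -/
def breaks (F : Finset ℝ) : Finset ℝ := insert 0 (insert 1 F)

/-- The consecutive break points around `u`, with `u` strictly below the upper one, so that there is
always room to move to the right. -/
theorem exists_gap_right (F : Finset ℝ) {u : ℝ} (h0 : 0 ≤ u) (h1 : u < 1) :
    ∃ a ∈ breaks F, ∃ b ∈ breaks F, 0 ≤ a ∧ a ≤ u ∧ u < b ∧ b ≤ 1 ∧ (∀ t ∈ F, t ∉ Ioo a b) ∧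
      (u ∉ breaks F → a < u) := by
  classical
  have n1 : ((breaks F).filter (· ≤ u)).Nonempty := ⟨0, by simp [breaks, h0]⟩
  have n2 : ((breaks F).filter (u < ·)).Nonempty := ⟨1, by simp [breaks, h1]⟩
  have m1 := Finset.mem_filter.1 (Finset.max'_mem _ n1)
  have m2 := Finset.mem_filter.1 (Finset.min'_mem _ n2)
  refine ⟨_, m1.1, _, m2.1, Finset.le_max' _ _ (by simp [breaks, h0]), m1.2, m2.2,
    Finset.min'_le _ _ (by simp [breaks, h1]), fun t ht hm => ?_, fun hu => ?_⟩
  · have ht' : t ∈ breaks F := by simp [breaks, ht]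
    rcases le_or_gt t u with h | h
    · exact hm.1.not_ge (Finset.le_max' _ _ (Finset.mem_filter.2 ⟨ht', h⟩))
    · exact hm.2.not_ge (Finset.min'_le _ _ (Finset.mem_filter.2 ⟨ht', h⟩))
  · exact m1.2.lt_of_ne fun h => hu (h ▸ m1.1)

theorem exists_gap (F : Finset ℝ) {u : ℝ} (h0 : 0 ≤ u) (h1 : u ≤ 1) :
    ∃ a ∈ breaks F, ∃ b ∈ breaks F, 0 ≤ a ∧ a < b ∧ b ≤ 1 ∧ (∀ t ∈ F, t ∉ Ioo a b) ∧
      u ∈ Icc a b ∧ (u ∉ breaks F → u ∈ Ioo a b) := by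
  classical
  rcases h1.lt_or_eq with h | rfl
  · obtain ⟨a, ha, b, hb, h1, h2, h3, h4, h5, h6⟩ := exists_gap_right F h0 h
    exact ⟨a, ha, b, hb, h1, h2.trans_lt h3, h4, h5, ⟨h2, h3.le⟩, fun hu => ⟨h6 hu, h3⟩⟩
  · have n1 : ((breaks F).filter (· < 1)).Nonempty := ⟨0, by simp [breaks]⟩
    have m1 := Finset.mem_filter.1 (Finset.max'_mem _ n1)
    refine ⟨_, m1.1, 1, by simp [breaks], Finset.le_max' _ _ (by simp [breaks]), m1.2, le_rfl,
      fun t ht hm => ?_, ⟨m1.2.le, le_rfl⟩, fun hu => absurd (by simp [breaks]) hu⟩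
    have hmem : t ∈ (breaks F).filter (· < 1) := Finset.mem_filter.2 ⟨by simp [breaks, ht], hm.2⟩
    exact hm.1.not_ge (Finset.le_max' _ _ hmem)

theorem lipschitzOn_of_gaps {E : Type*} [NormedAddCommGroup E] {g : ℝ → E} {F : Finset ℝ} {K : ℝ≥0}
    (hg : ContinuousOn g (Icc 0 1))
    (h : ∀ a ∈ breaks F, ∀ b ∈ breaks F, 0 ≤ a → a < b → b ≤ 1 → (∀ t ∈ F, t ∉ Ioo a b) →
      LipschitzOnWith K g (Icc a b)) : LipschitzOnWith K g (Icc 0 1) := by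
  have key : ∀ s t : ℝ, 0 ≤ s → s ≤ t → t ≤ 1 → ‖g t - g s‖ ≤ K * (t - s) := by
    intro s t hs hst ht
    have hsub : Icc s t ⊆ Icc 0 1 := Icc_subset_Icc hs ht
    have hcl : IsClosed ({x | ‖g x - g s‖ ≤ K * (x - s)} ∩ Icc s t) := by
      have := (((hg.mono hsub).sub (continuousOn_const (c := g s))).norm).prodMk
        (ContinuousOn.mul (continuousOn_const (c := (K : ℝ)))
          (continuousOn_id.sub (continuousOn_const (c := s))))
      have := this.preimage_isClosed_of_isClosed isClosed_Icc
        (OrderClosedTopology.isClosed_le' (α := ℝ))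
      rwa [inter_comm]
    -- Continuous induction: the set where the estimate holds is closed, and from each of its points
    -- one can advance inside the next gap with the same constant.
    refine hcl.Icc_subset_of_forall_exists_gt (by simp) ?_ ⟨hst, le_rfl⟩
    rintro x ⟨hx, hxs, hxt⟩ y hy
    obtain ⟨a, ha, b, hb, h1, h2, h3, h4, h5, -⟩ := exists_gap_right F (hs.trans hxs)
      (hxt.trans_le ht)
    have hL := h a ha b hb h1 (h2.trans_lt h3) h4 h5
    refine ⟨min y b, ?_, lt_min hy h3, min_le_left _ _⟩
    have hxy : x < min y b := lt_min hy h3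
    have := hL.dist_le_mul (min y b) ⟨h2.trans hxy.le, min_le_right _ _⟩ x ⟨h2, h3.le⟩
    rw [dist_eq_norm, Real.dist_eq, abs_of_pos (sub_pos.2 hxy)] at this
    have hx' : ‖g x - g s‖ ≤ K * (x - s) := hx
    calc ‖g (min y b) - g s‖ ≤ ‖g (min y b) - g x‖ + ‖g x - g s‖ :=
          norm_sub_le_norm_sub_add_norm_sub ..
      _ ≤ K * (min y b - x) + K * (x - s) := add_le_add this hx'
      _ = K * (min y b - s) := by ring
  refine LipschitzOnWith.of_dist_le_mul fun x hx y hy => ?_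
  rcases le_total x y with hxy | hxy
  · rw [dist_comm, dist_comm x, dist_eq_norm, Real.dist_eq, abs_of_nonneg (sub_nonneg.2 hxy)]
    exact key x y hx.1 hxy hy.2
  · rw [dist_eq_norm, Real.dist_eq, abs_of_nonneg (sub_nonneg.2 hxy)]
    exact key y x hy.1 hxy hx.2

variable {x₀ : S2}

theorem continuous_fn (σ : Loop x₀) : Continuous σ.fn := σ.path.continuous_extend

theorem Loop.exists_lipschitz (σ : Loop x₀) :
    ∃ K : ℝ≥0, LipschitzOnWith K (fun t => (σ.fn t : E3)) (Icc 0 1) := by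
  classical
  obtain ⟨F, hF⟩ := σ.smooth
  -- The constant is chosen for every pair, with 0 for pairs that are not gaps, so that a supremum
  -- over the finite set of pairs of break points can be taken.
  have : ∀ q : ℝ × ℝ, ∃ K : ℝ≥0, 0 ≤ q.1 → q.1 < q.2 → q.2 ≤ 1 → (∀ t ∈ F, t ∉ Ioo q.1 q.2) →
      LipschitzOnWith K (fun t => (σ.fn t : E3)) (Icc q.1 q.2) := by
    intro q
    by_cases h : 0 ≤ q.1 ∧ q.1 < q.2 ∧ q.2 ≤ 1 ∧ (∀ t ∈ F, t ∉ Ioo q.1 q.2)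
    · obtain ⟨h1, h2, h3, h4⟩ := h
      obtain ⟨K, hK⟩ := (hF _ _ h1 h2 h3 h4).exists_lipschitzOnWith (by simp) (convex_Icc _ _)
        isCompact_Icc
      exact ⟨K, fun _ _ _ _ => hK⟩
    · exact ⟨0, fun h1 h2 h3 h4 => absurd ⟨h1, h2, h3, h4⟩ h⟩
  choose K hK using this
  refine ⟨(breaks F ×ˢ breaks F).sup K, lipschitzOn_of_gaps (F := F)
    (continuous_subtype_val.comp (continuous_fn σ)).continuousOn ?_⟩
  intro a ha b hb h1 h2 h3 h4
  exact (hK (a, b) h1 h2 h3 h4).weaken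
    (Finset.le_sup (f := K) (b := (a, b)) (Finset.mk_mem_product ha hb))

theorem Loop.ae_differentiableAt (σ : Loop x₀) :
    ∀ᵐ u ∂(volume.restrict (Icc (0 : ℝ) 1)), DifferentiableAt ℝ (fun t => (σ.fn t : E3)) u := by
  obtain ⟨F, hF⟩ := σ.smooth
  have : ∀ᵐ u : ℝ, u ∉ (breaks F : Set ℝ) := by
    rw [ae_iff]; simpa using (breaks F).finite_toSet.measure_zero volume
  filter_upwards [ae_restrict_mem measurableSet_Icc, ae_restrict_of_ae this] with u hu hub
  obtain ⟨a, -, b, -, h1, h2, h3, h4, h5, h6⟩ := exists_gap F hu.1 hu.2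
  exact ((hF a b h1 h2 h3 h4).contDiffAt (Icc_mem_nhds (h6 hub).1 (h6 hub).2)).differentiableAt
    (by simp)

/-! ### Signed areas of small triangles -/

theorem norm_coe_S2 (x : S2) : ‖(x : E3)‖ = 1 := by simp

theorem inner_self_S2 (x : S2) : inner ℝ (x : E3) (x : E3) = (1 : ℝ) := by
  rw [real_inner_self_eq_norm_sq, norm_coe_S2, one_pow]

theorem le_inner_of_norm_sub_le {l y z : E3} {r : ℝ} (hl : ‖l‖ ≤ 1) (h : ‖z - y‖ ≤ r) :
    inner ℝ l y - r ≤ inner ℝ l z := by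
  have h1 := (abs_le.1 (abs_real_inner_le_norm l (z - y))).1
  have h2 : ‖l‖ * ‖z - y‖ ≤ 1 * ‖z - y‖ := by gcongr
  rw [inner_sub_right] at h1
  linarith

/-- The determinant is unchanged when `x` is subtracted from `y` and `z`, hence quadratic in the
side lengths. The cone integral is bounded because `x` itself has inner product at least 1/2 with
all three vertices. -/
theorem exists_triArea_bound {f : S2 → ℝ} (hf : Continuous f) :
    ∃ C, 0 ≤ C ∧ ∀ x y z : S2, ‖(y - x : E3)‖ ≤ 1 / 2 → ‖(z - x : E3)‖ ≤ 1 / 2 →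
      |triArea f x y z| ≤ C * (‖(y - x : E3)‖ * ‖(z - x : E3)‖) := by
  obtain ⟨C, hC0, hC⟩ := exists_coneInt_bound hf (δ := 1 / 2) (by norm_num)
  refine ⟨6 * C, by positivity, fun x y z hy hz => ?_⟩
  have hx := inner_self_S2 x
  have h1 := le_inner_of_norm_sub_le (norm_coe_S2 x).le hy
  have h2 := le_inner_of_norm_sub_le (norm_coe_S2 x).le hz
  have h3 := hC x x y z (norm_coe_S2 x).le (by linarith) (by linarith) (by linarith)
  have h4 := abs_det3_le x (y - x) (z - x)
  rw [det3_sub_sub, norm_coe_S2, one_mul] at h4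
  rw [triArea, abs_mul]
  calc _ ≤ 6 * (‖(y - x : E3)‖ * ‖(z - x : E3)‖) * C := by gcongr
    _ = _ := by ring

/-- The rescaled determinant tends to that of the limiting edge vectors, while the cone integral
tends to its value at three equal generators. -/
theorem tendsto_triArea {f : S2 → ℝ} (hf : Continuous f) {a b c : ℕ → S2} {x : S2} {h : ℕ → ℝ}
    {v w : E3} (ha : Tendsto a atTop (𝓝 x)) (hb : Tendsto b atTop (𝓝 x))
    (hc : Tendsto c atTop (𝓝 x))
    (hv : Tendsto (fun n => (h n)⁻¹ • (b n - a n : E3)) atTop (𝓝 v))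
    (hw : Tendsto (fun n => (h n)⁻¹ • (c n - a n : E3)) atTop (𝓝 w)) :
    Tendsto (fun n => triArea f (a n) (b n) (c n) / (h n * h n)) atTop
      (𝓝 (det3 x v w * (f x / 2))) := by
  have cv : Tendsto (fun s : S2 => (s : E3)) (𝓝 x) (𝓝 (x : E3)) := continuous_subtype_val.tendsto x
  have h1 := tendsto_det3 (cv.comp ha) hv hw
  have hx : (0 : ℝ) < inner ℝ (x : E3) (x : E3) := by rw [inner_self_S2]; norm_num
  have h2 := (continuousAt_coneInt hf (norm_coe_S2 x).le hx hx hx).tendsto.comp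
    ((cv.comp ha).prodMk_nhds ((cv.comp hb).prodMk_nhds (cv.comp hc)))
  rw [← coneInt_self]
  refine (h1.mul h2).congr fun n => ?_
  simp only [Function.comp_apply, det3_smul, det3_sub_sub, triArea]
  ring

/-! ### Holonomy along loops -/

/-- The loop does not meet the ray through `-p`. -/
def Avoids (p : E3) (σ : Loop x₀) : Prop := ∀ t, 0 < ‖p‖ + inner ℝ p (σ.fn t : E3)

/-- The density of the area swept by the segments from `p` to the points of the loop. -/
def holDens (f : S2 → ℝ) (p : E3) (σ : Loop x₀) (u : ℝ) : ℝ :=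
  det3 p (σ.fn u) (deriv (fun t => (σ.fn t : E3)) u) * coneInt f p (σ.fn u) (σ.fn u)

theorem Avoids.ne_zero {p : E3} {σ : Loop x₀} (h : Avoids p σ) : p ≠ 0 := by
  rintro rfl
  simpa using h 0

/-- The midpoint of `p / ‖p‖` and `x` serves as the functional `l` for the thin triangles with apex
`p`. It has positive inner product with both `p` and `x` as long as `x` is not opposite to `p`. -/
theorem norm_midpoint_le {p : E3} (hp : p ≠ 0) (x : S2) :
    ‖(1 / 2 : ℝ) • (‖p‖⁻¹ • p + (x : E3))‖ ≤ 1 := by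
  have h1 : ‖‖p‖⁻¹ • p‖ = 1 := by
    rw [norm_smul, norm_inv, norm_norm, inv_mul_cancel₀ (norm_ne_zero_iff.2 hp)]
  have := norm_add_le (‖p‖⁻¹ • p) (x : E3)
  rw [h1, norm_coe_S2] at this
  rw [norm_smul, Real.norm_eq_abs, abs_of_pos (by norm_num)]
  linarith

theorem inner_midpoint_left {p : E3} (hp : p ≠ 0) (x : S2) :
    inner ℝ ((1 / 2 : ℝ) • (‖p‖⁻¹ • p + (x : E3))) p = (‖p‖ + inner ℝ p (x : E3)) / 2 := by
  have := norm_ne_zero_iff.2 hp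
  rw [real_inner_smul_left, inner_add_left, real_inner_smul_left, real_inner_self_eq_norm_sq,
    real_inner_comm]
  field_simp

theorem inner_midpoint_right {p : E3} (hp : p ≠ 0) (x : S2) :
    inner ℝ ((1 / 2 : ℝ) • (‖p‖⁻¹ • p + (x : E3))) (x : E3) =
      (‖p‖ + inner ℝ p (x : E3)) / (2 * ‖p‖) := by
  have := norm_ne_zero_iff.2 hp
  rw [real_inner_smul_left, inner_add_left, real_inner_smul_left, inner_self_S2]
  field_simp
  ring

theorem Avoids.exists_bound {p : E3} {σ : Loop x₀} (h : Avoids p σ) {f : S2 → ℝ}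
    (hf : Continuous f) :
    ∃ C η : ℝ, 0 ≤ C ∧ 0 < η ∧ ∀ s t, s ∈ Icc (0 : ℝ) 1 → t ∈ Icc (0 : ℝ) 1 → |t - s| ≤ η →
      |triArea f p (σ.fn s) (σ.fn t)| ≤ C * |t - s| := by
  have hp := h.ne_zero
  have hp' := norm_pos_iff.2 hp
  obtain ⟨K, hK⟩ := σ.exists_lipschitz
  have hc : Continuous fun t => ‖p‖ + inner ℝ p (σ.fn t : E3) :=
    continuous_const.add (continuous_const.inner (continuous_subtype_val.comp (continuous_fn σ)))
  obtain ⟨u, -, hu⟩ := isCompact_Icc.exists_isMinOn (nonempty_Icc.2 zero_le_one) hc.continuousOn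
  set m := ‖p‖ + inner ℝ p (σ.fn u : E3) with hm
  have hm0 : 0 < m := h u
  -- By compactness the midpoint functional is at least `m / 2` on `p` and `m / (2 * ‖p‖)` on
  -- `σ(s)`. Half of the latter is kept in reserve, so that the functional is still at least `δ` on
  -- `σ(t)` when `σ(t)` is within `δ` of `σ(s)`.
  set δ := min (m / 2) (m / (4 * ‖p‖)) with hδ
  have hδ0 : 0 < δ := by positivity
  obtain ⟨C, hC0, hC⟩ := exists_coneInt_bound hf hδ0
  refine ⟨6 * ‖p‖ * K * C, δ / (K + 1), by positivity, by positivity, fun s t hs ht hst => ?_⟩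
  have hd : ‖(σ.fn t - σ.fn s : E3)‖ ≤ K * |t - s| := by
    have := hK.dist_le_mul t ht s hs
    rwa [dist_eq_norm, Real.dist_eq] at this
  have hd2 : ‖(σ.fn t - σ.fn s : E3)‖ ≤ δ := by
    refine hd.trans ?_
    rw [le_div_iff₀ (by positivity)] at hst
    nlinarith [abs_nonneg (t - s)]
  have hms : m ≤ ‖p‖ + inner ℝ p (σ.fn s : E3) := hu hs
  have e1 : δ ≤ m / 2 := min_le_left _ _
  have e2 : δ ≤ m / (4 * ‖p‖) := min_le_right _ _
  have e3 : m / (2 * ‖p‖) = 2 * (m / (4 * ‖p‖)) := by field_simp; ring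
  have i1 := inner_midpoint_left hp (σ.fn s)
  have i2 := inner_midpoint_right hp (σ.fn s)
  have e4 : m / (2 * ‖p‖) ≤ (‖p‖ + inner ℝ p (σ.fn s : E3)) / (2 * ‖p‖) := by gcongr
  have hl := norm_midpoint_le hp (σ.fn s)
  have i3 := le_inner_of_norm_sub_le hl hd2
  have h3 := hC _ p (σ.fn s) (σ.fn t) hl (by linarith) (by linarith) (by linarith)
  have h4 := abs_det3_le p (σ.fn s) (σ.fn t - σ.fn s)
  rw [det3_sub_right, norm_coe_S2, mul_one] at h4
  rw [triArea, abs_mul]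
  calc _ ≤ 6 * (‖p‖ * (K * |t - s|)) * C := by gcongr; exact h4.trans (by gcongr)
    _ = _ := by ring

/-- The thin triangle over a short piece has area of first order in its length, with density
`holDens`. Only continuity and monotonicity of `α` matter: uniform continuity makes the mesh tend to
0, and the limit depends on `α` only through its end values. All invariance properties of `hol` rest
on this. -/
theorem tendsto_sum_triArea {p : E3} {σ : Loop x₀} (hp : Avoids p σ) {f : S2 → ℝ}
    (hf : Continuous f) {α : ℝ → ℝ} (hα : Continuous α) (hm : Monotone α) (h0 : 0 ≤ α 0)
    (h1 : α 1 ≤ 1) :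
    IntegrableOn (holDens f p σ) (Ioc (α 0) (α 1)) ∧ Tendsto (fun n : ℕ => ∑ i ∈ Finset.range n,
      triArea f p (σ.fn (α (i / n))) (σ.fn (α ((i + 1 : ℕ) / n)))) atTop
      (𝓝 (∫ u in Ioc (α 0) (α 1), holDens f p σ u)) := by
  obtain ⟨C, η, hC0, hη, hC⟩ := hp.exists_bound hf
  have hmono : ∀ n : ℕ, Monotone fun i : ℕ => α (i / n) := fun n i j hij => hm (by gcongr)
  have hIcc : ∀ {t : ℝ}, 0 ≤ t → t ≤ 1 → α t ∈ Icc (0 : ℝ) 1 := fun h h' =>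
    ⟨h0.trans (hm h), (hm h').trans h1⟩
  have hle : ∀ {n k : ℕ}, k ≤ n → (k : ℝ) / n ≤ 1 := fun {n k} hk => by
    apply div_le_one_of_le₀ <;> [exact_mod_cast hk; positivity]
  have hmesh : ∀ ε > 0, ∀ᶠ n : ℕ in atTop, ∀ i < n,
      α ((i + 1 : ℕ) / n) - α (i / n) < ε := by
    intro ε hε
    have huc := isCompact_Icc.uniformContinuousOn_of_continuous (hα.continuousOn (s := Icc 0 1))
    obtain ⟨δ, hδ, H⟩ := Metric.uniformContinuousOn_iff.1 huc ε hε
    obtain ⟨N, hN⟩ := exists_nat_one_div_lt hδ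
    filter_upwards [eventually_ge_atTop (N + 1)] with n hn i hi
    have hn0 : (0 : ℝ) < n := by exact_mod_cast (Nat.succ_pos N).trans_le hn
    have := H ((i + 1 : ℕ) / n) ⟨by positivity, hle hi⟩ (i / n)
      ⟨by positivity, hle (Nat.le_of_lt hi)⟩ ?_
    · rw [Real.dist_eq] at this
      exact (le_abs_self _).trans_lt this
    · rw [Real.dist_eq, ← sub_div, Nat.cast_add, add_sub_cancel_left, Nat.cast_one,
        abs_of_pos (by positivity)]
      refine lt_of_le_of_lt ?_ hN
      gcongr
      exact_mod_cast hn
  refine tendsto_sum_of_density (μ := volume) (fun n => Finset.range n)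
    (fun n i => Ioc (α (i / n)) (α ((i + 1 : ℕ) / n))) _ _ _ C (by simp)
    (fun n k => measurableSet_Ioc) ?_ ?_ ?_ ?_
  · intro n i _ j _ hij
    exact (hmono n).pairwise_disjoint_on_Ioc_succ hij
  · filter_upwards [eventually_gt_atTop 0] with n hn
    have := (hmono n).biUnion_Ico_Ioc_map_succ 0 n
    have hn' : (n : ℝ) ≠ 0 := by exact_mod_cast hn.ne'
    simp only [Nat.cast_zero, zero_div, div_self hn'] at this
    rw [← this]
    simp [Finset.mem_range, mem_Ico]
  · filter_upwards [hmesh η hη] with n hn i hi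
    have hi' := Finset.mem_range.1 hi
    have hnn : 0 ≤ α ((i + 1 : ℕ) / n) - α (i / n) := sub_nonneg.2 (hmono n (Nat.le_succ i))
    have := hC _ _ (hIcc (by positivity) (hle hi'.le)) (hIcc (by positivity) (hle hi'))
      (by rw [abs_of_nonneg hnn]; exact (hn i hi').le)
    rw [Real.volume_real_Ioc_of_le (sub_nonneg.1 hnn)]
    rwa [abs_of_nonneg hnn] at this
  · have hsub : Ioc (α 0) (α 1) ⊆ Icc 0 1 := fun x hx => ⟨h0.trans hx.1.le, hx.2.trans h1⟩
    filter_upwards [ae_restrict_of_ae_restrict_of_subset hsub σ.ae_differentiableAt,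
      ae_restrict_mem measurableSet_Ioc] with u hu huI k hk
    set h : ℕ → ℝ := fun n => α ((k n + 1 : ℕ) / n) - α (k n / n) with hh
    have hpos : ∀ᶠ n in atTop, 0 < h n := hk.mono fun n hn => sub_pos.2 (hn.2.1.trans_le hn.2.2)
    have hlim : Tendsto h atTop (𝓝 0) := by
      rw [Metric.tendsto_nhds]
      intro ε hε
      filter_upwards [hmesh ε hε, hk, hpos] with n h1 h2 h3
      rw [Real.dist_eq, sub_zero, abs_of_pos h3]
      exact h1 _ (Finset.mem_range.1 h2.1)
    have b1 : ∀ᶠ n in atTop, ‖α (k n / n) - u‖ ≤ h n := hk.mono fun n hn => by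
      rw [Real.norm_eq_abs, abs_le]
      constructor <;> linarith [hn.2.1, hn.2.2]
    have b2 : ∀ᶠ n in atTop, ‖α ((k n + 1 : ℕ) / n) - u‖ ≤ h n := hk.mono fun n hn => by
      rw [Real.norm_eq_abs, abs_le]
      constructor <;> linarith [hn.2.1, hn.2.2]
    have t1 : Tendsto (fun n => α (k n / n)) atTop (𝓝 u) := by
      rw [tendsto_iff_norm_sub_tendsto_zero]
      exact squeeze_zero' (.of_forall fun _ => norm_nonneg _) b1 hlim
    have t2 : Tendsto (fun n => α ((k n + 1 : ℕ) / n)) atTop (𝓝 u) := by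
      rw [tendsto_iff_norm_sub_tendsto_zero]
      exact squeeze_zero' (.of_forall fun _ => norm_nonneg _) b2 hlim
    have d := tendsto_scaled_sub hu.hasFDerivAt (v := 1) hpos hlim b1 b2
      (hpos.mono fun n hn => by rw [smul_eq_mul]; exact inv_mul_cancel₀ hn.ne')
    rw [fderiv_apply_one_eq_deriv] at d
    have cv := continuous_subtype_val.comp (continuous_fn σ)
    have s1 := (cv.tendsto u).comp t1
    have s2 := (cv.tendsto u).comp t2
    have D := tendsto_det3 (tendsto_const_nhds (x := p)) s1 d
    have hp0 := hp.ne_zero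
    have hp' := norm_pos_iff.2 hp0
    have c1 : (0 : ℝ) < inner ℝ ((1 / 2 : ℝ) • (‖p‖⁻¹ • p + (σ.fn u : E3))) p := by
      rw [inner_midpoint_left hp0]; exact half_pos (hp u)
    have c2 : (0 : ℝ) < inner ℝ ((1 / 2 : ℝ) • (‖p‖⁻¹ • p + (σ.fn u : E3))) (σ.fn u : E3) := by
      rw [inner_midpoint_right hp0]; exact div_pos (hp u) (by positivity)
    have I := (continuousAt_coneInt hf (norm_midpoint_le hp0 (σ.fn u)) c1 c2 c2).tendsto.comp
      ((tendsto_const_nhds (x := p)).prodMk_nhds (s1.prodMk_nhds s2))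
    refine (D.mul I).congr' ?_
    filter_upwards [hpos] with n hn
    rw [Real.volume_real_Ioc_of_le (sub_pos.1 hn).le]
    have e := det3_smul 1 (h n)⁻¹ p (σ.fn (α (k n / n)))
      (σ.fn (α ((k n + 1 : ℕ) / n)) - σ.fn (α (k n / n)))
    rw [one_smul, one_mul, det3_sub_right] at e
    simp only [Function.comp_apply, triArea, e]
    exact (mul_assoc _ _ _).trans (div_eq_inv_mul _ _).symm

/-! ### Discs as limits of grids of small triangles -/

theorem IsSpanningDisc.exists_lipschitz {σ : Loop x₀} {D : ℝ × ℝ → S2} (hD : IsSpanningDisc σ D) :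
    ∃ K : ℝ≥0, (∀ θ ∈ Icc (0 : ℝ) 1, LipschitzOnWith K (fun r => (D (r, θ) : E3)) (Icc 0 1)) ∧
      ∀ r ∈ Icc (0 : ℝ) 1, LipschitzOnWith K (fun θ => (D (r, θ) : E3)) (Icc 0 1) := by
  classical
  obtain ⟨F, G, hFG⟩ := hD.piecewise_smooth
  have : ∀ q : (ℝ × ℝ) × (ℝ × ℝ), ∃ K : ℝ≥0, 0 ≤ q.1.1 → q.1.1 < q.1.2 → q.1.2 ≤ 1 →
      0 ≤ q.2.1 → q.2.1 < q.2.2 → q.2.2 ≤ 1 → (∀ t ∈ F, t ∉ Ioo q.1.1 q.1.2) →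
      (∀ t ∈ G, t ∉ Ioo q.2.1 q.2.2) →
      LipschitzOnWith K (fun p => (D p : E3)) (Icc q.1.1 q.1.2 ×ˢ Icc q.2.1 q.2.2) := by
    intro q
    by_cases h : 0 ≤ q.1.1 ∧ q.1.1 < q.1.2 ∧ q.1.2 ≤ 1 ∧
      0 ≤ q.2.1 ∧ q.2.1 < q.2.2 ∧ q.2.2 ≤ 1 ∧ (∀ t ∈ F, t ∉ Ioo q.1.1 q.1.2) ∧
      (∀ t ∈ G, t ∉ Ioo q.2.1 q.2.2)
    · obtain ⟨h1, h2, h3, h4, h5, h6, h7, h8⟩ := h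
      obtain ⟨K, hK⟩ := (hFG _ _ _ _ h1 h2 h3 h4 h5 h6 h7 h8).exists_lipschitzOnWith (by simp)
        ((convex_Icc _ _).prod (convex_Icc _ _)) (isCompact_Icc.prod isCompact_Icc)
      exact ⟨K, fun _ _ _ _ _ _ _ _ => hK⟩
    · exact ⟨0, fun h1 h2 h3 h4 h5 h6 h7 h8 => absurd ⟨h1, h2, h3, h4, h5, h6, h7, h8⟩ h⟩
  choose K hK using this
  have hle : ∀ a ∈ breaks F, ∀ b ∈ breaks F, ∀ c ∈ breaks G, ∀ d ∈ breaks G,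
      K ((a, b), (c, d)) ≤ ((breaks F ×ˢ breaks F) ×ˢ (breaks G ×ˢ breaks G)).sup K :=
    fun a ha b hb c hc d hd => Finset.le_sup (f := K) (b := ((a, b), (c, d)))
      (Finset.mk_mem_product (Finset.mk_mem_product ha hb) (Finset.mk_mem_product hc hd))
  have hcont : ContinuousOn (fun p => (D p : E3)) (Icc 0 1 ×ˢ Icc 0 1) :=
    continuous_subtype_val.comp_continuousOn hD.continuousOn
  have hl : ∀ θ : ℝ, LipschitzWith 1 fun r : ℝ => (r, θ) := fun θ =>
    LipschitzWith.of_dist_le_mul fun x y => by simp [Prod.dist_eq]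
  have hr : ∀ r : ℝ, LipschitzWith 1 fun θ : ℝ => (r, θ) := fun r =>
    LipschitzWith.of_dist_le_mul fun x y => by simp [Prod.dist_eq]
  refine ⟨((breaks F ×ˢ breaks F) ×ˢ (breaks G ×ˢ breaks G)).sup K, fun θ hθ => ?_, fun r hr' => ?_⟩
  · obtain ⟨c, hc, d, hd, g1, g2, g3, g4, g5, -⟩ := exists_gap G hθ.1 hθ.2
    refine lipschitzOn_of_gaps (F := F) (hcont.comp (hl θ).continuous.continuousOn
      fun r h => ⟨h, hθ⟩) fun a ha b hb h1 h2 h3 h4 => ?_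
    have := ((hK ((a, b), (c, d)) h1 h2 h3 g1 g2 g3 h4 g4).weaken (hle a ha b hb c hc d hd)).comp
      ((hl θ).lipschitzOnWith (s := Icc a b)) fun r h => ⟨h, g5⟩
    rwa [mul_one] at this
  · obtain ⟨a, ha, b, hb, g1, g2, g3, g4, g5, -⟩ := exists_gap F hr'.1 hr'.2
    refine lipschitzOn_of_gaps (F := G) (hcont.comp (hr r).continuous.continuousOn
      fun θ h => ⟨hr', h⟩) fun c hc d hd h1 h2 h3 h4 => ?_
    have := ((hK ((a, b), (c, d)) g1 g2 g3 h1 h2 h3 g4 h4).weaken (hle a ha b hb c hc d hd)).comp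
      ((hr r).lipschitzOnWith (s := Icc c d)) fun r h => ⟨g5, h⟩
    rwa [mul_one] at this

theorem ae_notMem_finset_prod (F G : Finset ℝ) : ∀ᵐ q : ℝ × ℝ, q.1 ∉ F ∧ q.2 ∉ G := by
  have h1 : ∀ F : Finset ℝ, ∀ᵐ x : ℝ, x ∉ F := fun F => by
    rw [ae_iff]; simpa using F.finite_toSet.measure_zero volume
  exact (Measure.quasiMeasurePreserving_fst.ae (h1 F)).and
    (Measure.quasiMeasurePreserving_snd.ae (h1 G))

theorem IsSpanningDisc.ae_differentiableAt {σ : Loop x₀} {D : ℝ × ℝ → S2}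
    (hD : IsSpanningDisc σ D) :
    ∀ᵐ q ∂(volume.restrict (Icc (0 : ℝ) 1 ×ˢ Icc (0 : ℝ) 1)),
      DifferentiableAt ℝ (fun p => (D p : E3)) q := by
  obtain ⟨F, G, hFG⟩ := hD.piecewise_smooth
  filter_upwards [ae_restrict_mem (measurableSet_Icc.prod measurableSet_Icc),
    ae_restrict_of_ae (ae_notMem_finset_prod (breaks F) (breaks G))] with q hq hqb
  obtain ⟨a, -, b, -, h1, h2, h3, h4, -, h5⟩ := exists_gap F hq.1.1 hq.1.2
  obtain ⟨c, -, d, -, k1, k2, k3, k4, -, k5⟩ := exists_gap G hq.2.1 hq.2.2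
  exact ((hFG a b c d h1 h2 h3 k1 k2 k3 h4 k4).contDiffAt (prod_mem_nhds
    (Icc_mem_nhds (h5 hqb.1).1 (h5 hqb.1).2)
    (Icc_mem_nhds (k5 hqb.2).1 (k5 hqb.2).2))).differentiableAt (by simp)

/-- The area form pulled back along a disc. -/
def areaDensity (f : S2 → ℝ) (D : ℝ × ℝ → S2) (q : ℝ × ℝ) : ℝ :=
  areaForm f (D q) (deriv (fun r => (D (r, q.2) : E3)) q.1)
    (deriv (fun θ => (D (q.1, θ) : E3)) q.2)

/-- Half-open cells partition the half-open square exactly, without overlaps along the grid lines.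
-/
theorem discArea_eq (f : S2 → ℝ) (D : ℝ × ℝ → S2) :
    discArea f D = ∫ q in Ioc (0 : ℝ) 1 ×ˢ Ioc (0 : ℝ) 1, areaDensity f D q :=
  setIntegral_congr_set (Measure.set_prod_ae_eq Ioc_ae_eq_Icc.symm Ioc_ae_eq_Icc.symm)

/-- The sum of the signed areas of the two triangles of a grid cell. -/
def cellArea (f : S2 → ℝ) (D : ℝ × ℝ → S2) (n i j : ℕ) : ℝ :=
  triArea f (D (i / n, j / n)) (D ((i + 1 : ℕ) / n, j / n))
      (D ((i + 1 : ℕ) / n, (j + 1 : ℕ) / n)) +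
    triArea f (D (i / n, j / n)) (D ((i + 1 : ℕ) / n, (j + 1 : ℕ) / n))
      (D (i / n, (j + 1 : ℕ) / n))

theorem grid_mem {n k : ℕ} (hk : k ≤ n) : (k : ℝ) / n ∈ Icc (0 : ℝ) 1 :=
  ⟨by positivity, div_le_one_of_le₀ (by exact_mod_cast hk) (by positivity)⟩

theorem grid_mesh (n i : ℕ) : ((i + 1 : ℕ) : ℝ) / n - i / n = (n : ℝ)⁻¹ := by
  rw [← sub_div]; push_cast; rw [add_sub_cancel_left, one_div]

theorem IsSpanningDisc.exists_grid_bound {σ : Loop x₀} {D : ℝ × ℝ → S2} (hD : IsSpanningDisc σ D) :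
    ∃ K : ℝ, 0 ≤ K ∧ ∀ n i j : ℕ, i < n → j < n →
      ‖(D ((i + 1 : ℕ) / n, j / n) - D (i / n, j / n) : E3)‖ ≤ K * (n : ℝ)⁻¹ ∧
      ‖(D (i / n, (j + 1 : ℕ) / n) - D (i / n, j / n) : E3)‖ ≤ K * (n : ℝ)⁻¹ ∧
      ‖(D ((i + 1 : ℕ) / n, (j + 1 : ℕ) / n) - D (i / n, j / n) : E3)‖ ≤ K * (n : ℝ)⁻¹ := by
  obtain ⟨K, hK1, hK2⟩ := hD.exists_lipschitz
  -- Two grid edges bound the diagonal, whence the factor 2.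
  refine ⟨2 * K, by positivity, fun n i j hi hj => ?_⟩
  have hK : (0 : ℝ) ≤ K := K.2
  have hn : (0 : ℝ) ≤ (n : ℝ)⁻¹ := by positivity
  have a1 := (hK1 _ (grid_mem hj.le)).dist_le_mul _ (grid_mem (Nat.succ_le_of_lt hi)) _
    (grid_mem hi.le)
  have a2 := (hK2 _ (grid_mem hi.le)).dist_le_mul _ (grid_mem (Nat.succ_le_of_lt hj)) _
    (grid_mem hj.le)
  have a3 := (hK2 _ (grid_mem (Nat.succ_le_of_lt hi))).dist_le_mul _
    (grid_mem (Nat.succ_le_of_lt hj)) _ (grid_mem hj.le)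
  rw [dist_eq_norm, Real.dist_eq, Nat.succ_eq_add_one, grid_mesh, abs_of_nonneg hn] at a1 a2 a3
  have a4 := norm_sub_le_norm_sub_add_norm_sub
    (D ((i + 1 : ℕ) / n, (j + 1 : ℕ) / n) : E3) (D ((i + 1 : ℕ) / n, j / n) : E3)
    (D (i / n, j / n) : E3)
  have := mul_nonneg hK hn
  refine ⟨by linarith, by linarith, by linarith⟩

theorem iUnion_grid {n : ℕ} (hn : 0 < n) :
    ⋃ i ∈ Finset.range n, Ioc ((i : ℝ) / n) ((i + 1 : ℕ) / n) = Ioc 0 1 := by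
  have hm : Monotone fun i : ℕ => (i : ℝ) / n := fun i j h => by simp only; gcongr
  have := hm.biUnion_Ico_Ioc_map_succ 0 n
  have hn' : (n : ℝ) ≠ 0 := by exact_mod_cast hn.ne'
  simp only [Nat.cast_zero, zero_div, div_self hn'] at this
  rw [← this]
  simp [Finset.mem_range, mem_Ico]

/-- Almost every point is a point of differentiability of the disc. There the two triangles of the
surrounding cell, divided by the area of the cell, tend to the pulled back area form; the Lipschitz
bound provides the domination. -/
theorem tendsto_sum_cellArea {f : S2 → ℝ} (hf : Continuous f) {σ : Loop x₀} {D : ℝ × ℝ → S2}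
    (hD : IsSpanningDisc σ D) :
    IntegrableOn (areaDensity f D) (Ioc (0 : ℝ) 1 ×ˢ Ioc (0 : ℝ) 1) ∧
    Tendsto (fun n : ℕ => ∑ q ∈ Finset.range n ×ˢ Finset.range n, cellArea f D n q.1 q.2) atTop
      (𝓝 (discArea f D)) := by
  obtain ⟨K, hK0, hK⟩ := hD.exists_grid_bound
  obtain ⟨C, hC0, hC⟩ := exists_triArea_bound hf
  have hsub : (Ioc (0 : ℝ) 1 ×ˢ Ioc (0 : ℝ) 1 : Set (ℝ × ℝ)) ⊆ Icc 0 1 ×ˢ Icc 0 1 :=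
    prod_mono Ioc_subset_Icc_self Ioc_subset_Icc_self
  have hm : ∀ n : ℕ, Monotone fun i : ℕ => (i : ℝ) / n := fun n i j h => by simp only; gcongr
  have hvol : ∀ n i j : ℕ, (volume : Measure (ℝ × ℝ)).real
      (Ioc ((i : ℝ) / n) ((i + 1 : ℕ) / n) ×ˢ Ioc ((j : ℝ) / n) ((j + 1 : ℕ) / n)) =
      (n : ℝ)⁻¹ * (n : ℝ)⁻¹ := by
    intro n i j
    rw [Measure.volume_eq_prod, measureReal_prod_prod,
      Real.volume_real_Ioc_of_le (hm n (Nat.le_succ i)),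
      Real.volume_real_Ioc_of_le (hm n (Nat.le_succ j)), grid_mesh, grid_mesh]
  rw [discArea_eq]
  have hinv : Tendsto (fun n : ℕ => (n : ℝ)⁻¹) atTop (𝓝 0) := tendsto_inv_atTop_nhds_zero_nat
  refine tendsto_sum_of_density (μ := volume) (fun n => Finset.range n ×ˢ Finset.range n)
    (fun n q => Ioc ((q.1 : ℝ) / n) ((q.1 + 1 : ℕ) / n) ×ˢ Ioc ((q.2 : ℝ) / n) ((q.2 + 1 : ℕ) / n))
    _ _ _ (2 * C * (K * K)) ?_ (fun n k => measurableSet_Ioc.prod measurableSet_Ioc) ?_ ?_ ?_ ?_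
  · rw [Measure.volume_eq_prod, Measure.prod_prod]
    simp
  · intro n q _ q' _ hq
    simp only [Function.onFun, Set.disjoint_prod]
    by_cases h : q.1 = q'.1
    · exact Or.inr ((hm n).pairwise_disjoint_on_Ioc_succ fun h' => hq (Prod.ext h h'))
    · exact Or.inl ((hm n).pairwise_disjoint_on_Ioc_succ h)
  · filter_upwards [eventually_gt_atTop 0] with n hn
    rw [← iUnion_grid hn]
    ext ⟨x, y⟩
    simp only [mem_iUnion, mem_prod, Finset.mem_product, exists_prop, Prod.exists]
    constructor
    · rintro ⟨i, j, ⟨hi, hj⟩, hx, hy⟩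
      exact ⟨⟨i, hi, hx⟩, ⟨j, hj, hy⟩⟩
    · rintro ⟨⟨i, hi, hx⟩, ⟨j, hj, hy⟩⟩
      exact ⟨i, j, ⟨hi, hj⟩, hx, hy⟩
  · have hev : ∀ᶠ n : ℕ in atTop, K * (n : ℝ)⁻¹ ≤ 1 / 2 := by
      have := hinv.const_mul K
      rw [mul_zero] at this
      exact this.eventually_le_const (by norm_num)
    filter_upwards [hev] with n hn q hq
    obtain ⟨hi, hj⟩ := Finset.mem_product.1 hq
    obtain ⟨k1, k2, k3⟩ := hK n q.1 q.2 (Finset.mem_range.1 hi) (Finset.mem_range.1 hj)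
    have t1 := hC _ _ _ (k1.trans hn) (k3.trans hn)
    have t2 := hC _ _ _ (k3.trans hn) (k2.trans hn)
    rw [hvol]
    refine (abs_add_le _ _).trans ((add_le_add t1 t2).trans ?_)
    have e1 := mul_le_mul k1 k3 (norm_nonneg _) (by positivity)
    have e2 := mul_le_mul k3 k2 (norm_nonneg _) (by positivity)
    calc _ ≤ C * (K * (n : ℝ)⁻¹ * (K * (n : ℝ)⁻¹)) + C * (K * (n : ℝ)⁻¹ * (K * (n : ℝ)⁻¹)) := by
          gcongr
      _ = _ := by ring
  · filter_upwards [ae_restrict_of_ae_restrict_of_subset hsub hD.ae_differentiableAt,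
      ae_restrict_mem (measurableSet_Ioc.prod measurableSet_Ioc)] with q hq hqI k hk
    have hpos : ∀ᶠ n : ℕ in atTop, (0 : ℝ) < (n : ℝ)⁻¹ := by
      filter_upwards [eventually_gt_atTop 0] with n hn
      positivity
    have hb : ∀ᶠ n : ℕ in atTop,
        (|(k n).1 / n - q.1| ≤ (n : ℝ)⁻¹ ∧ |((k n).1 + 1 : ℕ) / n - q.1| ≤ (n : ℝ)⁻¹) ∧
        (|(k n).2 / n - q.2| ≤ (n : ℝ)⁻¹ ∧ |((k n).2 + 1 : ℕ) / n - q.2| ≤ (n : ℝ)⁻¹) := by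
      filter_upwards [hk] with n hn
      obtain ⟨-, ⟨a, b⟩, c, d⟩ := hn
      have e1 := grid_mesh n (k n).1
      have e2 := grid_mesh n (k n).2
      refine ⟨⟨?_, ?_⟩, ?_, ?_⟩ <;> rw [abs_le] <;> constructor <;> linarith
    set z : ℕ → ℝ × ℝ := fun n => ((k n).1 / n, (k n).2 / n)
    set zr : ℕ → ℝ × ℝ := fun n => (((k n).1 + 1 : ℕ) / n, (k n).2 / n)
    set zt : ℕ → ℝ × ℝ := fun n => ((k n).1 / n, ((k n).2 + 1 : ℕ) / n)
    set zrt : ℕ → ℝ × ℝ := fun n => (((k n).1 + 1 : ℕ) / n, ((k n).2 + 1 : ℕ) / n)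
    have b0 : ∀ᶠ n : ℕ in atTop, ‖z n - q‖ ≤ (n : ℝ)⁻¹ :=
      hb.mono fun n h => max_le h.1.1 h.2.1
    have b1 : ∀ᶠ n : ℕ in atTop, ‖zr n - q‖ ≤ (n : ℝ)⁻¹ :=
      hb.mono fun n h => max_le h.1.2 h.2.1
    have b2 : ∀ᶠ n : ℕ in atTop, ‖zt n - q‖ ≤ (n : ℝ)⁻¹ :=
      hb.mono fun n h => max_le h.1.1 h.2.2
    have b3 : ∀ᶠ n : ℕ in atTop, ‖zrt n - q‖ ≤ (n : ℝ)⁻¹ :=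
      hb.mono fun n h => max_le h.1.2 h.2.2
    have d1 := tendsto_scaled_sub hq.hasFDerivAt (v := (1, 0)) hpos hinv b0 b1
      (hpos.mono fun n hn => by
        simp only [z, zr, Prod.mk_sub_mk, grid_mesh, sub_self, Prod.smul_mk, smul_eq_mul, mul_zero,
          inv_mul_cancel₀ hn.ne'])
    have d2 := tendsto_scaled_sub hq.hasFDerivAt (v := (0, 1)) hpos hinv b0 b2
      (hpos.mono fun n hn => by
        simp only [z, zt, Prod.mk_sub_mk, grid_mesh, sub_self, Prod.smul_mk, smul_eq_mul, mul_zero,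
          inv_mul_cancel₀ hn.ne'])
    have d3 := tendsto_scaled_sub hq.hasFDerivAt (v := (1, 1)) hpos hinv b0 b3
      (hpos.mono fun n hn => by
        simp only [z, zrt, Prod.mk_sub_mk, grid_mesh, Prod.smul_mk, smul_eq_mul,
          inv_mul_cancel₀ hn.ne'])
    have hcD : Tendsto D (𝓝 q) (𝓝 (D q)) := by
      have := hq.continuousAt
      rwa [show (fun p => (D p : E3)) = Subtype.val ∘ D from rfl,
        ← Topology.IsInducing.subtypeVal.continuousAt_iff] at this
    have hto : ∀ {w : ℕ → ℝ × ℝ}, (∀ᶠ n : ℕ in atTop, ‖w n - q‖ ≤ (n : ℝ)⁻¹) →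
        Tendsto (fun n => D (w n)) atTop (𝓝 (D q)) := by
      intro w hw
      refine hcD.comp ?_
      rw [tendsto_iff_norm_sub_tendsto_zero]
      exact squeeze_zero' (.of_forall fun _ => norm_nonneg _) hw hinv
    have T1 := tendsto_triArea hf (hto b0) (hto b1) (hto b3) d1 d3
    have T2 := tendsto_triArea hf (hto b0) (hto b3) (hto b2) d3 d2
    have hsum := T1.add T2
    simp only [← add_div] at hsum
    have hdr : deriv (fun r => (D (r, q.2) : E3)) q.1 =
        fderiv ℝ (fun p => (D p : E3)) q (1, 0) :=
      (HasFDerivAt.comp_hasDerivAt (f := fun r : ℝ => (r, q.2)) q.1 (l := fun p => (D p : E3))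
        hq.hasFDerivAt ((hasDerivAt_id q.1).prodMk (hasDerivAt_const q.1 q.2))).deriv
    have hdt : deriv (fun θ => (D (q.1, θ) : E3)) q.2 =
        fderiv ℝ (fun p => (D p : E3)) q (0, 1) :=
      (HasFDerivAt.comp_hasDerivAt (f := fun θ : ℝ => (q.1, θ)) q.2 (l := fun p => (D p : E3))
        hq.hasFDerivAt ((hasDerivAt_const q.2 q.1).prodMk (hasDerivAt_id q.2))).deriv
    have hL : fderiv ℝ (fun p => (D p : E3)) q (1, 1) = fderiv ℝ (fun p => (D p : E3)) q (1, 0) +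
        fderiv ℝ (fun p => (D p : E3)) q (0, 1) := by
      rw [← map_add]; simp
    -- The diagonal has derivative `∂r + ∂θ`, and the two half-determinants `det(∂r, ∂r + ∂θ)` and
    -- `det(∂r + ∂θ, ∂θ)` are both half of `det(∂r, ∂θ)`.
    have hval : areaDensity f D q =
        det3 (D q) (fderiv ℝ (fun p => (D p : E3)) q (1, 0))
          (fderiv ℝ (fun p => (D p : E3)) q (1, 1)) * (f (D q) / 2) +
        det3 (D q) (fderiv ℝ (fun p => (D p : E3)) q (1, 1))
          (fderiv ℝ (fun p => (D p : E3)) q (0, 1)) * (f (D q) / 2) := by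
      rw [areaDensity, areaForm_eq, hdr, hdt, hL]
      simp only [det3_eq, PiLp.add_apply]
      ring
    rw [hval]
    refine hsum.congr fun n => ?_
    rw [hvol]
    rfl

/-! ### Generic base points -/

theorem volume_coord_two_eq_zero : volume {w : E3 | w 2 = 0} = 0 := by
  have := ae_ne_zero_of_linear (EuclideanSpace.proj (2 : Fin 3) : E3 →L[ℝ] ℝ).toLinearMap
    ⟨EuclideanSpace.single 2 1, by simp⟩
  rw [ae_iff] at this
  simpa using this

/-- The cone over a smooth piece is the image of a part of the plane `w 2 = 0` under a
differentiable map of space to itself that ignores the last coordinate, and such maps preserve null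
sets. The finitely many break points add only lines. -/
theorem volume_cone_eq_zero (σ : Loop x₀) :
    volume {p : E3 | ∃ s : ℝ, ∃ t ∈ Icc (0 : ℝ) 1, p = s • (σ.fn t : E3)} = 0 := by
  obtain ⟨F, hF⟩ := σ.smooth
  set G : E3 → E3 := fun w => w 0 • (σ.fn (w 1) : E3)
  set S : Set E3 := {w | w 2 = 0 ∧ w 1 ∈ Icc (0 : ℝ) 1 ∧ w 1 ∉ breaks F}
  have hc : ∀ i : Fin 3, Differentiable ℝ fun w : E3 => w i := fun i =>
    (EuclideanSpace.proj i : E3 →L[ℝ] ℝ).differentiable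
  have h1 : volume (G '' S) = 0 := by
    refine addHaar_image_eq_zero_of_differentiableOn_of_addHaar_eq_zero _ ?_
      (measure_mono_null (fun w hw => hw.1) volume_coord_two_eq_zero)
    rintro w ⟨-, hw, hwF⟩
    obtain ⟨a, -, b, -, h1, h2, h3, h4, -, h6⟩ := exists_gap F hw.1 hw.2
    have hd : DifferentiableAt ℝ (fun t => (σ.fn t : E3)) (w 1) :=
      ((hF a b h1 h2 h3 h4).contDiffAt (Icc_mem_nhds (h6 hwF).1 (h6 hwF).2)).differentiableAt
        (by simp)
    exact ((hc 0 w).smul (hd.comp w (hc 1 w))).differentiableWithinAt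
  have h2 : ∀ x : E3, volume ((fun w : E3 => w 0 • x) '' {w | w 2 = 0}) = 0 := fun x =>
    addHaar_image_eq_zero_of_differentiableOn_of_addHaar_eq_zero _
      (((hc 0).smul (differentiable_const x)).differentiableOn) volume_coord_two_eq_zero
  have h3 : volume (⋃ t ∈ breaks F, (fun w : E3 => w 0 • (σ.fn t : E3)) '' {w | w 2 = 0}) = 0 :=
    (measure_biUnion_null_iff (breaks F).countable_toSet).2 fun t _ => h2 _
  refine measure_mono_null ?_ (measure_union_null h1 h3)
  rintro p ⟨s, t, ht, rfl⟩
  by_cases htF : t ∈ breaks F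
  · right
    exact mem_biUnion (Finset.mem_coe.2 htF) ⟨WithLp.toLp 2 ![s, t, 0], by simp, by simp⟩
  · left
    exact ⟨WithLp.toLp 2 ![s, t, 0], ⟨by simp, by simpa using ht, by simpa using htF⟩, by simp [G]⟩

theorem ae_avoids (σ : Loop x₀) : ∀ᵐ p : E3, Avoids p σ := by
  rw [ae_iff]
  refine measure_mono_null ?_ (volume_cone_eq_zero σ)
  intro p hp
  simp only [Avoids, not_forall, not_lt, mem_ofPred_eq] at hp
  obtain ⟨t, ht⟩ := hp
  -- Failure of the condition is equality in the Cauchy-Schwarz inequality, so `p` lies on the line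
  -- through a point of the loop.
  have key : p = (-‖p‖) • (σ.fn t : E3) := by
    have h2 : ‖p + ‖p‖ • (σ.fn t : E3)‖ ^ 2 ≤ 0 := by
      rw [norm_add_sq_real, norm_smul, norm_norm, norm_coe_S2, real_inner_smul_right]
      nlinarith [norm_nonneg p]
    have h3 : ‖p + ‖p‖ • (σ.fn t : E3)‖ = 0 := by
      have := norm_nonneg (p + ‖p‖ • (σ.fn t : E3))
      nlinarith
    rw [neg_smul]
    exact eq_neg_of_add_eq_zero_left (norm_eq_zero.1 h3)
  rcases le_total t 0 with h | h
  · exact ⟨_, 0, by simp, by rw [fn_nonpos σ le_rfl]; rwa [fn_nonpos σ h] at key⟩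
  · rcases le_total t 1 with h' | h'
    · exact ⟨_, t, ⟨h, h'⟩, key⟩
    · exact ⟨_, 1, by simp, by rw [fn_one_le σ le_rfl]; rwa [fn_one_le σ h'] at key⟩

/-- If all these determinants vanish, so does the cross product; Lagrange's identity then gives
inner product ±1 for the two unit vectors. -/
theorem exists_det3_ne_zero {x y : S2} (h : x ≠ y) (h' : (x : E3) ≠ -y) :
    ∃ v, det3 v x y ≠ 0 := by
  by_contra! H
  have a0 := H (EuclideanSpace.single 0 1)
  have a1 := H (EuclideanSpace.single 1 1)
  have a2 := H (EuclideanSpace.single 2 1)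
  simp [det3_eq] at a0 a1 a2
  have hx := inner_self_S2 x
  have hy := inner_self_S2 y
  have hi : inner ℝ (x : E3) (y : E3) ^ 2 = (1 : ℝ) := by
    rw [PiLp.inner_apply, Fin.sum_univ_three] at hx hy ⊢
    simp only [RCLike.inner_apply, conj_trivial] at hx hy ⊢
    set X0 := (x : E3).ofLp 0
    set X1 := (x : E3).ofLp 1
    set X2 := (x : E3).ofLp 2
    set Y0 := (y : E3).ofLp 0
    set Y1 := (y : E3).ofLp 1
    set Y2 := (y : E3).ofLp 2
    have e : (Y0 * X0 + Y1 * X1 + Y2 * X2) ^ 2 =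
        (X0 * X0 + X1 * X1 + X2 * X2) * (Y0 * Y0 + Y1 * Y1 + Y2 * Y2)
        - (X1 * Y2 - X2 * Y1) ^ 2 - (X0 * Y2 - X2 * Y0) ^ 2 - (X0 * Y1 - X1 * Y0) ^ 2 := by ring
    rw [e, hx, hy, a0, a2, show X0 * Y2 - X2 * Y0 = 0 by linarith]
    norm_num
  rcases mul_self_eq_one_iff.1 ((sq _).symm.trans hi) with h1 | h1
  · exact h (Subtype.ext ((inner_eq_one_iff_of_norm_eq_one (norm_coe_S2 x) (norm_coe_S2 y)).1 h1))
  · apply h'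
    refine (inner_eq_one_iff_of_norm_eq_one (𝕜 := ℝ) (norm_coe_S2 x)
      (by rw [norm_neg, norm_coe_S2])).1 ?_
    rw [inner_neg_right, h1, neg_neg]

/-- `p` does not lie in any of the planes through the origin and two points of the disc with
rational polar coordinates. -/
def GridGeneric (p : E3) (D : ℝ × ℝ → S2) : Prop :=
  ∀ n i j k l : ℕ, D (i / n, j / n) = D (k / n, l / n) ∨
    (D (i / n, j / n) : E3) = -D (k / n, l / n) ∨
    det3 p (D (i / n, j / n)) (D (k / n, l / n)) ≠ 0

theorem ae_gridGeneric (D : ℝ × ℝ → S2) : ∀ᵐ p : E3, GridGeneric p D := by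
  simp only [GridGeneric, ae_all_iff]
  intro n i j k l
  by_cases h1 : D (i / n, j / n) = D (k / n, l / n)
  · exact ae_of_all _ fun _ => Or.inl h1
  by_cases h2 : (D (i / n, j / n) : E3) = -D (k / n, l / n)
  · exact ae_of_all _ fun _ => Or.inr (Or.inl h2)
  filter_upwards [ae_det3_ne_zero (exists_det3_ne_zero h1 h2)] with p hp
  exact Or.inr (Or.inr hp)

/-! ### The area modulo one as holonomy -/

theorem inner_pos_of_close {x y : S2} (h : ‖(y - x : E3)‖ ≤ 1 / 2) :
    (0 : ℝ) < inner ℝ (x : E3) (y : E3) := by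
  have := le_inner_of_norm_sub_le (norm_coe_S2 x).le h
  rw [inner_self_S2] at this
  linarith

/-- Closeness rules out antipodal pairs. It also rules out `z = b x + c y` with `b, c ≤ 0`, because
then the inner product of `x` and `z` would not be positive. The bound 1/4 keeps `y` and `z` within
1/2 of each other. -/
theorem triArea_cocycle_of_close {f : S2 → ℝ} (hf : Continuous f)
    (htotal : ∫ x, f x ∂(volume : Measure E3).toSphere = 1) {p : E3} {x y z : S2}
    (hxy : x = y ∨ (x : E3) = -y ∨ det3 p x y ≠ 0) (hyz : y = z ∨ (y : E3) = -z ∨ det3 p y z ≠ 0)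
    (hzx : z = x ∨ (z : E3) = -x ∨ det3 p z x ≠ 0) (cxy : ‖(y - x : E3)‖ ≤ 1 / 4)
    (cxz : ‖(z - x : E3)‖ ≤ 1 / 4) :
    ((triArea f x y z : ℝ) : AddCircle (1 : ℝ)) =
      (triArea f p x y : ℝ) + (triArea f p y z : ℝ) + (triArea f p z x : ℝ) := by
  have cyz : ‖(z - y : E3)‖ ≤ 1 / 2 := by
    have := norm_sub_le_norm_sub_add_norm_sub (z : E3) x y
    rw [norm_sub_rev (x : E3) y] at this
    linarith
  have ixy := inner_pos_of_close (cxy.trans (by norm_num))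
  have ixz := inner_pos_of_close (cxz.trans (by norm_num))
  have iyz := inner_pos_of_close cyz
  have hne : ∀ {a b : S2}, (0 : ℝ) < inner ℝ (a : E3) (b : E3) → (a : E3) ≠ -b := by
    intro a b h h'
    rw [h', inner_neg_left, inner_self_S2] at h
    linarith
  have simp_or : ∀ {a b : S2}, (0 : ℝ) < inner ℝ (a : E3) (b : E3) →
      (a = b ∨ (a : E3) = -b ∨ det3 p a b ≠ 0) → ((a : E3) = b ∨ det3 p a b ≠ 0) := by
    rintro a b h (h1 | h1 | h1)
    · exact Or.inl (congrArg _ h1)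
    · exact absurd h1 (hne h)
    · exact Or.inr h1
  obtain ⟨n, hn⟩ := triArea_cocycle hf htotal (simp_or ixy hxy) (simp_or iyz hyz)
    (simp_or (by rwa [real_inner_comm]) hzx) (by
      intro b c hz
      by_contra! H
      have : inner ℝ (x : E3) (z : E3) = b + c * inner ℝ (x : E3) (y : E3) := by
        rw [hz, inner_add_right, real_inner_smul_right, real_inner_smul_right, inner_self_S2,
          mul_one]
      nlinarith [H.1, H.2])
  rw [← AddCircle.coe_add, ← AddCircle.coe_add, ← sub_eq_zero, ← AddCircle.coe_sub,
    AddCircle.coe_eq_zero_iff]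
  exact ⟨-n, by rw [zsmul_eq_mul, mul_one]; push_cast; linarith⟩

/-- The area swept by the segments from `p` to the points of the loop. -/
def hol (f : S2 → ℝ) (p : E3) (σ : Loop x₀) : ℝ := ∫ u in Ioc (0 : ℝ) 1, holDens f p σ u

/-- A discrete Green formula: interior edges occur twice with opposite signs. -/
theorem sum_grid_boundary {A : Type*} [AddCommGroup A] (H V : ℕ → ℕ → A) (n : ℕ) :
    ∑ q ∈ Finset.range n ×ˢ Finset.range n,
      ((H q.1 q.2 - H q.1 (q.2 + 1)) + (V (q.1 + 1) q.2 - V q.1 q.2)) =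
    ∑ i ∈ Finset.range n, (H i 0 - H i n) + ∑ j ∈ Finset.range n, (V n j - V 0 j) := by
  rw [Finset.sum_add_distrib, Finset.sum_product, Finset.sum_product_right]
  congr 1
  · exact Finset.sum_congr rfl fun i _ => Finset.sum_range_sub' (fun j => H i j) n
  · exact Finset.sum_congr rfl fun j _ => Finset.sum_range_sub (fun i => V i j) n

/-- Modulo 1 a grid triangle is the sum of the three triangles that join its edges to `p`. After
cancellation only the outer boundary of the grid remains, and the two sides are limits of the same
sums in the circle. -/
theorem ae_discArea_eq_hol {f : S2 → ℝ} (hf : Continuous f)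
    (htotal : ∫ x, f x ∂(volume : Measure E3).toSphere = 1) {σ : Loop x₀} {D : ℝ × ℝ → S2}
    (hD : IsSpanningDisc σ D) :
    ∀ᵐ p : E3, ((discArea f D : ℝ) : AddCircle (1 : ℝ)) = (hol f p σ : ℝ) := by
  filter_upwards [ae_avoids σ, ae_gridGeneric D] with p hp hG
  have hcoe : Continuous fun x : ℝ => (x : AddCircle (1 : ℝ)) := continuous_quotient_mk'
  have L1 := (hcoe.tendsto _).comp (tendsto_sum_cellArea hf hD).2
  have L2 := (hcoe.tendsto _).comp
    (tendsto_sum_triArea hp hf continuous_id monotone_id le_rfl le_rfl).2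
  refine tendsto_nhds_unique (L1.congr' ?_) L2
  obtain ⟨K, hK0, hK⟩ := hD.exists_grid_bound
  have hev : ∀ᶠ n : ℕ in atTop, K * (n : ℝ)⁻¹ ≤ 1 / 4 := by
    have := (tendsto_inv_atTop_nhds_zero_nat (𝕜 := ℝ)).const_mul K
    rw [mul_zero] at this
    exact this.eventually_le_const (by norm_num)
  filter_upwards [hev, eventually_gt_atTop 0] with n hn hn0
  have hn' : (n : ℝ) ≠ 0 := by exact_mod_cast hn0.ne'
  set c : S2 → S2 → AddCircle (1 : ℝ) := fun x y => ((triArea f p x y : ℝ) : AddCircle (1 : ℝ))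
    with hc
  have cswap : ∀ x y, c y x = -c x y := fun x y => by
    simp only [hc]; rw [triArea_swap hf, AddCircle.coe_neg]
  have cself : ∀ x, c x x = 0 := fun x => by
    simp only [hc]; rw [triArea_self_right, AddCircle.coe_zero]
  set P : ℕ → ℕ → S2 := fun i j => D (i / n, j / n) with hP
  -- The diagonal of the cell belongs to both triangles with opposite directions and drops out.
  have hcell : ∀ q ∈ Finset.range n ×ˢ Finset.range n,
      ((cellArea f D n q.1 q.2 : ℝ) : AddCircle (1 : ℝ)) =
      (c (P q.1 q.2) (P (q.1 + 1) q.2) - c (P q.1 (q.2 + 1)) (P (q.1 + 1) (q.2 + 1))) +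
      (c (P (q.1 + 1) q.2) (P (q.1 + 1) (q.2 + 1)) - c (P q.1 q.2) (P q.1 (q.2 + 1))) := by
    rintro ⟨i, j⟩ hq
    obtain ⟨hi, hj⟩ := Finset.mem_product.1 hq
    obtain ⟨k1, k2, k3⟩ := hK n i j (Finset.mem_range.1 hi) (Finset.mem_range.1 hj)
    rw [cellArea, AddCircle.coe_add,
      triArea_cocycle_of_close hf htotal (hG n i j (i + 1) j) (hG n (i + 1) j (i + 1) (j + 1))
        (hG n (i + 1) (j + 1) i j) (k1.trans hn) (k3.trans hn),
      triArea_cocycle_of_close hf htotal (hG n i j (i + 1) (j + 1))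
        (hG n (i + 1) (j + 1) i (j + 1)) (hG n i (j + 1) i j) (k3.trans hn) (k2.trans hn)]
    change (c (P i j) (P (i + 1) j) + c (P (i + 1) j) (P (i + 1) (j + 1))
      + c (P (i + 1) (j + 1)) (P i j)) + (c (P i j) (P (i + 1) (j + 1))
      + c (P (i + 1) (j + 1)) (P i (j + 1)) + c (P i (j + 1)) (P i j)) = _
    rw [cswap (P i j) (P (i + 1) (j + 1)), cswap (P i (j + 1)) (P (i + 1) (j + 1)),
      cswap (P i j) (P i (j + 1))]
    abel
  simp only [Function.comp_apply]
  have hsum : ∀ (s : Finset (ℕ × ℕ)) (g : ℕ × ℕ → ℝ),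
      ((∑ q ∈ s, g q : ℝ) : AddCircle (1 : ℝ)) = ∑ q ∈ s, (g q : AddCircle (1 : ℝ)) := fun s g =>
    map_sum (QuotientAddGroup.mk' (AddSubgroup.zmultiples (1 : ℝ))) g s
  have hsum' : ∀ (s : Finset ℕ) (g : ℕ → ℝ),
      ((∑ q ∈ s, g q : ℝ) : AddCircle (1 : ℝ)) = ∑ q ∈ s, (g q : AddCircle (1 : ℝ)) := fun s g =>
    map_sum (QuotientAddGroup.mk' (AddSubgroup.zmultiples (1 : ℝ))) g s
  rw [hsum, hsum', Finset.sum_congr rfl hcell,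
    sum_grid_boundary (fun i j => c (P i j) (P (i + 1) j)) (fun i j => c (P i j) (P i (j + 1)))]
  have e1 : ∑ i ∈ Finset.range n, (c (P i 0) (P (i + 1) 0) - c (P i n) (P (i + 1) n)) = 0 := by
    refine Finset.sum_eq_zero fun i hi => ?_
    have per : ∀ k ≤ n, P k 0 = P k n := fun k hk => by
      simp only [hP, Nat.cast_zero, zero_div, div_self hn']
      exact hD.periodic _ (grid_mem hk)
    rw [per i (Finset.mem_range.1 hi).le, per (i + 1) (Finset.mem_range.1 hi), sub_self]
  rw [e1, zero_add]
  refine Finset.sum_congr rfl fun j hj => ?_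
  have hj' := Finset.mem_range.1 hj
  -- The side `r = 0` is collapsed to the centre, so its triangles are degenerate.
  have z0 : P 0 (j + 1) = P 0 j := by
    simp only [hP, Nat.cast_zero, zero_div]
    rw [hD.center _ (grid_mem hj'), hD.center _ (grid_mem hj'.le)]
  have bd : ∀ k ≤ n, P n k = σ.fn (k / n) := fun k hk => by
    simp only [hP, div_self hn']
    exact hD.boundary _ (grid_mem hk)
  rw [z0, cself, sub_zero, bd j hj'.le, bd (j + 1) hj']
  rfl

/-! ### Invariance and additivity of the holonomy -/

/-- A parametrization that is merely continuous and monotone admits no substitution rule. But both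
integrals are limits of sums over the values at `i / n`, and these agree term by term. -/
theorem setIntegral_holDens_congr {f : S2 → ℝ} (hf : Continuous f) {p : E3} {σ τ : Loop x₀}
    (hσ : Avoids p σ) (hτ : Avoids p τ) {α β : ℝ → ℝ} (hα : Continuous α) (hαm : Monotone α)
    (hα0 : 0 ≤ α 0) (hα1 : α 1 ≤ 1) (hβ : Continuous β) (hβm : Monotone β)
    (hβ0 : 0 ≤ β 0) (hβ1 : β 1 ≤ 1) (h : ∀ t ∈ Icc (0 : ℝ) 1, σ.fn (α t) = τ.fn (β t)) :
    ∫ u in Ioc (α 0) (α 1), holDens f p σ u = ∫ u in Ioc (β 0) (β 1), holDens f p τ u := by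
  refine tendsto_nhds_unique (tendsto_sum_triArea hσ hf hα hαm hα0 hα1).2
    ((tendsto_sum_triArea hτ hf hβ hβm hβ0 hβ1).2.congr fun n => ?_)
  refine Finset.sum_congr rfl fun i hi => ?_
  have hi' := Finset.mem_range.1 hi
  rw [h _ (grid_mem hi'.le), h _ (grid_mem hi')]

theorem setIntegral_holDens_const {f : S2 → ℝ} (hf : Continuous f) {p : E3} {σ : Loop x₀}
    (hσ : Avoids p σ) {a b : ℝ} (h0 : 0 ≤ a) (hab : a ≤ b) (h1 : b ≤ 1) {x : S2}
    (h : ∀ t ∈ Icc a b, σ.fn t = x) : ∫ u in Ioc a b, holDens f p σ u = 0 := by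
  have hab' := sub_nonneg.2 hab
  have := (tendsto_sum_triArea hσ hf (α := fun t => a + (b - a) * t) (by fun_prop)
    (fun s t hst => by simp only; gcongr) (by simpa using h0) (by simpa using h1)).2
  simp only [mul_zero, add_zero, mul_one, add_sub_cancel] at this
  refine tendsto_nhds_unique this (tendsto_const_nhds.congr fun n => ?_)
  refine (Finset.sum_eq_zero fun i hi => ?_).symm
  have hi' := Finset.mem_range.1 hi
  have : ∀ t ∈ Icc (0 : ℝ) 1, σ.fn (a + (b - a) * t) = x := fun t ht =>
    h _ ⟨by nlinarith [ht.1], by nlinarith [ht.2]⟩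
  rw [this _ (grid_mem hi'.le), this _ (grid_mem hi'), triArea_self_right]

/-- Running `β` backwards makes it increasing; the sums are then the same in reflected order, with
each triangle reversed. -/
theorem setIntegral_holDens_reverse {f : S2 → ℝ} (hf : Continuous f) {p : E3} {σ τ : Loop x₀}
    (hσ : Avoids p σ) (hτ : Avoids p τ) {α β : ℝ → ℝ} (hα : Continuous α) (hαm : Monotone α)
    (hα0 : 0 ≤ α 0) (hα1 : α 1 ≤ 1) (hβ : Continuous β) (hβm : Antitone β)
    (hβ0 : β 0 ≤ 1) (hβ1 : 0 ≤ β 1) (h : ∀ t ∈ Icc (0 : ℝ) 1, σ.fn (α t) = τ.fn (β t)) :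
    ∫ u in Ioc (β 1) (β 0), holDens f p τ u = -∫ u in Ioc (α 0) (α 1), holDens f p σ u := by
  have h1 := (tendsto_sum_triArea hσ hf hα hαm hα0 hα1).2
  have h2 := (tendsto_sum_triArea hτ hf (α := fun t => β (1 - t)) (by fun_prop)
    (fun s t hst => hβm (by linarith)) (by simpa using hβ1) (by simpa using hβ0)).2
  simp only [sub_zero, sub_self] at h2
  refine tendsto_nhds_unique h2 (h1.neg.congr fun n => ?_)
  rw [← Finset.sum_range_reflect, ← Finset.sum_neg_distrib]
  refine Finset.sum_congr rfl fun i hi => ?_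
  have hi' := Finset.mem_range.1 hi
  have hn : (n : ℝ) ≠ 0 := by
    have : 0 < n := (Nat.zero_le i).trans_lt hi'
    exact_mod_cast this.ne'
  have e1 : ((n - 1 - i : ℕ) : ℝ) / n = 1 - (i + 1 : ℕ) / n := by
    rw [Nat.sub_sub, Nat.cast_sub (by omega), sub_div, div_self hn]
    push_cast; ring
  have e2 : ((n - 1 - i + 1 : ℕ) : ℝ) / n = 1 - i / n := by
    rw [show n - 1 - i + 1 = n - i by omega, Nat.cast_sub hi'.le, sub_div, div_self hn]
  rw [h _ (grid_mem (by omega)), h _ (grid_mem (by omega)), e1, e2, triArea_swap hf, neg_neg]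

theorem setIntegral_Ioc_add {h : ℝ → ℝ} {a b c : ℝ} (hab : a ≤ b) (hbc : b ≤ c)
    (hi : IntegrableOn h (Ioc a c)) :
    ∫ u in Ioc a c, h u = (∫ u in Ioc a b, h u) + ∫ u in Ioc b c, h u := by
  rw [← Ioc_union_Ioc_eq_Ioc hab hbc]
  refine setIntegral_union (Ioc_disjoint_Ioc_of_le le_rfl) measurableSet_Ioc ?_ ?_
  · exact hi.mono_set (Ioc_subset_Ioc_right hbc)
  · exact hi.mono_set (Ioc_subset_Ioc_left hab)

theorem integrableOn_holDens {f : S2 → ℝ} (hf : Continuous f) {p : E3} {σ : Loop x₀}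
    (hσ : Avoids p σ) : IntegrableOn (holDens f p σ) (Ioc 0 1) :=
  (tendsto_sum_triArea hσ hf continuous_id monotone_id le_rfl le_rfl).1

theorem hol_trans {f : S2 → ℝ} (hf : Continuous f) {p : E3} {σ τ : Loop x₀}
    (hσ : Avoids p σ) (hτ : Avoids p τ) (hστ : Avoids p (σ.trans τ)) :
    hol f p (σ.trans τ) = hol f p σ + hol f p τ := by
  rw [hol, setIntegral_Ioc_add (b := 1 / 2) (by norm_num) (by norm_num)
    (integrableOn_holDens hf hστ)]
  have h1 := setIntegral_holDens_congr hf hστ hσ (α := fun t => t / 2) (β := id) (by fun_prop)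
    (fun s t h => by simp only; gcongr) (by norm_num) (by norm_num) continuous_id monotone_id
    le_rfl le_rfl (fun t ht => by
      rw [fn_trans_left _ _ (by linarith [ht.2])]; congr 1; simp only [id]; ring)
  have h2 := setIntegral_holDens_congr hf hστ hτ (α := fun t => (t + 1) / 2) (β := id)
    (by fun_prop)
    (fun s t h => by simp only; gcongr) (by norm_num) (by norm_num) continuous_id monotone_id
    le_rfl le_rfl (fun t ht => by
      rw [fn_trans_right _ _ (by linarith [ht.1])]; congr 1; simp only [id]; ring)
  norm_num at h1 h2 ⊢
  rw [h1, h2]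
  rfl

/-- For a clipping, the interval is cut at `t₁` and `t₃`. The outer parts agree, the retraced piece
cancels its model, and a resting path sweeps no area. -/
theorem hol_eq_of_move {f : S2 → ℝ} (hf : Continuous f) {p : E3} {σ τ : Loop x₀}
    (hσ : Avoids p σ) (hτ : Avoids p τ) (h : Move σ τ) : hol f p σ = hol f p τ := by
  rcases h with ⟨φ, hc, hm, h0, h1, hφ⟩ | ⟨t₁, t₂, t₃, h01, h12, h23, h31,
      ⟨α, β, hα, hαm, hα0, hα1, hβ, hβm, hβ0, hβ1, hαβ⟩, hin, hout⟩
  · have := setIntegral_holDens_congr hf hσ hτ hc hm h0.ge h1.le continuous_id monotone_id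
      le_rfl le_rfl fun t ht => (hφ t ht).symm
    rw [h0, h1] at this
    exact this
  · have hends : σ.fn t₁ = σ.fn t₃ := by
      have := hαβ 0 (by simp)
      rwa [hα0, hβ0] at this
    have h13 := h12.trans h23
    have dec : ∀ {ρ : Loop x₀}, Avoids p ρ → hol f p ρ = (∫ u in Ioc 0 t₁, holDens f p ρ u) +
        ((∫ u in Ioc t₁ t₃, holDens f p ρ u) + ∫ u in Ioc t₃ 1, holDens f p ρ u) := by
      intro ρ hρ
      have hi := integrableOn_holDens hf hρ
      rw [hol, setIntegral_Ioc_add h01 (h13.trans h31) hi,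
        setIntegral_Ioc_add h13 h31 (hi.mono_set (Ioc_subset_Ioc_left h01))]
    have e1 := setIntegral_holDens_congr hf hσ hτ (α := fun t => t₁ * t) (β := fun t => t₁ * t)
      (by fun_prop) (fun s t h => by simp only; gcongr) (by simp) (by simp; linarith)
      (by fun_prop) (fun s t h => by simp only; gcongr) (by simp) (by simp; linarith)
      (fun t ht => by
        have hle : t₁ * t ≤ t₁ := mul_le_of_le_one_right h01 ht.2
        rcases hle.lt_or_eq with h | h
        · exact (hout _ ⟨mul_nonneg h01 ht.1, by linarith⟩ fun hm => hm.1.not_gt h).symm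
        · simp only [h]; exact (hin t₁ ⟨le_rfl, h13⟩).symm)
    have h31' := sub_nonneg.2 h31
    have e3 := setIntegral_holDens_congr hf hσ hτ (α := fun t => t₃ + (1 - t₃) * t)
      (β := fun t => t₃ + (1 - t₃) * t)
      (by fun_prop) (fun s t h => by simp only; gcongr) (by simp; linarith) (by simp)
      (by fun_prop) (fun s t h => by simp only; gcongr) (by simp; linarith) (by simp)
      (fun t ht => by
        have hle : t₃ ≤ t₃ + (1 - t₃) * t := by nlinarith [ht.1]
        rcases hle.lt_or_eq with h | h
        · exact (hout _ ⟨by linarith, by nlinarith [ht.2]⟩ fun hm => hm.2.not_gt h).symm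
        · simp only [← h]; rw [← hends]; exact (hin t₃ ⟨h13, le_rfl⟩).symm)
    simp only [mul_zero, mul_one, add_zero, add_sub_cancel] at e1 e3
    have e2 := setIntegral_holDens_const hf hτ h01 h13 h31 hin
    have e4 := setIntegral_holDens_reverse hf hσ hσ hα hαm (hα0 ▸ h01) (by linarith) hβ hβm
      (by linarith) (by linarith) hαβ
    rw [hα0, hα1, hβ0, hβ1] at e4
    have e5 := setIntegral_Ioc_add h12 h23 ((integrableOn_holDens hf hσ).mono_set
      (Ioc_subset_Ioc h01 h31))
    rw [dec hσ, dec hτ, e1, e2, e3, e5, e4]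
    ring

/-! ### Existence of discs -/

/-- The midpoint functional is positive at both ends of the segment, hence along all of it. -/
theorem segment_ne_zero {p : E3} {σ : Loop x₀} (hp : Avoids p σ) {r : ℝ} (h0 : 0 ≤ r) (h1 : r ≤ 1)
    (t : ℝ) : (1 - r) • p + r • (σ.fn t : E3) ≠ 0 := by
  intro h
  have hp0 := hp.ne_zero
  have hp' := norm_pos_iff.2 hp0
  have e1 := inner_midpoint_left hp0 (σ.fn t)
  have e2 := inner_midpoint_right hp0 (σ.fn t)
  have h3 := congrArg (inner ℝ ((1 / 2 : ℝ) • (‖p‖⁻¹ • p + (σ.fn t : E3)))) h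
  rw [inner_add_right, real_inner_smul_right, real_inner_smul_right, inner_zero_right, e1, e2] at h3
  have a1 : 0 < (‖p‖ + inner ℝ p (σ.fn t : E3)) / 2 := half_pos (hp t)
  have a2 : 0 < (‖p‖ + inner ℝ p (σ.fn t : E3)) / (2 * ‖p‖) := div_pos (hp t) (by positivity)
  rcases h0.eq_or_lt with rfl | h0
  · linarith
  · have := mul_pos h0 a2
    have := mul_nonneg (sub_nonneg.2 h1) a1.le
    linarith

/-- The disc is the radial projection of the straight cone over the loop from a generic point `p`.
It is smooth in `r`, so only the break points of the loop are needed as grid lines. -/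
theorem exists_spanningDisc (σ : Loop x₀) : ∃ D, IsSpanningDisc σ D := by
  obtain ⟨p, hp⟩ := (ae_avoids σ).exists
  obtain ⟨G, hG⟩ := σ.smooth
  set X : ℝ × ℝ → E3 := fun q => (1 - q.1) • p + q.1 • (σ.fn q.2 : E3) with hX
  have hX0 : ∀ q ∈ Icc (0 : ℝ) 1 ×ˢ Icc (0 : ℝ) 1, X q ≠ 0 := fun q hq =>
    segment_ne_zero hp hq.1.1 hq.1.2 q.2
  have hXc : Continuous X := by
    have := continuous_subtype_val.comp ((continuous_fn σ).comp (continuous_snd (X := ℝ) (Y := ℝ)))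
    exact ((continuous_const.sub continuous_fst).smul continuous_const).add
      (continuous_fst.smul this)
  refine ⟨fun q => proj (X q), ?_, ⟨∅, G, ?_⟩, ?_, ?_, ?_⟩
  · exact fun q hq => ((continuousAt_proj (hX0 q hq)).comp hXc.continuousAt).continuousWithinAt
  · intro a b c d ha hab hb hc hcd hd _ hbr
    have hsub : Icc a b ×ˢ Icc c d ⊆ Icc (0 : ℝ) 1 ×ˢ Icc (0 : ℝ) 1 :=
      prod_mono (Icc_subset_Icc ha hb) (Icc_subset_Icc hc hd)
    have h1 : ContDiffOn ℝ ∞ (fun q : ℝ × ℝ => (σ.fn q.2 : E3)) (Icc a b ×ˢ Icc c d) :=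
      (hG c d hc hcd hd hbr).comp contDiff_snd.contDiffOn fun q hq => hq.2
    have h2 : ContDiffOn ℝ ∞ X (Icc a b ×ˢ Icc c d) :=
      ((contDiffOn_const.sub contDiff_fst.contDiffOn).smul contDiffOn_const).add
        (contDiff_fst.contDiffOn.smul h1)
    have h3 : ContDiffOn ℝ ∞ (fun q => ‖X q‖⁻¹ • X q) (Icc a b ×ˢ Icc c d) :=
      ((h2.norm ℝ fun q hq => hX0 q (hsub hq)).inv
        fun q hq => norm_ne_zero_iff.2 (hX0 q (hsub hq))).smul h2
    exact h3.congr fun q hq => coe_proj (hX0 q (hsub hq))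
  · intro θ _
    simp [hX]
  · intro r _
    simp only [hX]
    rw [fn_nonpos σ le_rfl, fn_one_le σ le_rfl]
  · intro θ _
    have := proj_smul one_pos (σ.fn θ)
    simpa [hX] using this

/-! ### Caps through a given point -/

/-- `q`, `a`, `b` are orthonormal and negatively oriented. -/
def IsFrame (q a b : E3) : Prop :=
  (∀ r s t : ℝ, ‖r • q + s • a + t • b‖ ^ 2 = r ^ 2 + s ^ 2 + t ^ 2) ∧ det3 q a b = -1

theorem norm_sq_E3 (v : E3) : ‖v‖ ^ 2 = v 0 ^ 2 + v 1 ^ 2 + v 2 ^ 2 := by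
  rw [EuclideanSpace.norm_sq_eq, Fin.sum_univ_three]
  simp

theorem exists_frame (q : S2) : ∃ a b : E3, IsFrame q a b := by
  have hq0 : (q : E3) ≠ 0 := fun h => by have := norm_coe_S2 q; simp [h] at this
  obtain ⟨a, ha, hqa⟩ : ∃ a : E3, ‖a‖ = 1 ∧ inner ℝ (q : E3) a = (0 : ℝ) := by
    have : Fact (Module.finrank ℝ E3 = 2 + 1) := ⟨by simp⟩
    have hfr := Submodule.finrank_orthogonal_span_singleton (𝕜 := ℝ) (n := 2) hq0
    have : Nontrivial (Submodule.span ℝ {(q : E3)})ᗮ :=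
      Module.nontrivial_of_finrank_pos (R := ℝ) (by rw [hfr]; norm_num)
    obtain ⟨⟨v, hv⟩, hv0⟩ := exists_ne (0 : (Submodule.span ℝ {(q : E3)})ᗮ)
    have hv0' : v ≠ 0 := fun h => hv0 (Subtype.ext h)
    refine ⟨‖v‖⁻¹ • v, ?_, ?_⟩
    · rw [norm_smul, norm_inv, norm_norm, inv_mul_cancel₀ (norm_ne_zero_iff.2 hv0')]
    · rw [real_inner_smul_right, Submodule.mem_orthogonal_singleton_iff_inner_right.1 hv, mul_zero]
  have hQ : (q : E3) 0 ^ 2 + (q : E3) 1 ^ 2 + (q : E3) 2 ^ 2 = 1 := by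
    rw [← norm_sq_E3, norm_coe_S2, one_pow]
  have hA : a 0 ^ 2 + a 1 ^ 2 + a 2 ^ 2 = 1 := by rw [← norm_sq_E3, ha, one_pow]
  have hd : (q : E3) 0 * a 0 + (q : E3) 1 * a 1 + (q : E3) 2 * a 2 = 0 := by
    rw [PiLp.inner_apply, Fin.sum_univ_three] at hqa
    simp only [RCLike.inner_apply, conj_trivial] at hqa
    linarith
  generalize (q : E3) = q at *
  -- The third vector is the cross product of `a` and `q`, in this order, which gives the negative
  -- orientation.
  refine ⟨a, WithLp.toLp 2 ![q 2 * a 1 - q 1 * a 2, q 0 * a 2 - q 2 * a 0, q 1 * a 0 - q 0 * a 1],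
    fun r s t => ?_, ?_⟩
  · rw [norm_sq_E3]
    simp only [PiLp.add_apply, PiLp.smul_apply, smul_eq_mul, Matrix.cons_val_zero,
      Matrix.cons_val_one, Matrix.cons_val]
    linear_combination r ^ 2 * hQ + s ^ 2 * hA + t ^ 2 * ((a 0 ^ 2 + a 1 ^ 2 + a 2 ^ 2) * hQ + hA
      - (q 0 * a 0 + q 1 * a 1 + q 2 * a 2) * hd) + 2 * r * s * hd
  · rw [det3_eq]
    simp only [Matrix.cons_val_zero, Matrix.cons_val_one, Matrix.cons_val]
    linear_combination -((a 0 ^ 2 + a 1 ^ 2 + a 2 ^ 2) * hQ + hA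
      - (q 0 * a 0 + q 1 * a 1 + q 2 * a 2) * hd)

/-- The cap of angular radius `s` around the point at distance `s` from `q` in direction `a`, in
polar coordinates, with `q` at `r = 1`, `θ = 0`. -/
def capVec (q a b : E3) (s : ℝ) (x : ℝ × ℝ) : E3 :=
  (Real.cos (s * x.1) * Real.cos s +
    Real.sin (s * x.1) * Real.cos (2 * Real.pi * x.2) * Real.sin s) • q +
  (Real.cos (s * x.1) * Real.sin s -
    Real.sin (s * x.1) * Real.cos (2 * Real.pi * x.2) * Real.cos s) • a +
  (Real.sin (s * x.1) * Real.sin (2 * Real.pi * x.2)) • b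

def capDisc (q a b : E3) (s : ℝ) (x : ℝ × ℝ) : S2 := proj (capVec q a b s x)

theorem norm_capVec {q a b : E3} (h : IsFrame q a b) (s : ℝ) (x : ℝ × ℝ) :
    ‖capVec q a b s x‖ = 1 := by
  have : ‖capVec q a b s x‖ ^ 2 = 1 := by
    rw [capVec, h.1]
    have h1 := Real.sin_sq_add_cos_sq (s * x.1)
    have h2 := Real.sin_sq_add_cos_sq (2 * Real.pi * x.2)
    have h3 := Real.sin_sq_add_cos_sq s
    generalize Real.sin (s * x.1) = S at *
    generalize Real.cos (s * x.1) = C at *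
    generalize Real.sin (2 * Real.pi * x.2) = l at *
    generalize Real.cos (2 * Real.pi * x.2) = k at *
    linear_combination (C ^ 2 + S ^ 2 * k ^ 2) * h3 + S ^ 2 * h2 + h1
  exact (sq_eq_sq₀ (norm_nonneg _) zero_le_one).1 (by rw [this]; norm_num)

theorem capVec_ne_zero {q a b : E3} (h : IsFrame q a b) (s : ℝ) (x : ℝ × ℝ) :
    capVec q a b s x ≠ 0 := fun h0 => by simpa [h0] using norm_capVec h s x

theorem coe_capDisc {q a b : E3} (h : IsFrame q a b) (s : ℝ) (x : ℝ × ℝ) :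
    (capDisc q a b s x : E3) = capVec q a b s x := by
  rw [capDisc, coe_proj (capVec_ne_zero h s x), norm_capVec h, inv_one, one_smul]

theorem continuous_capDisc {q a b : E3} (h : IsFrame q a b) :
    Continuous fun y : ℝ × (ℝ × ℝ) => capDisc q a b y.1 y.2 := by
  have hc : Continuous fun y : ℝ × (ℝ × ℝ) => capVec q a b y.1 y.2 := by
    unfold capVec; fun_prop
  exact continuous_iff_continuousAt.2 fun y =>
    ContinuousAt.comp (g := proj) (f := fun y : ℝ × (ℝ × ℝ) => capVec q a b y.1 y.2)
      (continuousAt_proj (capVec_ne_zero h _ _)) hc.continuousAt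

theorem contDiff_capVec (q a b : E3) (s : ℝ) : ContDiff ℝ ∞ (capVec q a b s) := by
  unfold capVec; fun_prop

theorem capVec_one_zero (q a b : E3) (s : ℝ) : capVec q a b s (1, 0) = q := by
  have := Real.sin_sq_add_cos_sq s
  simp only [capVec, mul_one, mul_zero, Real.cos_zero, Real.sin_zero, zero_smul, add_zero]
  rw [show Real.cos s * Real.cos s + Real.sin s * Real.sin s = 1 by linarith,
    mul_comm (Real.cos s), sub_self, zero_smul, one_smul, add_zero]

theorem capVec_periodic (q a b : E3) (s r : ℝ) : capVec q a b s (r, 0) = capVec q a b s (r, 1) := by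
  simp [capVec]

theorem continuous_capDisc_boundary {q a b : E3} (h : IsFrame q a b) (s : ℝ) :
    Continuous fun t : ℝ => capDisc q a b s (1, t) :=
  Continuous.comp' (f := fun t : ℝ => ((s, (1, t)) : ℝ × (ℝ × ℝ))) (continuous_capDisc h)
    (continuous_const.prodMk (continuous_const.prodMk continuous_id))

/-- The boundary of a cap. -/
def capLoop (q : S2) {a b : E3} (h : IsFrame q a b) (s : ℝ) : Loop q where
  path :=
    { toFun := fun t => capDisc q a b s (1, (t : ℝ))
      continuous_toFun := (continuous_capDisc_boundary h s).comp continuous_subtype_val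
      source' := Subtype.ext (by
        rw [coe_capDisc h, Set.Icc.coe_zero, capVec_one_zero])
      target' := Subtype.ext (by
        rw [coe_capDisc h, Set.Icc.coe_one, ← capVec_periodic, capVec_one_zero]) }
  smooth := by
    refine ⟨∅, fun c d hc _ hd _ => ?_⟩
    have h1 : ContDiffOn ℝ ∞ (fun t : ℝ => capVec q a b s (1, t)) (Icc c d) :=
      ((contDiff_capVec q a b s).comp (contDiff_const.prodMk contDiff_id)).contDiffOn
    refine h1.congr fun t ht => ?_
    rw [Path.extend_apply _ ⟨hc.trans ht.1, ht.2.trans hd⟩]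
    exact coe_capDisc h s _

theorem isSpanningDisc_capDisc {σ : Loop x₀} {q a b : E3} (h : IsFrame q a b) (s : ℝ)
    (hb : ∀ θ ∈ Icc (0 : ℝ) 1, capDisc q a b s (1, θ) = σ.fn θ) :
    IsSpanningDisc σ (capDisc q a b s) where
  continuousOn := ((continuous_capDisc h).comp (continuous_const.prodMk continuous_id)).continuousOn
  piecewise_smooth := ⟨∅, ∅, fun _ _ _ _ _ _ _ _ _ _ _ _ => by
    simp only [coe_capDisc h]
    exact (contDiff_capVec q a b s).contDiffOn⟩
  center := fun θ _ => by simp [capDisc, capVec]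
  periodic := fun r _ => by rw [capDisc, capDisc, capVec_periodic]
  boundary := hb

theorem isSpanningDisc_capLoop (q : S2) {a b : E3} (h : IsFrame q a b) (s : ℝ) :
    IsSpanningDisc (capLoop q h s) (capDisc q a b s) :=
  isSpanningDisc_capDisc h s fun θ hθ => by
    rw [Loop.fn, Path.extend_apply _ hθ]
    rfl

/-- At angular radius π the boundary circle of the cap shrinks to `q`, and the cap covers the sphere
once from its centre `-q`. -/
theorem isSpanningDisc_capDisc_pi (q : S2) {a b : E3} (h : IsFrame q a b) :
    IsSpanningDisc (Loop.const q) (capDisc q a b Real.pi) :=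
  isSpanningDisc_capDisc h _ fun θ hθ => Subtype.ext (by
    rw [coe_capDisc h, fn_const]
    simp [capVec])

theorem det3_comb (q a b : E3) (x₁ x₂ x₃ y₁ y₂ y₃ z₁ z₂ z₃ : ℝ) :
    det3 (x₁ • q + x₂ • a + x₃ • b) (y₁ • q + y₂ • a + y₃ • b) (z₁ • q + z₂ • a + z₃ • b) =
      (x₁ * (y₂ * z₃ - y₃ * z₂) - x₂ * (y₁ * z₃ - y₃ * z₁) + x₃ * (y₁ * z₂ - y₂ * z₁)) *
        det3 q a b := by
  simp only [det3_eq, PiLp.add_apply, PiLp.smul_apply, smul_eq_mul]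
  ring

/-- The negative orientation of the frame is what makes the area positive when the cap is traversed
with increasing `θ`. -/
theorem areaDensity_capDisc (f : S2 → ℝ) {q a b : E3} (h : IsFrame q a b) (s : ℝ) (x : ℝ × ℝ) :
    areaDensity f (capDisc q a b s) x =
      2 * Real.pi * s * Real.sin (s * x.1) * f (capDisc q a b s x) := by
  obtain ⟨r, θ⟩ := x
  have hs : HasDerivAt (fun r => Real.sin (s * r)) (Real.cos (s * r) * s) r := by
    simpa using ((hasDerivAt_id r).const_mul s).sin
  have hc : HasDerivAt (fun r => Real.cos (s * r)) (-Real.sin (s * r) * s) r := by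
    simpa using ((hasDerivAt_id r).const_mul s).cos
  have ts : HasDerivAt (fun θ => Real.sin (2 * Real.pi * θ))
      (Real.cos (2 * Real.pi * θ) * (2 * Real.pi)) θ := by
    simpa using ((hasDerivAt_id θ).const_mul (2 * Real.pi)).sin
  have tc : HasDerivAt (fun θ => Real.cos (2 * Real.pi * θ))
      (-Real.sin (2 * Real.pi * θ) * (2 * Real.pi)) θ := by
    simpa using ((hasDerivAt_id θ).const_mul (2 * Real.pi)).cos
  have d1 : HasDerivAt (fun r => capVec q a b s (r, θ)) _ r :=
    ((((hc.mul_const (Real.cos s)).add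
      ((hs.mul_const (Real.cos (2 * Real.pi * θ))).mul_const (Real.sin s))).smul_const q).add
      (((hc.mul_const (Real.sin s)).sub
      ((hs.mul_const (Real.cos (2 * Real.pi * θ))).mul_const (Real.cos s))).smul_const a)).add
      ((hs.mul_const (Real.sin (2 * Real.pi * θ))).smul_const b)
  have d2 : HasDerivAt (fun θ => capVec q a b s (r, θ)) _ θ :=
    (((((tc.const_mul (Real.sin (s * r))).mul_const (Real.sin s)).const_add
      (Real.cos (s * r) * Real.cos s)).smul_const q).add
      ((((tc.const_mul (Real.sin (s * r))).mul_const (Real.cos s)).const_sub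
      (Real.cos (s * r) * Real.sin s)).smul_const a)).add
      ((ts.const_mul (Real.sin (s * r))).smul_const b)
  simp only [areaDensity, areaForm_eq, coe_capDisc h]
  rw [d1.deriv, d2.deriv, capVec, det3_comb, h.2]
  simp only
  have h1 := Real.sin_sq_add_cos_sq (s * r)
  have h2 := Real.sin_sq_add_cos_sq (2 * Real.pi * θ)
  have h3 := Real.sin_sq_add_cos_sq s
  generalize f _ = F
  generalize Real.sin (s * r) = S at *
  generalize Real.cos (s * r) = C at *
  generalize Real.sin (2 * Real.pi * θ) = l at *
  generalize Real.cos (2 * Real.pi * θ) = k at *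
  generalize Real.sin s = A at *
  generalize Real.cos s = B at *
  have e : (A ^ 2 + B ^ 2) * (l ^ 2 + k ^ 2) * (S ^ 2 + C ^ 2) = 1 := by rw [h1, h2, h3]; norm_num
  linear_combination (2 * Real.pi * s * S * F) * e

theorem discArea_capDisc (f : S2 → ℝ) {q a b : E3} (h : IsFrame q a b) (s : ℝ) :
    discArea f (capDisc q a b s) = ∫ x in Icc (0 : ℝ) 1 ×ˢ Icc (0 : ℝ) 1,
      2 * Real.pi * s * Real.sin (s * x.1) * f (capDisc q a b s x) := by
  simp only [← areaDensity_capDisc f h]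
  rfl

/-- For `s = π` the cap is exactly the spherical coordinate system of `integral_sphere_eq`; the
minus sign of the cosine there matches the centre `-q`. -/
theorem discArea_capDisc_pi {f : S2 → ℝ} (hf : Continuous f) {q a b : E3} (h : IsFrame q a b) :
    discArea f (capDisc q a b Real.pi) = ∫ x, f x ∂(volume : Measure E3).toSphere := by
  rw [discArea_capDisc f h, integral_sphere_eq hf (by rw [h.2]; norm_num) h.1]
  congr 1
  funext x
  rw [capDisc, capVec, Real.cos_pi, Real.sin_pi]
  congr 1
  · ring
  · congr 2
    congr 2
    · congr 1; ring
    · congr 1; ring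

theorem continuous_discArea_capDisc {f : S2 → ℝ} (hf : Continuous f) {q a b : E3}
    (h : IsFrame q a b) : Continuous fun s => discArea f (capDisc q a b s) := by
  simp only [discArea_capDisc f h]
  refine continuous_parametric_integral_of_continuous ?_ (isCompact_Icc.prod isCompact_Icc)
  have := hf.comp (continuous_capDisc h)
  refine Continuous.mul ?_ this
  fun_prop

/-- The area of the cap varies continuously from 0 at radius 0 to the total area 1 at radius π, so
the intermediate value theorem applies. All these caps have `q` on their boundary. -/
theorem exists_capLoop_area {f : S2 → ℝ} (hf : Continuous f)
    (htotal : ∫ x, f x ∂(volume : Measure E3).toSphere = 1) (q : S2) {y : ℝ} (h0 : 0 ≤ y)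
    (h1 : y ≤ 1) : ∃ (σ : Loop q) (D : ℝ × ℝ → S2), IsSpanningDisc σ D ∧ discArea f D = y := by
  obtain ⟨a, b, h⟩ := exists_frame q
  have e0 : discArea f (capDisc q a b 0) = 0 := by rw [discArea_capDisc f h]; simp
  have e1 : discArea f (capDisc q a b Real.pi) = 1 := by rw [discArea_capDisc_pi hf h, htotal]
  obtain ⟨s, -, hs⟩ := intermediate_value_Icc Real.pi_pos.le
    (continuous_discArea_capDisc hf h).continuousOn
    (show y ∈ Icc (discArea f (capDisc q a b 0)) (discArea f (capDisc q a b Real.pi)) by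
      rw [e0, e1]; exact ⟨h0, h1⟩)
  exact ⟨capLoop q h s, capDisc q a b s, isSpanningDisc_capLoop q h s, hs⟩

/-! ### Slices of the area integral -/

/-- Slicing reduces reversal in `θ` and rescaling in `r` to substitutions in one variable. -/
def areaSlice (f : S2 → ℝ) (D : ℝ × ℝ → S2) (r : ℝ) : ℝ := ∫ θ in (0 : ℝ)..1, areaDensity f D (r, θ)

theorem intervalIntegrable_areaSlice {f : S2 → ℝ} (hf : Continuous f) {σ : Loop x₀}
    {D : ℝ × ℝ → S2} (hD : IsSpanningDisc σ D) :
    IntervalIntegrable (areaSlice f D) volume 0 1 ∧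
      discArea f D = ∫ r in (0 : ℝ)..1, areaSlice f D r := by
  have hi := (tendsto_sum_cellArea hf hD).1
  have hs : areaSlice f D = fun r => ∫ θ in Ioc (0 : ℝ) 1, areaDensity f D (r, θ) := by
    funext r
    exact intervalIntegral.integral_of_le zero_le_one
  constructor
  · rw [intervalIntegrable_iff_integrableOn_Ioc_of_le zero_le_one, hs]
    rw [IntegrableOn, Measure.volume_eq_prod, ← Measure.prod_restrict] at hi
    exact hi.integral_prod_left
  · rw [discArea_eq, intervalIntegral.integral_of_le zero_le_one, hs, Measure.volume_eq_prod,
      setIntegral_prod _ hi]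

/-! ### Reversed discs -/

def flipDisc (D : ℝ × ℝ → S2) (p : ℝ × ℝ) : S2 := D (p.1, 1 - p.2)

theorem isSpanningDisc_flipDisc {σ : Loop x₀} {D : ℝ × ℝ → S2} (hD : IsSpanningDisc σ D) :
    IsSpanningDisc σ.symm (flipDisc D) where
  continuousOn := hD.continuousOn.comp (f := fun p : ℝ × ℝ => (p.1, 1 - p.2)) (by fun_prop)
    fun p hp => ⟨hp.1, by linarith [hp.2.2], by linarith [hp.2.1]⟩
  piecewise_smooth := by
    classical
    obtain ⟨F, G, h⟩ := hD.piecewise_smooth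
    refine ⟨F, G.image fun t => 1 - t, fun a b c d ha hab hb hc hcd hd hF hG => ?_⟩
    have key := h a b (1 - d) (1 - c) ha hab hb (by linarith) (by linarith) (by linarith) hF
      fun t ht hm => hG (1 - t) (Finset.mem_image_of_mem _ ht)
        ⟨by linarith [hm.2], by linarith [hm.1]⟩
    exact key.comp (f := fun p : ℝ × ℝ => (p.1, 1 - p.2))
      (contDiff_fst.prodMk (contDiff_const.sub contDiff_snd)).contDiffOn
      fun p hp => ⟨hp.1, by linarith [hp.2.2], by linarith [hp.2.1]⟩
  center := fun θ hθ => by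
    rw [flipDisc, flipDisc, hD.center (1 - θ) ⟨by linarith [hθ.2], by linarith [hθ.1]⟩,
      hD.center (1 - 0) ⟨by norm_num, by norm_num⟩]
  periodic := fun r hr => by
    simp only [flipDisc, sub_zero, sub_self]
    exact (hD.periodic r hr).symm
  boundary := fun θ hθ => by
    rw [fn_symm]
    exact hD.boundary _ ⟨by linarith [hθ.2], by linarith [hθ.1]⟩

theorem areaDensity_flipDisc (f : S2 → ℝ) (D : ℝ × ℝ → S2) (r θ : ℝ) :
    areaDensity f (flipDisc D) (r, θ) = -areaDensity f D (r, 1 - θ) := by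
  have h := deriv_comp_const_sub (fun θ => (D (r, θ) : E3)) 1 θ
  simp only [areaDensity, areaForm_eq, flipDisc]
  rw [h]
  simp only [det3_eq, PiLp.neg_apply]
  ring

theorem discArea_flipDisc {f : S2 → ℝ} (hf : Continuous f) {σ : Loop x₀}
    {D : ℝ × ℝ → S2} (hD : IsSpanningDisc σ D) : discArea f (flipDisc D) = -discArea f D := by
  rw [(intervalIntegrable_areaSlice hf hD).2,
    (intervalIntegrable_areaSlice hf (isSpanningDisc_flipDisc hD)).2,
    ← intervalIntegral.integral_neg]
  congr 1
  funext r
  simp only [areaSlice, areaDensity_flipDisc, intervalIntegral.integral_neg]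
  rw [intervalIntegral.integral_comp_sub_left (fun θ => areaDensity f D (r, θ))]
  norm_num

theorem symm_const : (Loop.const x₀).symm = Loop.const x₀ :=
  Loop.ext_fn fun t _ => by rw [fn_symm, fn_const, fn_const]

/-! ### Inserting a sphere at the centre of a disc -/

/-- `D` is pushed out to the annulus `1/2 ≤ r`, where its centre becomes a whole circle. The inner
half is filled by a disc `W` with constant boundary at that centre. -/
def glueDisc (W D : ℝ × ℝ → S2) (p : ℝ × ℝ) : S2 :=
  if p.1 ≤ 1 / 2 then W (2 * p.1, p.2) else D (2 * p.1 - 1, p.2)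

theorem glueDisc_left (W D : ℝ × ℝ → S2) {p : ℝ × ℝ} (h : p.1 ≤ 1 / 2) :
    glueDisc W D p = W (2 * p.1, p.2) := if_pos h

theorem glueDisc_right {σ : Loop x₀} {W D : ℝ × ℝ → S2} (hD : IsSpanningDisc σ D)
    (hW : IsSpanningDisc (Loop.const (D (0, 0))) W) {p : ℝ × ℝ} (h : 1 / 2 ≤ p.1)
    (hp : p.2 ∈ Icc (0 : ℝ) 1) : glueDisc W D p = D (2 * p.1 - 1, p.2) := by
  rcases h.eq_or_lt with h | h
  · rw [glueDisc_left W D h.ge, ← h]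
    norm_num
    rw [hW.boundary _ hp, fn_const, hD.center _ hp]
  · exact if_neg h.not_ge

theorem isSpanningDisc_glueDisc {σ : Loop x₀} {W D : ℝ × ℝ → S2} (hD : IsSpanningDisc σ D)
    (hW : IsSpanningDisc (Loop.const (D (0, 0))) W) : IsSpanningDisc σ (glueDisc W D) where
  continuousOn := by
    have h1 : ContinuousOn (glueDisc W D) (Icc 0 (1 / 2) ×ˢ Icc 0 1) :=
      (hW.continuousOn.comp (f := fun p : ℝ × ℝ => (2 * p.1, p.2)) (by fun_prop)
        fun p hp => ⟨⟨by linarith [hp.1.1], by linarith [hp.1.2]⟩, hp.2⟩).congr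
        fun p hp => glueDisc_left W D hp.1.2
    have h2 : ContinuousOn (glueDisc W D) (Icc (1 / 2) 1 ×ˢ Icc 0 1) :=
      (hD.continuousOn.comp (f := fun p : ℝ × ℝ => (2 * p.1 - 1, p.2)) (by fun_prop)
        fun p hp => ⟨⟨by linarith [hp.1.1], by linarith [hp.1.2]⟩, hp.2⟩).congr
        fun p hp => glueDisc_right hD hW hp.1.1 hp.2
    have h := h1.union_of_isClosed h2 (isClosed_Icc.prod isClosed_Icc)
      (isClosed_Icc.prod isClosed_Icc)
    rwa [← union_prod, Icc_union_Icc_eq_Icc (by norm_num) (by norm_num)] at h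
  piecewise_smooth := by
    classical
    obtain ⟨F, G, h⟩ := hW.piecewise_smooth
    obtain ⟨F', G', h'⟩ := hD.piecewise_smooth
    refine ⟨insert (1 / 2) (F.image (fun t => t / 2) ∪ F'.image (fun t => (t + 1) / 2)), G ∪ G',
      fun a b c d ha hab hb hc hcd hd hF hG => ?_⟩
    rcases le_or_gt b (1 / 2) with hb2 | hb2
    · have key := h (2 * a) (2 * b) c d (by linarith) (by linarith) (by linarith) hc hcd hd
        (fun t ht hm => hF (t / 2) (Finset.mem_insert_of_mem
          (Finset.mem_union_left _ (Finset.mem_image_of_mem _ ht)))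
          ⟨by linarith [hm.1], by linarith [hm.2]⟩)
        fun t ht => hG t (Finset.mem_union_left _ ht)
      refine (key.comp (f := fun p : ℝ × ℝ => (2 * p.1, p.2))
        ((contDiff_const.mul contDiff_fst).prodMk contDiff_snd).contDiffOn
        fun p hp => ⟨⟨by linarith [hp.1.1], by linarith [hp.1.2]⟩, hp.2⟩).congr fun p hp => ?_
      rw [glueDisc_left W D (hp.1.2.trans hb2)]
      rfl
    · have ha2 : 1 / 2 ≤ a := by
        by_contra hlt
        exact hF (1 / 2) (Finset.mem_insert_self _ _) ⟨by linarith, hb2⟩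
      have key := h' (2 * a - 1) (2 * b - 1) c d (by linarith) (by linarith) (by linarith) hc hcd hd
        (fun t ht hm => hF ((t + 1) / 2) (Finset.mem_insert_of_mem
          (Finset.mem_union_right _ (Finset.mem_image_of_mem _ ht)))
          ⟨by linarith [hm.1], by linarith [hm.2]⟩)
        fun t ht => hG t (Finset.mem_union_right _ ht)
      refine (key.comp (f := fun p : ℝ × ℝ => (2 * p.1 - 1, p.2))
        (((contDiff_const.mul contDiff_fst).sub contDiff_const).prodMk contDiff_snd).contDiffOn
        fun p hp => ⟨⟨by linarith [hp.1.1], by linarith [hp.1.2]⟩, hp.2⟩).congr fun p hp => ?_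
      rw [glueDisc_right hD hW (ha2.trans hp.1.1) ⟨hc.trans hp.2.1, hp.2.2.trans hd⟩]
      rfl
  center := fun θ hθ => by
    rw [glueDisc_left W D (by norm_num), glueDisc_left W D (by norm_num)]
    simp only [mul_zero]
    exact hW.center θ hθ
  periodic := fun r hr => by
    rcases le_or_gt r (1 / 2) with h | h
    · rw [glueDisc_left W D h, glueDisc_left W D h]
      exact hW.periodic _ ⟨by linarith [hr.1], by linarith⟩
    · rw [glueDisc_right hD hW h.le (by simp), glueDisc_right hD hW h.le (by simp)]
      exact hD.periodic _ ⟨by linarith, by linarith [hr.2]⟩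
  boundary := fun θ hθ => by
    rw [glueDisc_right hD hW (by norm_num) hθ]
    norm_num
    exact hD.boundary θ hθ

/-- The chain rule in `r` contributes the factor `k`, which later compensates the shortened range of
`r`. -/
theorem areaSlice_of_eventuallyEq {f : S2 → ℝ} {E D : ℝ × ℝ → S2} {k c r : ℝ}
    (h : ∀ᶠ s in 𝓝 r, ∀ θ, E (s, θ) = D (k * s + c, θ)) :
    areaSlice f E r = k * areaSlice f D (k * r + c) := by
  have hr := h.self_of_nhds
  rw [areaSlice, areaSlice, ← intervalIntegral.integral_const_mul]
  congr 1
  funext θ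
  have h1 : deriv (fun s => (E (s, θ) : E3)) r =
      k • deriv (fun s => (D (s, θ) : E3)) (k * r + c) := by
    have he : (fun s => (E (s, θ) : E3)) =ᶠ[𝓝 r] fun s => (D (k * s + c, θ) : E3) := by
      filter_upwards [h] with s hs
      rw [hs]
    rw [he.deriv_eq, deriv_comp_mul_left k (fun s => (D (s + c, θ) : E3)),
      deriv_comp_add_const (fun s => (D (s, θ) : E3))]
  simp only [areaDensity, areaForm_eq, h1, hr]
  simp only [det3_eq, PiLp.smul_apply, smul_eq_mul]
  ring

theorem discArea_glueDisc {f : S2 → ℝ} (hf : Continuous f) {σ : Loop x₀} {W D : ℝ × ℝ → S2}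
    (hD : IsSpanningDisc σ D) (hW : IsSpanningDisc (Loop.const (D (0, 0))) W) :
    discArea f (glueDisc W D) = discArea f W + discArea f D := by
  obtain ⟨i, e⟩ := intervalIntegrable_areaSlice hf (isSpanningDisc_glueDisc hD hW)
  -- Open intervals are used because the radial derivative need not exist on the seam `r = 1/2`.
  have hl : ∀ r ∈ Ioo (0 : ℝ) (1 / 2),
      areaSlice f (glueDisc W D) r = 2 * areaSlice f W (2 * r) := fun r hr => by
    rw [areaSlice_of_eventuallyEq (k := 2) (c := 0) (D := W), add_zero]
    filter_upwards [Iio_mem_nhds hr.2] with s hs θ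
    rw [glueDisc_left W D (p := (s, θ)) (mem_Iio.1 hs).le, add_zero]
  have hr : ∀ r ∈ Ioo (1 / 2 : ℝ) 1,
      areaSlice f (glueDisc W D) r = 2 * areaSlice f D (2 * r - 1) := fun r hr => by
    rw [areaSlice_of_eventuallyEq (k := 2) (c := -1) (D := D), ← sub_eq_add_neg]
    filter_upwards [Ioi_mem_nhds hr.1] with s hs θ
    rw [← sub_eq_add_neg]
    exact if_neg (not_le.2 hs)
  rw [e, ← intervalIntegral.integral_add_adjacent_intervals (b := 1 / 2)
    (i.mono_set (by
      rw [uIcc_of_le, uIcc_of_le] <;> [apply Icc_subset_Icc; skip; skip] <;> norm_num))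
    (i.mono_set (by
      rw [uIcc_of_le, uIcc_of_le] <;> [apply Icc_subset_Icc; skip; skip] <;> norm_num)),
    (intervalIntegrable_areaSlice hf hW).2, (intervalIntegrable_areaSlice hf hD).2]
  congr 1
  · rw [intervalIntegral.integral_of_le (by norm_num), integral_Ioc_eq_integral_Ioo,
      setIntegral_congr_fun measurableSet_Ioo hl, ← integral_Ioc_eq_integral_Ioo,
      ← intervalIntegral.integral_of_le (by norm_num), intervalIntegral.integral_const_mul,
      intervalIntegral.mul_integral_comp_mul_left]
    norm_num
  · rw [intervalIntegral.integral_of_le (by norm_num), integral_Ioc_eq_integral_Ioo,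
      setIntegral_congr_fun measurableSet_Ioo hr, ← integral_Ioc_eq_integral_Ioo,
      ← intervalIntegral.integral_of_le (by norm_num), intervalIntegral.integral_const_mul,
      intervalIntegral.mul_integral_comp_mul_sub]
    norm_num

/-- Gluing in a disc that covers the sphere once, or its reversal, changes the area by 1 or -1 and
keeps the boundary. -/
theorem exists_disc_add_int {f : S2 → ℝ} (hf : Continuous f)
    (htotal : ∫ x, f x ∂(volume : Measure E3).toSphere = 1) {σ : Loop x₀} {D : ℝ × ℝ → S2}
    (hD : IsSpanningDisc σ D) (n : ℤ) :
    ∃ E, IsSpanningDisc σ E ∧ discArea f E = discArea f D + n := by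
  have step : ∀ E, IsSpanningDisc σ E →
      (∃ E', IsSpanningDisc σ E' ∧ discArea f E' = 1 + discArea f E) ∧
      ∃ E', IsSpanningDisc σ E' ∧ discArea f E' = -1 + discArea f E := fun E hE => by
    obtain ⟨a, b, h⟩ := exists_frame (E (0, 0))
    have hW := isSpanningDisc_capDisc_pi (E (0, 0)) h
    have hA := discArea_capDisc_pi hf h
    rw [htotal] at hA
    have hW' := isSpanningDisc_flipDisc hW
    have hA' := discArea_flipDisc hf hW
    rw [hA] at hA'
    rw [symm_const] at hW'
    exact ⟨⟨_, isSpanningDisc_glueDisc hE hW, by rw [discArea_glueDisc hf hE hW, hA]⟩,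
      ⟨_, isSpanningDisc_glueDisc hE hW', by rw [discArea_glueDisc hf hE hW', hA']⟩⟩
  induction n with
  | zero => exact ⟨D, hD, by simp⟩
  | succ n ih =>
    obtain ⟨E, hE, h⟩ := ih
    obtain ⟨E', hE', h'⟩ := (step E hE).1
    exact ⟨E', hE', by rw [h', h]; push_cast; ring⟩
  | pred n ih =>
    obtain ⟨E, hE, h⟩ := ih
    obtain ⟨E', hE', h'⟩ := (step E hE).2
    exact ⟨E', hE', by rw [h', h]; push_cast; ring⟩

/-! ### The area homomorphism -/

/-- Almost every `p` is suitable for both discs, and the holonomy from a common `p` knows only the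
loop. -/
theorem coe_discArea_eq {f : S2 → ℝ} (hf : Continuous f)
    (htotal : ∫ x, f x ∂(volume : Measure E3).toSphere = 1)
    {σ : Loop x₀} {D E : ℝ × ℝ → S2} (hD : IsSpanningDisc σ D) (hE : IsSpanningDisc σ E) :
    ((discArea f D : ℝ) : AddCircle (1 : ℝ)) = (discArea f E : ℝ) := by
  obtain ⟨p, h1, h2⟩ :=
    ((ae_discArea_eq_hol hf htotal hD).and (ae_discArea_eq_hol hf htotal hE)).exists
  rw [h1, h2]

theorem coe_discArea_eq_of_move {f : S2 → ℝ} (hf : Continuous f)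
    (htotal : ∫ x, f x ∂(volume : Measure E3).toSphere = 1)
    {σ τ : Loop x₀} (h : Move σ τ) {D E : ℝ × ℝ → S2} (hD : IsSpanningDisc σ D)
    (hE : IsSpanningDisc τ E) :
    ((discArea f D : ℝ) : AddCircle (1 : ℝ)) = (discArea f E : ℝ) := by
  obtain ⟨p, ⟨h1, h2⟩, h3, h4⟩ :=
    (((ae_discArea_eq_hol hf htotal hD).and (ae_discArea_eq_hol hf htotal hE)).and
      ((ae_avoids σ).and (ae_avoids τ))).exists
  rw [h1, h2, hol_eq_of_move hf h3 h4 h]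

theorem coe_discArea_trans {f : S2 → ℝ} (hf : Continuous f)
    (htotal : ∫ x, f x ∂(volume : Measure E3).toSphere = 1)
    {σ τ : Loop x₀} {D E B : ℝ × ℝ → S2} (hD : IsSpanningDisc σ D) (hE : IsSpanningDisc τ E)
    (hB : IsSpanningDisc (σ.trans τ) B) :
    ((discArea f B : ℝ) : AddCircle (1 : ℝ)) = (discArea f D : ℝ) + (discArea f E : ℝ) := by
  obtain ⟨p, ⟨h1, h2, h3⟩, h4, h5, h6⟩ :=
    (((ae_discArea_eq_hol hf htotal hD).and ((ae_discArea_eq_hol hf htotal hE).and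
      (ae_discArea_eq_hol hf htotal hB))).and
      ((ae_avoids σ).and ((ae_avoids τ).and (ae_avoids (σ.trans τ))))).exists
  rw [h1, h2, h3, hol_trans hf h4 h5 h6, AddCircle.coe_add]

/-- The area enclosed by a loop, modulo the total area. -/
def enclosedArea (f : S2 → ℝ) (σ : Loop x₀) : AddCircle (1 : ℝ) :=
  (discArea f (exists_spanningDisc σ).choose : ℝ)

theorem enclosedArea_eq {f : S2 → ℝ} (hf : Continuous f)
    (htotal : ∫ x, f x ∂(volume : Measure E3).toSphere = 1)
    {σ : Loop x₀} {D : ℝ × ℝ → S2} (hD : IsSpanningDisc σ D) :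
    enclosedArea f σ = (discArea f D : ℝ) :=
  coe_discArea_eq hf htotal (exists_spanningDisc σ).choose_spec hD

/-- The enclosed area as a homomorphism on the path group. -/
def areaHom {f : S2 → ℝ} (hf : Continuous f)
    (htotal : ∫ x, f x ∂(volume : Measure E3).toSphere = 1) (x₀ : S2) :
    PathGroup x₀ →* Multiplicative (AddCircle (1 : ℝ)) :=
  MonoidHom.mk' (Quot.lift (fun σ => Multiplicative.ofAdd (enclosedArea f σ)) fun σ τ h =>
      congrArg Multiplicative.ofAdd (coe_discArea_eq_of_move hf htotal h
        (exists_spanningDisc σ).choose_spec (exists_spanningDisc τ).choose_spec)) <| by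
    rintro ⟨σ⟩ ⟨τ⟩
    -- In a product the second factor is traversed first, so the two areas appear in exchanged
    -- order.
    refine congrArg Multiplicative.ofAdd ((coe_discArea_trans hf htotal
      (exists_spanningDisc τ).choose_spec (exists_spanningDisc σ).choose_spec
      (exists_spanningDisc (τ.trans σ)).choose_spec).trans (add_comm _ _))

theorem areaHom_mk {f : S2 → ℝ} (hf : Continuous f)
    (htotal : ∫ x, f x ∂(volume : Measure E3).toSphere = 1)
    {σ : Loop x₀} {D : ℝ × ℝ → S2} (hD : IsSpanningDisc σ D) :
    areaHom hf htotal x₀ (PathGroup.mk σ) =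
      Multiplicative.ofAdd ((discArea f D : ℝ) : AddCircle (1 : ℝ)) :=
  congrArg Multiplicative.ofAdd (enclosedArea_eq hf htotal hD)

theorem exists_int_of_coe_eq {a b : ℝ} (h : (a : AddCircle (1 : ℝ)) = b) :
    ∃ n : ℤ, b = a + n := by
  have h' : ((b - a : ℝ) : AddCircle (1 : ℝ)) = 0 := by rw [AddCircle.coe_sub, h, sub_self]
  obtain ⟨n, hn⟩ := (AddCircle.coe_eq_zero_iff 1).1 h'
  exact ⟨n, by rw [zsmul_one] at hn; linarith⟩

theorem exists_disc_of_coe_eq {f : S2 → ℝ} (hf : Continuous f)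
    (htotal : ∫ x, f x ∂(volume : Measure E3).toSphere = 1)
    {σ : Loop x₀} {D : ℝ × ℝ → S2} (hD : IsSpanningDisc σ D) {y : ℝ}
    (h : ((discArea f D : ℝ) : AddCircle (1 : ℝ)) = (y : ℝ)) :
    ∃ E, IsSpanningDisc σ E ∧ discArea f E = y := by
  obtain ⟨n, rfl⟩ := exists_int_of_coe_eq h
  exact exists_disc_add_int hf htotal hD n

theorem areaHom_surjective {f : S2 → ℝ} (hf : Continuous f)
    (htotal : ∫ x, f x ∂(volume : Measure E3).toSphere = 1) (x₀ : S2) :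
    Function.Surjective (areaHom hf htotal x₀) := by
  intro y
  obtain ⟨y, rfl⟩ := Multiplicative.ofAdd.surjective y
  obtain ⟨t, rfl⟩ := QuotientAddGroup.mk_surjective y
  obtain ⟨σ, D, hD, h⟩ := exists_capLoop_area hf htotal x₀ (Int.fract_nonneg t)
    (Int.fract_lt_one t).le
  refine ⟨PathGroup.mk σ, ?_⟩
  rw [areaHom_mk hf htotal hD, h, Int.fract, AddCircle.coe_sub]
  have : ((⌊t⌋ : ℝ) : AddCircle (1 : ℝ)) = 0 :=
    (AddCircle.coe_eq_zero_iff 1).2 ⟨⌊t⌋, by simp⟩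
  rw [this, sub_zero]

/-- A loop in the kernel has a disc of integral area, and inserted spheres bring this area to 0
without changing the loop. -/
theorem coe_ker_areaHom {f : S2 → ℝ} (hf : Continuous f)
    (htotal : ∫ x, f x ∂(volume : Measure E3).toSphere = 1) (x₀ : S2) :
    ((areaHom hf htotal x₀).ker : Set (PathGroup x₀)) = zeroAreaClasses f x₀ := by
  ext ⟨σ⟩
  change areaHom hf htotal x₀ (PathGroup.mk σ) = 1 ↔ _
  constructor
  · intro h
    obtain ⟨D, hD⟩ := exists_spanningDisc σ
    rw [areaHom_mk hf htotal hD] at h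
    obtain ⟨E, hE, h'⟩ := exists_disc_of_coe_eq hf htotal hD (y := 0)
      (Multiplicative.ofAdd.injective h)
    exact ⟨σ, rfl, E, hE, h'⟩
  · rintro ⟨τ, h, E, hE, h'⟩
    change PathGroup.mk τ = PathGroup.mk σ at h
    rw [← h, areaHom_mk hf htotal hE, h', AddCircle.coe_zero, ofAdd_zero]

/-- The group isomorphism between `ℝ / ℤ` and the unit circle. -/
def addCircleMulEquivCircle : Multiplicative (AddCircle (1 : ℝ)) ≃* Circle :=
  MulEquiv.ofBijective
    (MonoidHom.mk' (fun x => AddCircle.toCircle (Multiplicative.toAdd x))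
      fun _ _ => AddCircle.toCircle_add _ _)
    ⟨fun _ _ h => AddCircle.injective_toCircle one_ne_zero h, fun z => by
      obtain ⟨x, hx⟩ := (AddCircle.homeomorphCircle (one_ne_zero (α := ℝ))).surjective z
      exact ⟨Multiplicative.ofAdd x, by rw [← hx, AddCircle.homeomorphCircle_apply]; rfl⟩⟩

end SpherePaths

end

/-! ### Assembly: the first isomorphism theorem and the coset of areas. -/

theorem theorem2p3 (x₀ : SpherePaths.S2) (f : SpherePaths.S2 → ℝ)
    (hf : ContMDiff (𝓡 2) 𝓘(ℝ, ℝ) ∞ f) (hpos : ∀ x, 0 < f x)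
    (htotal : ∫ x, f x ∂(volume : Measure SpherePaths.E3).toSphere = 1) :
    (∃ N : Subgroup (SpherePaths.PathGroup x₀),
      (N : Set (SpherePaths.PathGroup x₀)) = SpherePaths.zeroAreaClasses f x₀ ∧
      ∃ _ : N.Normal,
        Nonempty ((SpherePaths.PathGroup x₀ ⧸ N) ≃* Circle) ∧
        ∃ e : (SpherePaths.PathGroup x₀ ⧸ N) ≃* Multiplicative (AddCircle (1 : ℝ)),
          ∀ (σ : SpherePaths.Loop x₀) (D : ℝ × ℝ → SpherePaths.S2),
            SpherePaths.IsSpanningDisc σ D →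
            e (QuotientGroup.mk (SpherePaths.PathGroup.mk σ)) =
              Multiplicative.ofAdd ((SpherePaths.discArea f D : ℝ) : AddCircle (1 : ℝ))) ∧
    (∀ σ : SpherePaths.Loop x₀, ∃ a : ℝ, ∀ b : ℝ,
      (∃ D, SpherePaths.IsSpanningDisc σ D ∧ SpherePaths.discArea f D = b) ↔
        ∃ n : ℤ, b = a + n) := by
  have hc := hf.continuous
  refine ⟨⟨(SpherePaths.areaHom hc htotal x₀).ker, SpherePaths.coe_ker_areaHom hc htotal x₀,
    inferInstance, ?_⟩,
    fun σ => ?_⟩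
  · let e := QuotientGroup.quotientKerEquivOfSurjective _
      (SpherePaths.areaHom_surjective hc htotal x₀)
    exact ⟨⟨e.trans SpherePaths.addCircleMulEquivCircle⟩, e, fun σ D hD =>
      SpherePaths.areaHom_mk hc htotal hD⟩
  · obtain ⟨D, hD⟩ := SpherePaths.exists_spanningDisc σ
    refine ⟨SpherePaths.discArea f D, fun b => ⟨?_, ?_⟩⟩
    · rintro ⟨E, hE, rfl⟩
      obtain ⟨n, hn⟩ := SpherePaths.exists_int_of_coe_eq
        (SpherePaths.coe_discArea_eq hc htotal hD hE)
      exact ⟨n, hn⟩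
    · rintro ⟨n, rfl⟩
      exact SpherePaths.exists_disc_add_int hc htotal hD n
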